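/- An instance of the Euclidean TSP is a finite set $V \subset \mathbb{R}^2$ with $n \ge 3$ points; let $c(x,y)$ denote the Euclidean distance. A tour for $V$ is a cycle in the complete graph on $V$ that contains all points of $V$; its length is the sum of the Euclidean lengths of its edges, and a tour is optimal if it has minimum length among all tours for $V$. Orient a tour $T$ as a directed cycle. If two distinct directed edges $(a,b)$ and $(x,y)$ of $T$ satisfy $c(a,x)+c(b,y) < c(a,b)+c(x,y)$, then replacing them by the edges $\{a,x\}$ and $\{b,y\}$ gives a shorter tour; this is called an improving 2-move. The 2-Opt heuristic starts with an arbitrary tour, performs improving 2-moves as long as one exists, and returns the tour reached; the tours it can return are exactly the 2-optimal tours, i.e. those with no improving 2-move. For $n \ge 3$ let $\rho(n)$ be the approximation ratio of the 2-Opt heuristic on instances with $n$ points, i.e. the supremum, over all $V \subset \mathbb{R}^2$ with $|V| = n$ and all tours $S$ for $V$ that the heuristic can return, of the length of $S$ divided by the length of an optimal tour for $V$. **Theorem.** For every $n \ge 3$ the supremum $\rho(n)$ is taken over a nonempty bounded set of real numbers, and $$\rho(n) = \Theta\!\left(\frac{\log n}{\log\log n}\right) \qquad (n \to \infty),$$ i.e.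 there are constants $c, C > 0$ and $n_0$ such that $c\,\frac{\log n}{\log\log n} \le \rho(n) \le C\,\frac{\log n}{\log\log n}$ for all $n \ge n_0$. -/

import Mathlib

namespace EuclideanTSP

/-- The Euclidean plane. -/
abbrev Plane : Type := EuclideanSpace ℝ (Fin 2)

/-- An oriented tour for the finite point set `V`, given by its successor map `σ`: the oriented
edges are the pairs `(v, σ v)`, and they form one single cycle through all the points of `V`.
As a cycle in a graph, a tour has at least three vertices. -/
def IsTour {V : Finset Plane} (σ : Equiv.Perm V) : Prop :=
  3 ≤ V.card ∧ σ.IsCycleOn Set.univ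

/-- The set of (unoriented) edges of a tour. -/
def edges {V : Finset Plane} (σ : Equiv.Perm V) : Set (Sym2 V) :=
  Set.range fun v : V => s(v, σ v)

/-- The length of a tour: the sum of the Euclidean lengths of its edges. -/
noncomputable def length {V : Finset Plane} (σ : Equiv.Perm V) : ℝ :=
  ∑ v : V, dist v (σ v)

/-- An optimal tour: a tour of minimum length among all tours for `V`. -/
def IsOptimalTour {V : Finset Plane} (σ : Equiv.Perm V) : Prop :=
  IsTour σ ∧ ∀ τ : Equiv.Perm V, IsTour τ → length σ ≤ length τ

/-- The two oriented edges `(a, σ a)` and `(x, σ x)` are distinct and violate the 2-optimality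
condition: the edges `{a, x}` and `{σ a, σ x}` are together strictly shorter. -/
def IsImprovingPair {V : Finset Plane} (σ : Equiv.Perm V) (a x : V) : Prop :=
  a ≠ x ∧ dist a x + dist (σ a) (σ x) < dist a (σ a) + dist x (σ x)

/-- `τ` is a tour that results from the tour `σ` by an improving 2-move: two oriented edges
`(a, b)` and `(x, y)` of `σ` that violate the 2-optimality condition are replaced by `{a, x}` and
`{b, y}`. The orientation of the resulting cycle may be chosen freely. -/
def ImprovingTwoMove {V : Finset Plane} (σ τ : Equiv.Perm V) : Prop :=
  IsTour σ ∧ IsTour τ ∧ ∃ a x : V, IsImprovingPair σ a x ∧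
    edges τ = (edges σ \ {s(a, σ a), s(x, σ x)}) ∪ {s(a, x), s(σ a, σ x)}

/-- A 2-optimal tour: for any two distinct oriented edges `(a, b)` and `(x, y)` of the tour,
`c(a, x) + c(b, y) ≥ c(a, b) + c(x, y)`. -/
def IsTwoOptimal {V : Finset Plane} (σ : Equiv.Perm V) : Prop :=
  IsTour σ ∧ ∀ a x : V, a ≠ x →
    dist a (σ a) + dist x (σ x) ≤ dist a x + dist (σ a) (σ x)

/-- `σ` is a possible output of the 2-Opt heuristic: start with an arbitrary tour, perform
improving 2-moves, and stop at a tour that is 2-optimal, i.e. has no improving 2-move. -/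
def IsTwoOptOutput {V : Finset Plane} (σ : Equiv.Perm V) : Prop :=
  ∃ σ₀ : Equiv.Perm V, IsTour σ₀ ∧ Relation.ReflTransGen ImprovingTwoMove σ₀ σ ∧ IsTwoOptimal σ

/-- All ratios between the length of an output of the 2-Opt heuristic and the length of an optimal
tour, over all Euclidean TSP instances with exactly `n` points. -/
def twoOptRatios (n : ℕ) : Set ℝ :=
  {r | ∃ V : Finset Plane, V.card = n ∧ ∃ σ τ : Equiv.Perm V,
    IsTwoOptOutput σ ∧ IsOptimalTour τ ∧ r = length σ / length τ}

/-- The (worst-case) approximation ratio of the 2-Opt heuristic for Euclidean TSP instances with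
`n` points. -/
noncomputable def twoOptApproxRatio (n : ℕ) : ℝ :=
  sSup (twoOptRatios n)

end EuclideanTSP

/-! ### Entropy bound for weights on a rooted tree -/

namespace EuclideanTSP

/-! Upper bound. Compare a 2-optimal tour with a short simple polygon through its points. Optimal
tours are 2-optimal, and a 2-optimal tour whose points are not collinear has no crossings or
overlaps; one extra point destroys collinearity and at most doubles the optimum. Subdivide polygon
and tour where they meet (`length_le_of_simplePolygon`). Splitting a directed edge preserves
2-optimality by the triangle inequality, so the tour becomes a 2-optimal family of polynomially many
chords and edges of a polygon.

Sort these chords by direction along the polygon and by the side of the polygon on which they lie: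
four classes. Two chords of one class whose end points interleave would have to meet, since disjoint
interleaved chords lie on different sides (`interleaved_parity`, proved by counting ray crossings
mod 2); but 2-optimal segments meet only if collinear, and a chord contains no further vertex. So
every class is laminar and forms a tree under inclusion of index intervals. Take a chord `e` and a
child `f`. The two replacement edges of the 2-move on `e` and `f` are bounded by walking from the
ends of `e` to those of `f` along the other children and the polygon edges not covered by children.
Hence c(e) + 2c(f) ≤ S(e) + g(e), where S(e) is the sum over the children and g(e) the uncovered
length (`sum_laminar_le`).

With M(e) the largest child and T the polygon length, summing gives ΣM ≤ T/2. So large weights S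
need nodes that split into many small children, and an entropy potential bounds how often that
happens: ΣS·log(S/M) ≤ T(1 + 2 log N). Separating nodes with S ≤ K·M from the others gives ΣS ≤
T(K/2 + (1 + 2 log N)/log K) (`sum_tree_le`). Choosing K = √(log n) yields O(log n / log log n); any
fixed K shows that the ratios are bounded.

Lower bound. For odd d stack d + 1 horizontal layers at heights 2/d^(i+1), with d^i equal steps in
layer i < d and a very fine last layer. The tour snakes through all layers, rightwards in even and
leftwards in odd ones, and returns by a vertical edge at abscissa -1. Every layer has width at least
1, so the tour has length at least d. It is 2-optimal: adjacent layers run in opposite directions,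
and equally directed layers are so far apart that the squared distance exceeds the product of their
step lengths. But a closed walk along the last layer with a detour to every other point has length
at most 16, since layer i has about d^i points at height 2/d^(i+1) and thus costs O(1/d). This uses
about d^d points, so d can be of order log n / log log n; the fineness of the last layer is used to
hit every n exactly. -/

/-- The entropy-like function `x (1 + log A - log x)`. -/
noncomputable def entropyTerm (A x : ℝ) : ℝ := x * (1 + Real.log A - Real.log x)

/-- The derivative in x is log A - log x, which is nonnegative up to A. The inequality log(y/x) ≤
y/x - 1 replaces calculus. -/
lemma entropyTerm_mono {A x y : ℝ} (hx : 0 ≤ x) (hxy : x ≤ y) (hy : y ≤ A) :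
    entropyTerm A x ≤ entropyTerm A y := by
  unfold entropyTerm
  rcases hx.eq_or_lt with rfl | hx
  · rcases hxy.eq_or_lt with rfl | hy0
    · simp
    · have := Real.log_le_log hy0 hy
      simp only [zero_mul]
      apply mul_nonneg hy0.le
      linarith
  · have hy0 : 0 < y := hx.trans_le hxy
    have h1 := Real.log_le_log hy0 hy
    have h2 : Real.log y - Real.log x ≤ y / x - 1 := by
      rw [← Real.log_div hy0.ne' hx.ne']
      exact Real.log_le_sub_one_of_pos (by positivity)
    have h3 : x * (Real.log y - Real.log x) ≤ y - x := by
      calc _ ≤ x * (y / x - 1) := by gcongr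
        _ = _ := by field_simp
    nlinarith [mul_nonneg (sub_nonneg.2 hxy) (sub_nonneg.2 h1)]

/-- The quotient `entropyTerm A x / x` decreases in x. -/
lemma entropyTerm_add_le {A x y : ℝ} (hx : 0 ≤ x) (hy : 0 ≤ y) :
    entropyTerm A (x + y) ≤ entropyTerm A x + entropyTerm A y := by
  unfold entropyTerm
  rcases hx.eq_or_lt with rfl | hx
  · simp
  rcases hy.eq_or_lt with rfl | hy
  · simp
  have h1 : Real.log x ≤ Real.log (x + y) := Real.log_le_log hx (by linarith)
  have h2 : Real.log y ≤ Real.log (x + y) := Real.log_le_log hy (by linarith)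
  nlinarith [mul_le_mul_of_nonneg_left h1 hx.le, mul_le_mul_of_nonneg_left h2 hy.le]

/-- Summing a weight on a rooted tree in which the weight of every node plus twice the largest
weight of a child is at most the sum of the weights of the children plus a gap term. -/
lemma sum_tree_le {α : Type*} [DecidableEq α] (P F : Finset α) (par : α → α) (c g M : α → ℝ)
    {T K : ℝ} (hFP : F ⊆ P) (hpar : ∀ f ∈ F, par f ∈ P) (hc0 : ∀ e ∈ P, 0 ≤ c e)
    (hcT : ∀ f ∈ F, c f ≤ T) (hroot : ∀ e ∈ P, e ∉ F → c e = 0) (hg0 : ∀ e ∈ P, 0 ≤ g e)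
    (hgT : ∑ e ∈ P, g e = T) (hK : 1 < K) (hM : ∀ f ∈ F, c f ≤ M (par f))
    (hM0 : ∀ e ∈ P, 0 ≤ M e) (hMS : ∀ e ∈ P, M e ≤ ∑ f ∈ F with par f = e, c f)
    (hcM : ∀ e ∈ P, c e + 2 * M e ≤ (∑ f ∈ F with par f = e, c f) + g e)
    (hT : 0 < T) (hcard : F.card + 1 ≤ P.card) :
    ∑ f ∈ F, c f ≤ T * (K / 2 + (1 + 2 * Real.log P.card) / Real.log K) := by
  set S : α → ℝ := fun e => ∑ f ∈ F with par f = e, c f with hS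
  set N : ℝ := (P.card : ℝ) with hN
  have hN1 : (F.card : ℝ) + 1 ≤ N := by rw [hN]; exact_mod_cast hcard
  have hN0 : 0 < N := by linarith [(Nat.cast_nonneg F.card : (0 : ℝ) ≤ F.card)]
  set A := N * T with hA
  have hA0 : 0 < A := by positivity
  have hlogK : 0 < Real.log K := Real.log_pos hK
  have hSsum : ∑ e ∈ P, S e = ∑ f ∈ F, c f := Finset.sum_fiberwise_of_maps_to hpar c
  have hcF : ∀ f ∈ F, 0 ≤ c f := fun f hf => hc0 f (hFP hf)
  have hS0 : ∀ e, 0 ≤ S e := fun e =>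
    Finset.sum_nonneg fun f hf => hcF f (Finset.mem_filter.1 hf).1
  have hcP : ∑ e ∈ P, c e = ∑ f ∈ F, c f := (Finset.sum_subset hFP hroot).symm
  -- Every non-root is the child of exactly one node and the root has weight 0, so the weights c
  -- cancel against the sums S.
  have hMsum : ∑ e ∈ P, M e ≤ T / 2 := by
    have := Finset.sum_le_sum hcM
    rw [Finset.sum_add_distrib, Finset.sum_add_distrib, ← Finset.mul_sum] at this
    change _ ≤ ∑ e ∈ P, S e + _ at this
    linarith
  have hhP : ∑ e ∈ P, entropyTerm A (c e) = ∑ f ∈ F, entropyTerm A (c f) := by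
    refine (Finset.sum_subset hFP fun e he hne => ?_).symm
    rw [hroot e he hne]; simp [entropyTerm]
  have hhF : ∑ e ∈ P, ∑ f ∈ F with par f = e, entropyTerm A (c f) =
      ∑ f ∈ F, entropyTerm A (c f) := Finset.sum_fiberwise_of_maps_to hpar _
  -- Each child weighs at most M(e), so splitting S(e) into its children raises the entropy by at
  -- least S log(S/M).
  have hchild : ∀ e ∈ P, entropyTerm A (S e) + S e * (Real.log (S e) - Real.log (M e)) ≤
      ∑ f ∈ F with par f = e, entropyTerm A (c f) := by
    intro e he
    have h1 : entropyTerm A (S e) + S e * (Real.log (S e) - Real.log (M e)) =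
        ∑ f ∈ F with par f = e, c f * (1 + Real.log A - Real.log (M e)) := by
      rw [← Finset.sum_mul]; unfold entropyTerm; simp only [hS]; ring
    rw [h1]
    refine Finset.sum_le_sum fun f hf => ?_
    obtain ⟨hfF, rfl⟩ := Finset.mem_filter.1 hf
    rcases (hcF f hfF).eq_or_lt with h0 | h0
    · rw [← h0]; simp [entropyTerm]
    · have := Real.log_le_log h0 (hM f hfF)
      unfold entropyTerm
      gcongr
  have hgle : ∀ e ∈ P, g e ≤ T := fun e he => hgT ▸ Finset.single_le_sum hg0 he
  have hSg : ∀ e ∈ P, S e + g e ≤ A := by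
    intro e he
    have h1 : S e ≤ F.card * T := by
      calc S e ≤ ∑ f ∈ F, c f :=
            Finset.sum_le_sum_of_subset_of_nonneg (Finset.filter_subset _ _) fun f hf _ => hcF f hf
        _ ≤ ∑ f ∈ F, T := Finset.sum_le_sum hcT
        _ = _ := by simp
    nlinarith [hgle e he]
  have hpt : ∀ e ∈ P, entropyTerm A (c e) ≤ entropyTerm A (S e) + entropyTerm A (g e) := by
    intro e he
    refine le_trans (entropyTerm_mono (hc0 e he) ?_ (hSg e he)) (entropyTerm_add_le (hS0 e) (hg0 e he))
    have := hcM e he; have := hM0 e he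
    simp only [hS]; linarith
  -- Both sides contain the entropy of all nodes, once as nodes and once as children; only the gap
  -- terms remain to pay for the splitting.
  have hent : ∑ e ∈ P, S e * (Real.log (S e) - Real.log (M e)) ≤ ∑ e ∈ P, entropyTerm A (g e) := by
    have h1 := Finset.sum_le_sum hchild
    have h2 := Finset.sum_le_sum hpt
    rw [Finset.sum_add_distrib] at h1 h2
    linarith
  -- The total entropy of the gaps is largest when all N gaps equal T/N; the pointwise bound is the
  -- tangent there.
  have hgent : ∑ e ∈ P, entropyTerm A (g e) ≤ T * (1 + 2 * Real.log N) := by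
    have : ∀ e ∈ P, entropyTerm A (g e) ≤ g e * (2 * Real.log N) + T / N := by
      intro e he
      unfold entropyTerm
      rcases (hg0 e he).eq_or_lt with h0 | h0
      · rw [← h0]; simp; positivity
      · have h1 : Real.log (T / (N * g e)) ≤ T / (N * g e) - 1 :=
          Real.log_le_sub_one_of_pos (by positivity)
        rw [Real.log_div hT.ne' (by positivity), Real.log_mul hN0.ne' h0.ne'] at h1
        rw [hA, Real.log_mul hN0.ne' hT.ne']
        have h2 : g e * (T / (N * g e) - 1) = T / N - g e := by field_simp
        nlinarith [mul_le_mul_of_nonneg_left h1 h0.le]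
    refine (Finset.sum_le_sum this).trans ?_
    rw [Finset.sum_add_distrib, ← Finset.sum_mul, hgT, Finset.sum_const, nsmul_eq_mul]
    apply le_of_eq
    field_simp
    ring
  -- If S > K·M then log(S/M)/log K ≥ 1, so one of the two terms alone dominates S.
  have hfin : ∀ e ∈ P, S e ≤ K * M e + S e * (Real.log (S e) - Real.log (M e)) / Real.log K := by
    intro e he
    have hMe := hM0 e he
    have hMSe : M e ≤ S e := hMS e he
    rcases hMe.eq_or_lt with h0 | h0
    · have : S e ≤ 0 := by
        refine Finset.sum_nonpos fun f hf => ?_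
        obtain ⟨hfF, rfl⟩ := Finset.mem_filter.1 hf
        exact (hM f hfF).trans h0.ge
      have hSe : S e = 0 := le_antisymm this (hS0 e)
      rw [hSe, ← h0]; simp
    · have hS1 : 0 < S e := h0.trans_le hMSe
      by_cases hk : S e ≤ K * M e
      · have := Real.log_le_log h0 hMSe
        have : 0 ≤ S e * (Real.log (S e) - Real.log (M e)) / Real.log K := by
          apply div_nonneg _ hlogK.le
          apply mul_nonneg hS1.le; linarith
        linarith
      · push Not at hk
        have h1 := Real.log_le_log (by positivity) hk.le
        rw [Real.log_mul (by positivity) h0.ne'] at h1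
        have : S e ≤ S e * (Real.log (S e) - Real.log (M e)) / Real.log K := by
          rw [le_div_iff₀ hlogK]
          gcongr; linarith
        have : 0 ≤ K * M e := by positivity
        linarith
  have h1 := Finset.sum_le_sum hfin
  rw [Finset.sum_add_distrib, ← Finset.mul_sum, ← Finset.sum_div, hSsum] at h1
  calc _ ≤ K * (T / 2) + T * (1 + 2 * Real.log N) / Real.log K := by
        refine h1.trans ?_
        gcongr
        exact hent.trans hgent
    _ = _ := by ring

/-! ### Laminar families of 2-optimal chords of a closed path -/

section Laminar
variable {X : Type*} [PseudoMetricSpace X]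

/-- The distance between two points of a path is at most the length of a path that uses shortcuts
over disjoint index intervals. -/
lemma dist_le_sum_shortcuts (t : ℕ → X) (D : Finset (ℕ × ℕ)) (hD : ∀ d ∈ D, d.1 < d.2)
    (hdisj : ∀ d ∈ D, ∀ d' ∈ D, d ≠ d' → d.2 ≤ d'.1 ∨ d'.2 ≤ d.1) (i k : ℕ) (hik : i ≤ k)
    (hin : ∀ d ∈ D, d.1 < k → i < d.2 → i ≤ d.1 ∧ d.2 ≤ k) :
    dist (t i) (t k) ≤ (∑ d ∈ D with i ≤ d.1 ∧ d.2 ≤ k, dist (t d.1) (t d.2)) +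
      ∑ r ∈ Finset.Ico i k with ∀ d ∈ D, ¬ (d.1 ≤ r ∧ r < d.2), dist (t r) (t (r + 1)) := by
  induction k using Nat.strong_induction_on with
  | _ k ih =>
  rcases hik.eq_or_lt with rfl | hlt
  · rw [dist_self]
    exact add_nonneg (Finset.sum_nonneg fun _ _ => dist_nonneg)
      (Finset.sum_nonneg fun _ _ => dist_nonneg)
  -- The last unit step either lies in a shortcut, which `hin` forces to end exactly at k, or is
  -- free and is walked directly.
  by_cases hcov : ∃ d ∈ D, d.1 ≤ k - 1 ∧ k - 1 < d.2
  · obtain ⟨d, hd, h1, h2⟩ := hcov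
    obtain ⟨h3, h4⟩ := hin d hd (by omega) (by omega)
    have h5 : d.2 = k := by omega
    have := ih d.1 (by omega) h3 (fun d' hd' ha hb => by
      obtain ⟨h6, h7⟩ := hin d' hd' (by omega) hb
      refine ⟨h6, ?_⟩
      have := hdisj d hd d' hd' (by rintro rfl; omega)
      have := hD d' hd'
      omega)
    calc dist (t i) (t k) ≤ dist (t i) (t d.1) + dist (t d.1) (t d.2) := by
          rw [h5]; exact dist_triangle _ _ _
      _ ≤ ((∑ d' ∈ D with i ≤ d'.1 ∧ d'.2 ≤ d.1, dist (t d'.1) (t d'.2)) +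
            dist (t d.1) (t d.2)) +
            ∑ r ∈ Finset.Ico i d.1 with ∀ d ∈ D, ¬ (d.1 ≤ r ∧ r < d.2),
              dist (t r) (t (r + 1)) := by linarith
      _ ≤ _ := by
        have hd2 := hD d hd
        gcongr ?_ + ?_
        · rw [add_comm, ← Finset.sum_insert (f := fun d' : ℕ × ℕ => dist (t d'.1) (t d'.2))
            (by simp; omega)]
          refine Finset.sum_le_sum_of_subset_of_nonneg ?_ fun _ _ _ => dist_nonneg
          intro x hx
          simp only [Finset.mem_insert, Finset.mem_filter] at hx ⊢
          rcases hx with rfl | ⟨hx, h8, h9⟩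
          · exact ⟨hd, h3, h4⟩
          · exact ⟨hx, h8, by omega⟩
        · refine Finset.sum_le_sum_of_subset_of_nonneg ?_ fun _ _ _ => dist_nonneg
          refine Finset.filter_subset_filter _ (Finset.Ico_subset_Ico_right (by omega))
  · push Not at hcov
    have := ih (k - 1) (by omega) (by omega) (fun d' hd' ha hb => by
      obtain ⟨h6, h7⟩ := hin d' hd' (by omega) hb
      refine ⟨h6, ?_⟩
      have := hcov d' hd' (by omega)
      omega)
    have hk : k - 1 + 1 = k := by omega
    calc dist (t i) (t k) ≤ dist (t i) (t (k - 1)) + dist (t (k - 1)) (t (k - 1 + 1)) := by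
          rw [hk]; exact dist_triangle _ _ _
      _ ≤ (∑ d' ∈ D with i ≤ d'.1 ∧ d'.2 ≤ k - 1, dist (t d'.1) (t d'.2)) +
            ((∑ r ∈ Finset.Ico i (k - 1) with ∀ d ∈ D, ¬ (d.1 ≤ r ∧ r < d.2),
              dist (t r) (t (r + 1))) + dist (t (k - 1)) (t (k - 1 + 1))) := by linarith
      _ ≤ _ := by
        gcongr ?_ + ?_
        · refine Finset.sum_le_sum_of_subset_of_nonneg ?_ fun _ _ _ => dist_nonneg
          intro x hx
          simp only [Finset.mem_filter] at hx ⊢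
          exact ⟨hx.1, hx.2.1, by omega⟩
        · rw [add_comm, ← Finset.sum_insert (f := fun r => dist (t r) (t (r + 1))) (by simp)]
          refine Finset.sum_le_sum_of_subset_of_nonneg ?_ fun _ _ _ => dist_nonneg
          intro x hx
          simp only [Finset.mem_insert, Finset.mem_filter, Finset.mem_Ico] at hx ⊢
          rcases hx with rfl | ⟨hx, h8⟩
          · refine ⟨by omega, fun d hd hc => ?_⟩
            have := hcov d hd hc.1
            omega
          · exact ⟨by omega, h8⟩

/-- Used twice: with `Q` excluding f it selects the parent of f, and with trivial `Q` the innermost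
member over a unit step. The artificial root (0, m) guarantees existence. -/
lemma exists_shortest_cover (P : Finset (ℕ × ℕ)) (m a b : ℕ) (hm : (0, m) ∈ P) (hb : b ≤ m)
    (Q : ℕ × ℕ → Prop) (hQ : Q (0, m)) :
    ∃ e ∈ P, e.1 ≤ a ∧ b ≤ e.2 ∧ Q e ∧
      ∀ e' ∈ P, e'.1 ≤ a → b ≤ e'.2 → Q e' → e.2 - e.1 ≤ e'.2 - e'.1 := by
  classical
  obtain ⟨e, he, hmin⟩ := Finset.exists_min_image
    (P.filter fun e => e.1 ≤ a ∧ b ≤ e.2 ∧ Q e) (fun e => e.2 - e.1)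
    ⟨(0, m), by simp [hm, hb, hQ]⟩
  simp only [Finset.mem_filter] at he hmin
  exact ⟨e, he.1, he.2.1, he.2.2.1, he.2.2.2, fun e' h1 h2 h3 h4 => hmin e' ⟨h1, h2, h3, h4⟩⟩

/-- A noninterleaving family of equally directed chords of a closed path that satisfies the
2-optimality condition has total length at most `log N / log K + K` times the length of the path,
up to constants. -/
lemma sum_laminar_le (t : ℕ → X) (m : ℕ) (hclosed : t m = t 0) (F : Finset (ℕ × ℕ))
    (hF : ∀ f ∈ F, f.1 < f.2 ∧ f.2 < m)
    (hlam : ∀ e ∈ F, ∀ f ∈ F, ¬ (e.1 < f.1 ∧ f.1 < e.2 ∧ e.2 < f.2))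
    (hopt : ∀ e ∈ F, ∀ f ∈ F, e ≠ f → dist (t e.1) (t e.2) + dist (t f.1) (t f.2) ≤
      dist (t e.1) (t f.1) + dist (t e.2) (t f.2)) {K : ℝ} (hK : 1 < K)
    (hT : 0 < ∑ r ∈ Finset.range m, dist (t r) (t (r + 1))) :
    ∑ f ∈ F, dist (t f.1) (t f.2) ≤ (∑ r ∈ Finset.range m, dist (t r) (t (r + 1))) *
      (K / 2 + (1 + 2 * Real.log (F.card + 1)) / Real.log K) := by
  classical
  set T := ∑ r ∈ Finset.range m, dist (t r) (t (r + 1)) with hTdef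
  set P := insert (0, m) F with hP
  have hroot : ((0, m) : ℕ × ℕ) ∉ F := fun h => absurd (hF _ h).2 (lt_irrefl _)
  have hrP : ((0, m) : ℕ × ℕ) ∈ P := Finset.mem_insert_self _ _
  have hFP : F ⊆ P := Finset.subset_insert _ _
  have hm0 : 0 < m := by
    rcases Nat.eq_zero_or_pos m with h | h
    · simp [hTdef, h] at hT
    · exact h
  have hPm : ∀ e ∈ P, e.1 < e.2 ∧ e.2 ≤ m := by
    intro e he
    rcases Finset.mem_insert.1 he with rfl | he
    · exact ⟨hm0, le_rfl⟩
    · exact ⟨(hF e he).1, (hF e he).2.le⟩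
  have hPlam : ∀ e ∈ P, ∀ f ∈ P, ¬ (e.1 < f.1 ∧ f.1 < e.2 ∧ e.2 < f.2) := by
    intro e he f hf
    have h1 := hPm e he
    have h2 := hPm f hf
    rcases Finset.mem_insert.1 he with rfl | he'
    · simp only; omega
    rcases Finset.mem_insert.1 hf with rfl | hf'
    · simp only; omega
    · exact hlam e he' f hf'
  have hPopt : ∀ e ∈ P, ∀ f ∈ F, e ≠ f → dist (t e.1) (t e.2) + dist (t f.1) (t f.2) ≤
      dist (t e.1) (t f.1) + dist (t e.2) (t f.2) := by
    intro e he f hf hne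
    rcases Finset.mem_insert.1 he with rfl | he'
    · simp only [hclosed, dist_self, zero_add]
      exact dist_triangle_left _ _ _
    · exact hopt e he' f hf hne
  have hpar : ∀ f : ℕ × ℕ, ∃ e, f ∈ F → e ∈ P ∧ e.1 ≤ f.1 ∧ f.2 ≤ e.2 ∧ e ≠ f ∧
      ∀ e' ∈ P, e'.1 ≤ f.1 → f.2 ≤ e'.2 → e' ≠ f → e.2 - e.1 ≤ e'.2 - e'.1 := by
    intro f
    by_cases hf : f ∈ F
    · obtain ⟨e, he⟩ := exists_shortest_cover P m f.1 f.2 hrP (hF f hf).2.le (fun e => e ≠ f)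
        (by rintro rfl; exact hroot hf)
      exact ⟨e, fun _ => he⟩
    · exact ⟨f, fun h => absurd h hf⟩
  choose par hpar using hpar
  have hcov : ∀ r : ℕ, ∃ e, r < m → e ∈ P ∧ e.1 ≤ r ∧ r + 1 ≤ e.2 ∧
      ∀ e' ∈ P, e'.1 ≤ r → r + 1 ≤ e'.2 → e.2 - e.1 ≤ e'.2 - e'.1 := by
    intro r
    by_cases hr : r < m
    · obtain ⟨e, h1, h2, h3, -, h4⟩ := exists_shortest_cover P m r (r + 1) hrP hr
        (fun _ => True) trivial
      exact ⟨e, fun _ => ⟨h1, h2, h3, fun e' ha hb hc => h4 e' ha hb hc trivial⟩⟩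
    · exact ⟨(0, 0), fun h => absurd h hr⟩
  choose cov hcov using hcov
  -- every member strictly below `e` lies below a child of `e`
  have hchild : ∀ e ∈ P, ∀ f ∈ F, e.1 ≤ f.1 → f.2 ≤ e.2 → e ≠ f →
      ∃ d ∈ F, par d = e ∧ d.1 ≤ f.1 ∧ f.2 ≤ d.2 := by
    intro e he f hf h1 h2 hne
    obtain ⟨d, hd, hmax⟩ := Finset.exists_max_image
      (F.filter fun d => d.1 ≤ f.1 ∧ f.2 ≤ d.2 ∧ e.1 ≤ d.1 ∧ d.2 ≤ e.2 ∧ e ≠ d)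
      (fun d => d.2 - d.1) ⟨f, by simp [hf, h1, h2, hne]⟩
    simp only [Finset.mem_filter] at hd hmax
    obtain ⟨hd, hdf1, hdf2, hed1, hed2, hed⟩ := hd
    obtain ⟨p1, p2, p3, p4, p5⟩ := hpar d hd
    have hle := p5 e he hed1 hed2 hed
    refine ⟨d, hd, ?_, hdf1, hdf2⟩
    by_contra hpe
    have e0 := hPm e he
    have f0 := hF f hf
    have d0 := hF d hd
    have q0 := hPm _ p1
    have l1 := hPlam e he _ p1
    have l2 := hPlam _ p1 e he
    have hpe' : ¬ ((par d).1 = e.1 ∧ (par d).2 = e.2) := fun h => hpe (Prod.ext h.1 h.2)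
    have hpd' : ¬ ((par d).1 = d.1 ∧ (par d).2 = d.2) := fun h => p4 (Prod.ext h.1 h.2)
    have hpF : par d ∈ F := by
      rcases Finset.mem_insert.1 p1 with h | h
      · exfalso
        rw [h] at l1 l2 hle hpe'
        simp only at l1 l2 hle hpe'
        omega
      · exact h
    have := hmax (par d) ⟨hpF, by omega, by omega, by omega, by omega, fun h => hpe h.symm⟩
    omega
  have hchildren : ∀ e ∈ P, ∀ d ∈ F, par d = e → e.1 ≤ d.1 ∧ d.2 ≤ e.2 ∧ e ≠ d := by
    rintro e he d hd rfl
    obtain ⟨p1, p2, p3, p4, p5⟩ := hpar d hd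
    exact ⟨p2, p3, p4⟩
  have hdisj : ∀ e ∈ P, ∀ d ∈ F.filter (fun f => par f = e), ∀ d' ∈ F.filter (fun f => par f = e),
      d ≠ d' → d.2 ≤ d'.1 ∨ d'.2 ≤ d.1 := by
    intro e he d hd d' hd' hne
    simp only [Finset.mem_filter] at hd hd'
    have key : ∀ d ∈ F, ∀ d' ∈ F, par d = e → par d' = e → d ≠ d' → ¬ (d'.1 ≤ d.1 ∧ d.2 ≤ d'.2) := by
      rintro d hd d' hd' hpd hpd' hne ⟨h1, h2⟩
      obtain ⟨-, -, -, -, p5⟩ := hpar d hd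
      have h3 := p5 d' (hFP hd') h1 h2 hne.symm
      obtain ⟨-, p2, p3, p4, -⟩ := hpar d' hd'
      rw [hpd] at h3
      rw [hpd'] at p2 p3 p4
      have := hPm e he
      have := hF d' hd'
      exact p4 (Prod.ext (by omega) (by omega))
    have k1 := key d hd.1 d' hd'.1 hd.2 hd'.2 hne
    have k2 := key d' hd'.1 d hd.1 hd'.2 hd.2 hne.symm
    have l1 := hlam d hd.1 d' hd'.1
    have l2 := hlam d' hd'.1 d hd.1
    omega
  -- A step inside e that no child of e covers has e as its innermost member, hence is charged to
  -- g(e); the gaps of different nodes are thus disjoint.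
  have huncov : ∀ e ∈ P, ∀ r, e.1 ≤ r → r < e.2 →
      (∀ d ∈ F.filter (fun f => par f = e), ¬ (d.1 ≤ r ∧ r < d.2)) → cov r = e := by
    intro e he r h1 h2 hun
    have e0 := hPm e he
    obtain ⟨p1, p2, p3, p4⟩ := hcov r (by omega)
    have h3 := p4 e he h1 h2
    by_contra hne
    have hne' : ¬ ((cov r).1 = e.1 ∧ (cov r).2 = e.2) := fun h => hne (Prod.ext h.1 h.2)
    have q0 := hPm _ p1
    have l1 := hPlam e he _ p1
    have l2 := hPlam _ p1 e he
    have hcF : cov r ∈ F := by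
      rcases Finset.mem_insert.1 p1 with h | h
      · exfalso
        rw [h] at l1 l2 h3 hne'
        simp only at l1 l2 h3 hne'
        omega
      · exact h
    obtain ⟨d, hd, hpd, h4, h5⟩ := hchild e he _ hcF (by omega) (by omega) (fun h => hne h.symm)
    exact hun d (by simp [hd, hpd]) ⟨by omega, by omega⟩
  set c : ℕ × ℕ → ℝ := fun e => dist (t e.1) (t e.2) with hc
  set g : ℕ × ℕ → ℝ := fun e => ∑ r ∈ Finset.range m with cov r = e, dist (t r) (t (r + 1)) with hg
  -- the shortcut path between two points of the interval of `e`
  have hpath : ∀ e ∈ P, ∀ i k, e.1 ≤ i → i ≤ k → k ≤ e.2 →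
      (∀ d ∈ F.filter (fun f => par f = e), d.1 < k → i < d.2 → i ≤ d.1 ∧ d.2 ≤ k) →
      dist (t i) (t k) ≤
        (∑ d ∈ F.filter (fun f => par f = e) with i ≤ d.1 ∧ d.2 ≤ k, c d) +
        ∑ r ∈ (Finset.range m).filter (fun r => cov r = e) with i ≤ r ∧ r < k,
          dist (t r) (t (r + 1)) := by
    intro e he i k h1 h2 h3 h4
    have e0 := hPm e he
    refine (dist_le_sum_shortcuts t _ (fun d hd => (hF d (Finset.mem_filter.1 hd).1).1)
      (hdisj e he) i k h2 h4).trans ?_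
    refine add_le_add le_rfl ?_
    refine Finset.sum_le_sum_of_subset_of_nonneg ?_ fun r _ _ => dist_nonneg
    intro r hr
    rw [Finset.mem_filter, Finset.mem_Ico] at hr
    simp only [Finset.mem_filter, Finset.mem_range]
    refine ⟨⟨by omega, huncov e he r (by omega) (by omega) hr.2⟩, hr.1.1, hr.1.2⟩
  have hmain : ∀ e ∈ P, c e ≤ (∑ f ∈ F with par f = e, c f) + g e := by
    intro e he
    have e0 := hPm e he
    refine (hpath e he e.1 e.2 le_rfl e0.1.le le_rfl fun d hd _ _ => ?_).trans ?_
    · have hd' := Finset.mem_filter.1 hd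
      obtain ⟨h1, h2, -⟩ := hchildren e he d hd'.1 hd'.2
      exact ⟨h1, h2⟩
    · gcongr
      · exact Finset.filter_subset _ _
      · exact Finset.sum_le_sum_of_subset_of_nonneg (Finset.filter_subset _ _)
          fun _ _ _ => dist_nonneg
  -- 2-optimality bounds c(e) + c(f) by the distances between the two left ends and between the two
  -- right ends. The shortcut paths for these use the siblings of f on either side, so together with
  -- f itself every child is counted at most once.
  have hmain2 : ∀ e ∈ P, ∀ f ∈ F.filter (fun f => par f = e),
      c e + 2 * c f ≤ (∑ f ∈ F with par f = e, c f) + g e := by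
    intro e he f hf
    have e0 := hPm e he
    have hf' := Finset.mem_filter.1 hf
    have f0 := hF f hf'.1
    obtain ⟨h1, h2, h3⟩ := hchildren e he f hf'.1 hf'.2
    have hin : ∀ d ∈ F.filter (fun f => par f = e), d ≠ f →
        (d.1 < d.2) ∧ e.1 ≤ d.1 ∧ d.2 ≤ e.2 ∧ (d.2 ≤ f.1 ∨ f.2 ≤ d.1) := by
      intro d hd hne
      have hd' := Finset.mem_filter.1 hd
      obtain ⟨h1, h2, -⟩ := hchildren e he d hd'.1 hd'.2
      exact ⟨(hF d hd'.1).1, h1, h2, hdisj e he d hd f hf hne⟩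
    have a1 := hpath e he e.1 f.1 le_rfl h1 (by omega) (fun d hd h4 h5 => by
      by_cases hdf : d = f
      · subst hdf; omega
      · obtain ⟨g0, g1, g2, g3⟩ := hin d hd hdf; omega)
    have a2 := hpath e he f.2 e.2 (by omega) h2 le_rfl (fun d hd h4 h5 => by
      by_cases hdf : d = f
      · subst hdf; omega
      · obtain ⟨g0, g1, g2, g3⟩ := hin d hd hdf; omega)
    have a3 := hPopt e he f hf'.1 h3
    have s1 : (∑ d ∈ F.filter (fun f => par f = e) with e.1 ≤ d.1 ∧ d.2 ≤ f.1, c d) +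
        (∑ d ∈ F.filter (fun f => par f = e) with f.2 ≤ d.1 ∧ d.2 ≤ e.2, c d) + c f ≤
        ∑ f ∈ F with par f = e, c f := by
      rw [← Finset.sum_union, add_comm, ← Finset.sum_insert (f := c)]
      · refine Finset.sum_le_sum_of_subset_of_nonneg ?_ fun _ _ _ => dist_nonneg
        intro x hx
        rcases Finset.mem_insert.1 hx with rfl | hx
        · exact hf
        · rcases Finset.mem_union.1 hx with hx | hx
          · exact (Finset.mem_filter.1 hx).1
          · exact (Finset.mem_filter.1 hx).1
      · simp only [Finset.mem_union, Finset.mem_filter]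
        omega
      · rw [Finset.disjoint_left]
        intro x hx hy
        have hx1 := Finset.mem_filter.1 hx
        have hy1 := Finset.mem_filter.1 hy
        have := hF x (Finset.mem_filter.1 hx1.1).1
        omega
    have s2 : (∑ r ∈ (Finset.range m).filter (fun r => cov r = e) with e.1 ≤ r ∧ r < f.1,
          dist (t r) (t (r + 1))) +
        (∑ r ∈ (Finset.range m).filter (fun r => cov r = e) with f.2 ≤ r ∧ r < e.2,
          dist (t r) (t (r + 1))) ≤ g e := by
      rw [← Finset.sum_union]
      · refine Finset.sum_le_sum_of_subset_of_nonneg ?_ fun _ _ _ => dist_nonneg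
        intro x hx
        rcases Finset.mem_union.1 hx with hx | hx
        · exact (Finset.mem_filter.1 hx).1
        · exact (Finset.mem_filter.1 hx).1
      · rw [Finset.disjoint_left]
        intro x hx hy
        have hx1 := Finset.mem_filter.1 hx
        have hy1 := Finset.mem_filter.1 hy
        omega
    have a4 := dist_comm (t e.2) (t f.2)
    simp only [hc] at s1 s2 a1 a2 ⊢
    linarith
  -- For a leaf M = 0 and the inequality without a child applies.
  have hMex : ∀ e, ∃ M : ℝ, e ∈ P → (∀ f ∈ F.filter (fun f => par f = e), c f ≤ M) ∧ 0 ≤ M ∧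
      M ≤ (∑ f ∈ F with par f = e, c f) ∧ c e + 2 * M ≤ (∑ f ∈ F with par f = e, c f) + g e := by
    intro e
    by_cases he : e ∈ P
    · rcases (F.filter (fun f => par f = e)).eq_empty_or_nonempty with h0 | h0
      · refine ⟨0, fun _ => ⟨by simp [h0], le_rfl, by simp [h0], ?_⟩⟩
        have := hmain e he
        linarith
      · obtain ⟨f, hf, hmax⟩ := Finset.exists_max_image _ c h0
        exact ⟨c f, fun _ => ⟨hmax, dist_nonneg,
          Finset.single_le_sum (f := c) (fun _ _ => dist_nonneg) hf, hmain2 e he f hf⟩⟩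
    · exact ⟨0, fun h => absurd h he⟩
  choose M hMM using hMex
  have hcard : P.card = F.card + 1 := Finset.card_insert_of_notMem hroot
  have hcT : ∀ f ∈ F, c f ≤ T := by
    intro f hf
    have f0 := hF f hf
    refine (dist_le_Ico_sum_dist t f0.1.le).trans ?_
    refine Finset.sum_le_sum_of_subset_of_nonneg ?_ fun _ _ _ => dist_nonneg
    intro r hr
    rw [Finset.mem_Ico] at hr
    rw [Finset.mem_range]; omega
  have := sum_tree_le P F par c g M (T := T) (K := K) hFP (fun f hf => (hpar f hf).1)
    (fun _ _ => dist_nonneg) hcT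
    (fun e he hne => by
      rcases Finset.mem_insert.1 he with rfl | h
      · simp [hc, hclosed]
      · exact absurd h hne)
    (fun e _ => Finset.sum_nonneg fun _ _ => dist_nonneg)
    (Finset.sum_fiberwise_of_maps_to (fun r hr => (hcov r (Finset.mem_range.1 hr)).1) _) hK
    (fun f hf => (hMM (par f) (hpar f hf).1).1 f (by simp [hf]))
    (fun e he => (hMM e he).2.1) (fun e he => (hMM e he).2.2.1) (fun e he => (hMM e he).2.2.2)
    hT hcard.ge
  rw [hcard] at this
  push_cast at this
  exact this

end Laminar

end EuclideanTSP

namespace EuclideanTSP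
-- Parity of ray crossings
section Parity
open Classical in
/-- Mod-2 indicator that the upward vertical ray from `p` crosses the segment `s t`. -/
noncomputable def rayCross (s t p : ℝ × ℝ) : ZMod 2 :=
  if ((s.1 ≤ p.1 ∧ p.1 < t.1) ∨ (t.1 ≤ p.1 ∧ p.1 < s.1)) ∧
    p.2 < s.2 + (t.2 - s.2) / (t.1 - s.1) * (p.1 - s.1) then 1 else 0

open Classical in
/-- Mod-2 indicator that the point `v` lies above the segment `p q`. -/
noncomputable def aboveSegment (p q v : ℝ × ℝ) : ZMod 2 :=
  if ((p.1 < v.1 ∧ v.1 ≤ q.1) ∨ (q.1 < v.1 ∧ v.1 ≤ p.1)) ∧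
    p.2 + (q.2 - p.2) / (q.1 - p.1) * (v.1 - p.1) < v.2 then 1 else 0

lemma line_symm {s t : ℝ × ℝ} (h : s.1 ≠ t.1) (ξ : ℝ) :
    s.2 + (t.2 - s.2) / (t.1 - s.1) * (ξ - s.1) = t.2 + (s.2 - t.2) / (s.1 - t.1) * (ξ - t.1) := by
  have h1 : t.1 - s.1 ≠ 0 := sub_ne_zero.2 h.symm
  have h2 : s.1 - t.1 ≠ 0 := sub_ne_zero.2 h
  field_simp
  ring

lemma rayCross_symm {s t : ℝ × ℝ} (h : s.1 ≠ t.1) (p : ℝ × ℝ) :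
    rayCross s t p = rayCross t s p := by
  unfold rayCross
  simp only [line_symm h, or_comm]

lemma aboveSegment_symm {p q : ℝ × ℝ} (h : p.1 ≠ q.1) (v : ℝ × ℝ) :
    aboveSegment p q v = aboveSegment q p v := by
  unfold aboveSegment
  simp only [line_symm h, or_comm]

lemma mem_segment_line {s t : ℝ × ℝ} (h : s.1 < t.1) {ξ : ℝ} (h1 : s.1 ≤ ξ) (h2 : ξ ≤ t.1) :
    ((ξ, s.2 + (t.2 - s.2) / (t.1 - s.1) * (ξ - s.1)) : ℝ × ℝ) ∈ segment ℝ s t := by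
  have h0 : 0 < t.1 - s.1 := sub_pos.2 h
  rw [segment_eq_image']
  refine ⟨(ξ - s.1) / (t.1 - s.1), ⟨div_nonneg (by linarith) h0.le, ?_⟩, ?_⟩
  · rw [div_le_one h0]; linarith
  · ext
    · simp; field_simp; ring
    · simp; field_simp

/-- Over the common range of abscissas the two segments are graphs that never meet, so their
vertical order is constant. Each end of this range is an end point of one segment and contributes
one indicator, and the two indicators agree. The half-open conventions of `rayCross` and
`aboveSegment` are complementary, so that coinciding abscissas are counted once. -/
lemma rayCross_add_aux {s t p q : ℝ × ℝ} (hst : s.1 < t.1) (hpq : p.1 < q.1)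
    (hd : Disjoint (segment ℝ p q) (segment ℝ s t)) :
    rayCross s t p + rayCross s t q = aboveSegment p q s + aboveSegment p q t := by
  set f : ℝ → ℝ := fun ξ => s.2 + (t.2 - s.2) / (t.1 - s.1) * (ξ - s.1) with hf
  set g : ℝ → ℝ := fun ξ => p.2 + (q.2 - p.2) / (q.1 - p.1) * (ξ - p.1) with hg
  have hne : ∀ ξ, s.1 ≤ ξ → ξ ≤ t.1 → p.1 ≤ ξ → ξ ≤ q.1 → f ξ ≠ g ξ := by
    intro ξ h1 h2 h3 h4 heq
    have ha := mem_segment_line hst h1 h2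
    have hb := mem_segment_line hpq h3 h4
    change (ξ, f ξ) ∈ _ at ha
    rw [heq] at ha
    exact Set.disjoint_left.1 hd hb ha
  have hcf : Continuous f := by fun_prop
  have hcg : Continuous g := by fun_prop
  -- Constancy of the order is the intermediate value theorem on the interval between the two
  -- abscissas.
  have hsign : ∀ ξ η, s.1 ≤ ξ → ξ ≤ t.1 → p.1 ≤ ξ → ξ ≤ q.1 → s.1 ≤ η → η ≤ t.1 → p.1 ≤ η →
      η ≤ q.1 → g ξ < f ξ → g η < f η := by
    intro ξ η h1 h2 h3 h4 h5 h6 h7 h8 hlt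
    by_contra hcon
    push Not at hcon
    have hpre : IsPreconnected (Set.uIcc ξ η) := isPreconnected_uIcc
    obtain ⟨ζ, hζ, h9⟩ := hpre.intermediate_value₂ Set.right_mem_uIcc Set.left_mem_uIcc
      hcf.continuousOn hcg.continuousOn hcon hlt.le
    rw [Set.mem_uIcc] at hζ
    refine hne ζ ?_ ?_ ?_ ?_ h9 <;> rcases hζ with h | h <;> linarith [h.1, h.2]
  have fs : f s.1 = s.2 := by simp [hf]
  have ft : f t.1 = t.2 := by
    have : t.1 - s.1 ≠ 0 := (sub_pos.2 hst).ne'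
    simp only [hf]; field_simp; ring
  have gp : g p.1 = p.2 := by simp [hg]
  have gq : g q.1 = q.2 := by
    have : q.1 - p.1 ≠ 0 := (sub_pos.2 hpq).ne'
    simp only [hg]; field_simp; ring
  have e1 : rayCross s t p = if (s.1 ≤ p.1 ∧ p.1 < t.1) ∧ g p.1 < f p.1 then 1 else 0 := by
    unfold rayCross; rw [gp]
    congr 1
    have : ¬ (t.1 ≤ p.1 ∧ p.1 < s.1) := by rintro ⟨h1, h2⟩; linarith
    simp only [this, or_false, hf]
  have e2 : rayCross s t q = if (s.1 ≤ q.1 ∧ q.1 < t.1) ∧ g q.1 < f q.1 then 1 else 0 := by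
    unfold rayCross; rw [gq]
    congr 1
    have : ¬ (t.1 ≤ q.1 ∧ q.1 < s.1) := by rintro ⟨h1, h2⟩; linarith
    simp only [this, or_false, hf]
  have e3 : aboveSegment p q s = if (p.1 < s.1 ∧ s.1 ≤ q.1) ∧ g s.1 < f s.1 then 1 else 0 := by
    unfold aboveSegment; rw [fs]
    congr 1
    have : ¬ (q.1 < s.1 ∧ s.1 ≤ p.1) := by rintro ⟨h1, h2⟩; linarith
    simp only [this, or_false, hg]
  have e4 : aboveSegment p q t = if (p.1 < t.1 ∧ t.1 ≤ q.1) ∧ g t.1 < f t.1 then 1 else 0 := by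
    unfold aboveSegment; rw [ft]
    congr 1
    have : ¬ (q.1 < t.1 ∧ t.1 ≤ p.1) := by rintro ⟨h1, h2⟩; linarith
    simp only [this, or_false, hg]
  rw [e1, e2, e3, e4]
  have two : (1 : ZMod 2) + 1 = 0 := by decide
  rcases le_or_gt s.1 p.1 with a | a <;> rcases le_or_gt t.1 q.1 with b | b
  · have n1 : ¬ p.1 < s.1 := not_lt.2 a
    have n2 : ¬ q.1 < t.1 := not_lt.2 b
    rcases le_or_gt t.1 p.1 with d | d
    · simp [n1, n2, not_lt.2 d]
    · have : g p.1 < f p.1 ↔ g t.1 < f t.1 := ⟨hsign _ _ a d.le le_rfl hpq.le hst.le le_rfl d.le b,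
        hsign _ _ hst.le le_rfl d.le b a d.le le_rfl hpq.le⟩
      simp [n1, n2, a, b, d, this]
  · have n1 : ¬ p.1 < s.1 := not_lt.2 a
    have n2 : ¬ t.1 ≤ q.1 := not_le.2 b
    have : g p.1 < f p.1 ↔ g q.1 < f q.1 :=
      ⟨hsign _ _ a (hpq.trans b).le le_rfl hpq.le (a.trans hpq.le) b.le hpq.le le_rfl,
        hsign _ _ (a.trans hpq.le) b.le hpq.le le_rfl a (hpq.trans b).le le_rfl hpq.le⟩
    simp only [a, hpq.trans b, a.trans hpq.le, b, n1, n2, this, and_self, true_and, false_and,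
      and_false, if_false]
    split_ifs <;> simp [two]
  · have n1 : ¬ s.1 ≤ p.1 := not_le.2 a
    have n2 : ¬ q.1 < t.1 := not_lt.2 b
    have : g s.1 < f s.1 ↔ g t.1 < f t.1 :=
      ⟨hsign _ _ le_rfl hst.le a.le (hst.le.trans b) hst.le le_rfl (a.trans hst).le b,
        hsign _ _ hst.le le_rfl (a.trans hst).le b le_rfl hst.le a.le (hst.le.trans b)⟩
    simp only [a, a.trans hst, hst.le.trans b, b, n1, n2, this, and_self, true_and, false_and,
      and_false, if_false]
    split_ifs <;> simp [two]
  · have n1 : ¬ s.1 ≤ p.1 := not_le.2 a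
    have n2 : ¬ t.1 ≤ q.1 := not_le.2 b
    rcases le_or_gt s.1 q.1 with d | d
    · have : g s.1 < f s.1 ↔ g q.1 < f q.1 := ⟨hsign _ _ le_rfl hst.le a.le d d b.le hpq.le le_rfl,
        hsign _ _ d b.le hpq.le le_rfl le_rfl hst.le a.le d⟩
      simp [n1, n2, a, b, d, this]
    · simp [n1, n2, not_le.2 d]

/-- Moving a point along a segment disjoint from `s t` changes the crossing indicator of `s t` by a
coboundary. -/
lemma rayCross_add {s t p q : ℝ × ℝ} (hst : s.1 ≠ t.1) (hpq : p.1 ≠ q.1)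
    (hd : Disjoint (segment ℝ p q) (segment ℝ s t)) :
    rayCross s t p + rayCross s t q = aboveSegment p q s + aboveSegment p q t := by
  rcases hst.lt_or_gt with h1 | h1 <;> rcases hpq.lt_or_gt with h2 | h2
  · exact rayCross_add_aux h1 h2 hd
  · rw [aboveSegment_symm hpq, aboveSegment_symm hpq, add_comm]
    exact rayCross_add_aux h1 h2 (by rwa [segment_symm])
  · rw [rayCross_symm hst, rayCross_symm hst, add_comm (aboveSegment p q s)]
    exact rayCross_add_aux h1 h2 (by rwa [segment_symm ℝ t s])
  · rw [rayCross_symm hst, rayCross_symm hst, aboveSegment_symm hpq, aboveSegment_symm hpq,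
      add_comm, add_comm (aboveSegment q p s)]
    exact rayCross_add_aux h1 h2 (by rwa [segment_symm, segment_symm ℝ t s])

/-- Parity of the number of edges `k ∈ [i, j)` of the path `t` above `p`. -/
noncomputable def pathCross (t : ℕ → ℝ × ℝ) (i j : ℕ) (p : ℝ × ℝ) : ZMod 2 :=
  ∑ k ∈ Finset.Ico i j, rayCross (t k) (t (k + 1)) p

lemma zmod_two_add_self (x : ZMod 2) : x + x = 0 := CharTwo.add_self_eq_zero x

/-- Summing `rayCross_add` along the path telescopes mod 2, so only the ends of the path matter;
around a closed curve nothing remains. -/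
lemma pathCross_add (t : ℕ → ℝ × ℝ) {i j : ℕ} (hij : i ≤ j) {p q : ℝ × ℝ}
    (hx : ∀ k, i ≤ k → k < j → (t k).1 ≠ (t (k + 1)).1) (hpq : p.1 ≠ q.1)
    (hd : ∀ k, i ≤ k → k < j → Disjoint (segment ℝ p q) (segment ℝ (t k) (t (k + 1)))) :
    pathCross t i j p + pathCross t i j q = aboveSegment p q (t i) + aboveSegment p q (t j) := by
  unfold pathCross
  induction j, hij using Nat.le_induction with
  | base => simp [zmod_two_add_self]
  | succ j hij ih =>
    rw [Finset.sum_Ico_succ_top hij, Finset.sum_Ico_succ_top hij]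
    have h1 := ih (fun k h1 h2 => hx k h1 (by omega)) (fun k h1 h2 => hd k h1 (by omega))
    have h2 := rayCross_add (hx j hij (by omega)) hpq (hd j hij (by omega))
    have h3 := zmod_two_add_self (aboveSegment p q (t j))
    linear_combination h1 + h2 + h3

lemma pathCross_split (t : ℕ → ℝ × ℝ) {i j k : ℕ} (hij : i ≤ j) (hjk : j ≤ k) (p : ℝ × ℝ) :
    pathCross t i k p = pathCross t i j p + pathCross t j k p :=
  (Finset.sum_Ico_consecutive _ hij hjk).symm

/-- Far from its end points, a segment is crossed alike by the rays from nearby points. -/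
lemma rayCross_eventually {s t b : ℝ × ℝ} (hs : s.1 ≠ b.1) (ht : t.1 ≠ b.1) (hst : s.1 ≠ t.1)
    (hb : b ∉ segment ℝ s t) : ∀ᶠ q in nhds b, rayCross s t q = rayCross s t b := by
  have h1 : Filter.Tendsto (fun q : ℝ × ℝ => q.1) (nhds b) (nhds b.1) := continuous_fst.tendsto b
  have hs' : ∀ᶠ q : ℝ × ℝ in nhds b, (s.1 ≤ q.1 ↔ s.1 ≤ b.1) ∧ (q.1 < s.1 ↔ b.1 < s.1) := by
    rcases hs.lt_or_gt with h | h
    · filter_upwards [h1.eventually (lt_mem_nhds h)] with q hq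
      exact ⟨⟨fun _ => h.le, fun _ => hq.le⟩, ⟨fun h' => by linarith, fun h' => by linarith⟩⟩
    · filter_upwards [h1.eventually (gt_mem_nhds h)] with q hq
      exact ⟨⟨fun _ => by linarith, fun _ => by linarith⟩, ⟨fun h' => h, fun h' => hq⟩⟩
  have ht' : ∀ᶠ q : ℝ × ℝ in nhds b, (t.1 ≤ q.1 ↔ t.1 ≤ b.1) ∧ (q.1 < t.1 ↔ b.1 < t.1) := by
    rcases ht.lt_or_gt with h | h
    · filter_upwards [h1.eventually (lt_mem_nhds h)] with q hq
      exact ⟨⟨fun _ => h.le, fun _ => hq.le⟩, ⟨fun h' => by linarith, fun h' => by linarith⟩⟩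
    · filter_upwards [h1.eventually (gt_mem_nhds h)] with q hq
      exact ⟨⟨fun _ => by linarith, fun _ => by linarith⟩, ⟨fun h' => h, fun h' => hq⟩⟩
  by_cases hstr : (s.1 ≤ b.1 ∧ b.1 < t.1) ∨ (t.1 ≤ b.1 ∧ b.1 < s.1)
  · have hne : b.2 ≠ s.2 + (t.2 - s.2) / (t.1 - s.1) * (b.1 - s.1) := by
      intro heq
      apply hb
      rcases hstr with h | h
      · have := mem_segment_line (h.1.trans_lt h.2) h.1 h.2.le
        rwa [← heq] at this
      · have := mem_segment_line (h.1.trans_lt h.2) h.1 h.2.le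
        rw [line_symm hst] at heq
        rw [← heq] at this
        rwa [segment_symm]
    have hc : Continuous fun q : ℝ × ℝ => s.2 + (t.2 - s.2) / (t.1 - s.1) * (q.1 - s.1) := by
      fun_prop
    have hlt : ∀ᶠ q : ℝ × ℝ in nhds b, (q.2 < s.2 + (t.2 - s.2) / (t.1 - s.1) * (q.1 - s.1) ↔
        b.2 < s.2 + (t.2 - s.2) / (t.1 - s.1) * (b.1 - s.1)) := by
      rcases hne.lt_or_gt with h | h
      · filter_upwards [(continuous_snd.tendsto b).eventually_lt (hc.tendsto b) h] with q hq
        exact ⟨fun _ => h, fun _ => hq⟩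
      · filter_upwards [(hc.tendsto b).eventually_lt (continuous_snd.tendsto b) h] with q hq
        exact ⟨fun h' => absurd h' (not_lt.2 hq.le), fun h' => absurd h' (not_lt.2 h.le)⟩
    filter_upwards [hs', ht', hlt] with q h1 h2 h3
    unfold rayCross
    simp only [h1.1, h1.2, h2.1, h2.2, h3]
  · filter_upwards [hs', ht'] with q h1 h2
    unfold rayCross
    simp only [h1.1, h1.2, h2.1, h2.2]
    simp [hstr]

end Parity
end EuclideanTSP

/-! ### Simple polygons and theta graphs -/

namespace EuclideanTSP
open Filter Topology

/-- A simple closed polygon with the `m` distinct vertices `t 0, …, t (m - 1)`, closed up by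
`t m = t 0`. -/
structure SimplePolygon {E : Type*} [AddCommGroup E] [Module ℝ E] (t : ℕ → E) (m : ℕ) : Prop where
  closed : t m = t 0
  inj : ∀ a < m, ∀ b < m, t a = t b → a = b
  edges : ∀ a b, a < b → b < m → ∀ p ∈ segment ℝ (t a) (t (a + 1)),
    p ∈ segment ℝ (t b) (t (b + 1)) → (b = a + 1 ∧ p = t b) ∨ (a = 0 ∧ b + 1 = m ∧ p = t 0)

/-- The chord between the vertices `i` and `j` meets the polygon in its end points only. -/
def AvoidsPolygon {E : Type*} [AddCommGroup E] [Module ℝ E] (t : ℕ → E) (m i j : ℕ) : Prop :=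
  ∀ a < m, ∀ p ∈ segment ℝ (t i) (t j), p ∈ segment ℝ (t a) (t (a + 1)) → p = t i ∨ p = t j

lemma SimplePolygon.vertex_mem_edge {E : Type*} [AddCommGroup E] [Module ℝ E] {t : ℕ → E} {m : ℕ}
    (h : SimplePolygon t m) {v a : ℕ} (hv : v < m) (ha : a < m)
    (hmem : t v ∈ segment ℝ (t a) (t (a + 1))) : v = a ∨ v = a + 1 ∨ (v = 0 ∧ a + 1 = m) := by
  have hvv := left_mem_segment ℝ (t v) (t (v + 1))
  rcases lt_trichotomy a v with h1 | h1 | h1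
  · rcases h.edges a v h1 hv _ hmem hvv with ⟨h2, -⟩ | ⟨h2, h3, h4⟩
    · exact Or.inr (Or.inl h2)
    · have := h.inj v hv 0 (by omega) h4
      omega
  · exact Or.inl h1.symm
  · rcases h.edges v a h1 ha _ hvv hmem with ⟨h2, h3⟩ | ⟨h2, h3, h4⟩
    · have := h.inj v hv a ha h3
      omega
    · exact Or.inr (Or.inr ⟨h2, h3⟩)

section Theta

/-- Close to b the test point lies horizontally within the segment from b to u iff u and v are on
the same horizontal side of b, and then it is below that segment iff the slopes compare accordingly.
-/
lemma rayCross_ray {b u v : ℝ × ℝ} (hu : u.1 ≠ b.1) (hv : v.1 ≠ b.1) :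
    ∀ᶠ ε : ℝ in 𝓝[>] 0, rayCross u b (b + ε • (v - b)) =
      if 0 < (u.1 - b.1) * (v.1 - b.1) ∧
        ((v.2 - b.2) / (v.1 - b.1) - (u.2 - b.2) / (u.1 - b.1)) * (v.1 - b.1) < 0
      then 1 else 0 := by
  have hu' : u.1 - b.1 ≠ 0 := sub_ne_zero.2 hu
  have hv' : v.1 - b.1 ≠ 0 := sub_ne_zero.2 hv
  have hsmall : ∀ᶠ ε : ℝ in 𝓝[>] 0, |ε * (v.1 - b.1)| < |u.1 - b.1| := by
    have : Tendsto (fun ε : ℝ => |ε * (v.1 - b.1)|) (𝓝 0) (𝓝 |0 * (v.1 - b.1)|) :=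
      Continuous.tendsto (by fun_prop) 0
    apply nhdsWithin_le_nhds
    apply this.eventually (gt_mem_nhds _)
    simpa using abs_pos.2 hu'
  filter_upwards [hsmall, self_mem_nhdsWithin] with ε hε hε0
  have hε0 : 0 < ε := hε0
  rw [rayCross_symm hu]
  unfold rayCross
  congr 1
  have e1 : (b + ε • (v - b)).1 = b.1 + ε * (v.1 - b.1) := by simp
  have e2 : (b + ε • (v - b)).2 = b.2 + ε * (v.2 - b.2) := by simp
  rw [e1, e2]
  have e3 : b.2 + ε * (v.2 - b.2) < b.2 + (u.2 - b.2) / (u.1 - b.1) * (b.1 + ε * (v.1 - b.1) - b.1) ↔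
      ((v.2 - b.2) / (v.1 - b.1) - (u.2 - b.2) / (u.1 - b.1)) * (v.1 - b.1) < 0 := by
    set s := (v.2 - b.2) / (v.1 - b.1) with hs
    have : (v.2 - b.2) = s * (v.1 - b.1) := by rw [hs]; field_simp
    rw [this]
    constructor
    · intro h; by_contra hcon; push Not at hcon
      nlinarith [mul_nonneg hε0.le hcon]
    · intro h
      nlinarith [mul_neg_of_pos_of_neg hε0 h]
  rw [e3]
  apply propext
  refine and_congr_left fun _ => ?_
  rcases hu'.lt_or_gt with h1 | h1 <;> rcases hv'.lt_or_gt with h2 | h2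
  · have := mul_neg_of_pos_of_neg hε0 h2
    rw [abs_of_neg this, abs_of_neg h1] at hε
    exact iff_of_true (Or.inr ⟨by linarith, by linarith⟩) (mul_pos_of_neg_of_neg h1 h2)
  · have := mul_pos hε0 h2
    refine iff_of_false ?_ (not_lt.2 (mul_nonpos_of_nonpos_of_nonneg h1.le h2.le))
    rintro (h | h) <;> linarith [h.1, h.2]
  · have := mul_neg_of_pos_of_neg hε0 h2
    refine iff_of_false ?_ (not_lt.2 (mul_nonpos_of_nonneg_of_nonpos h1.le h2.le))
    rintro (h | h) <;> linarith [h.1, h.2]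
  · have := mul_pos hε0 h2
    rw [abs_of_pos this, abs_of_pos h1] at hε
    exact iff_of_true (Or.inl ⟨by linarith, by linarith⟩) (mul_pos h1 h2)

lemma slope_ne {b u v : ℝ × ℝ} (hu : u.1 ≠ b.1) (hv : v.1 ≠ b.1)
    (hpos : 0 < (u.1 - b.1) * (v.1 - b.1))
    (hd : ∀ p ∈ segment ℝ b u, p ∈ segment ℝ b v → p = b) :
    (v.2 - b.2) / (v.1 - b.1) ≠ (u.2 - b.2) / (u.1 - b.1) := by
  have hu' : u.1 - b.1 ≠ 0 := sub_ne_zero.2 hu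
  have hv' : v.1 - b.1 ≠ 0 := sub_ne_zero.2 hv
  intro heq
  have key : ∀ u v : ℝ × ℝ, u.1 - b.1 ≠ 0 → v.1 - b.1 ≠ 0 → 0 < (u.1 - b.1) * (v.1 - b.1) →
      (v.2 - b.2) / (v.1 - b.1) = (u.2 - b.2) / (u.1 - b.1) → |u.1 - b.1| ≤ |v.1 - b.1| →
      u ∈ segment ℝ b v := by
    intro u v hu' hv' hpos heq habs
    rw [segment_eq_image']
    refine ⟨(u.1 - b.1) / (v.1 - b.1), ⟨?_, ?_⟩, ?_⟩
    · rw [div_nonneg_iff, ← mul_nonneg_iff]; exact hpos.le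
    · refine (le_abs_self _).trans ?_
      rw [abs_div, div_le_one (abs_pos.2 hv')]; exact habs
    · ext
      · simp; field_simp; ring
      · simp
        rw [div_eq_div_iff hv' hu'] at heq
        field_simp
        linarith
  rcases le_total |u.1 - b.1| |v.1 - b.1| with h | h
  · exact hu (congrArg Prod.fst (hd u (right_mem_segment _ _ _) (key u v hu' hv' hpos heq h)))
  · exact hv (congrArg Prod.fst (hd v (key v u hv' hu' (by rwa [mul_comm]) heq.symm h)
      (right_mem_segment _ _ _)))

/-- If both branches leave b to the same side, they have different slopes, so exactly one of them is
below the other and sees it; otherwise neither does. -/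
lemma rayCross_pair {b u v : ℝ × ℝ} (hu : u.1 ≠ b.1) (hv : v.1 ≠ b.1)
    (hd : ∀ p ∈ segment ℝ b u, p ∈ segment ℝ b v → p = b) :
    ∀ᶠ ε : ℝ in 𝓝[>] 0, rayCross u b (b + ε • (v - b)) + rayCross v b (b + ε • (u - b)) =
      if 0 < (u.1 - b.1) * (v.1 - b.1) then 1 else 0 := by
  have hu' : u.1 - b.1 ≠ 0 := sub_ne_zero.2 hu
  have hv' : v.1 - b.1 ≠ 0 := sub_ne_zero.2 hv
  filter_upwards [rayCross_ray hu hv, rayCross_ray hv hu] with ε h1 h2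
  rw [h1, h2]
  by_cases hpos : 0 < (u.1 - b.1) * (v.1 - b.1)
  · have hne := slope_ne hu hv hpos hd
    have hpos' : 0 < (v.1 - b.1) * (u.1 - b.1) := by rwa [mul_comm]
    simp only [hpos, hpos', true_and, if_true]
    set s := (v.2 - b.2) / (v.1 - b.1)
    set r := (u.2 - b.2) / (u.1 - b.1)
    have hiff : (r - s) * (u.1 - b.1) < 0 ↔ ¬ (s - r) * (v.1 - b.1) < 0 := by
      rcases hne.lt_or_gt with h | h <;> rcases hu'.lt_or_gt with h3 | h3
      · have h4 : v.1 - b.1 < 0 := by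
          rcases pos_and_pos_or_neg_and_neg_of_mul_pos hpos with h5 | h5 <;> linarith [h5.1, h5.2]
        constructor <;> intro h <;> nlinarith
      · have h4 : 0 < v.1 - b.1 := by
          rcases pos_and_pos_or_neg_and_neg_of_mul_pos hpos with h5 | h5 <;> linarith [h5.1, h5.2]
        refine iff_of_false (by nlinarith) (by push Not; nlinarith)
      · have h4 : v.1 - b.1 < 0 := by
          rcases pos_and_pos_or_neg_and_neg_of_mul_pos hpos with h5 | h5 <;> linarith [h5.1, h5.2]
        refine iff_of_false (by nlinarith) (by push Not; nlinarith)
      · have h4 : 0 < v.1 - b.1 := by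
          rcases pos_and_pos_or_neg_and_neg_of_mul_pos hpos with h5 | h5 <;> linarith [h5.1, h5.2]
        refine iff_of_true (by nlinarith) (by push Not; nlinarith)
    by_cases h : (s - r) * (v.1 - b.1) < 0
    · simp [h, hiff]
    · simp [h, hiff]
  · have hpos' : ¬ 0 < (v.1 - b.1) * (u.1 - b.1) := by rwa [mul_comm]
    simp [hpos, hpos']

/-- Among three nonzero signs, one pair or all three pairs agree. -/
lemma three_signs {x y z : ℝ} (hx : x ≠ 0) (hy : y ≠ 0) (hz : z ≠ 0) :
    ((if 0 < x * y then 1 else 0) + (if 0 < y * z then 1 else 0) + (if 0 < z * x then 1 else 0) :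
      ZMod 2) = 1 := by
  have three : (1 + 1 + 1 : ZMod 2) = 1 := by decide
  rcases hx.lt_or_gt with h1 | h1 <;> rcases hy.lt_or_gt with h2 | h2 <;>
    rcases hz.lt_or_gt with h3 | h3 <;>
    simp [mul_pos_iff, h1, h2, h3, not_lt.2 h1.le, not_lt.2 h2.le,
      not_lt.2 h3.le, three]

lemma mem_segment_ray {E : Type*} [AddCommGroup E] [Module ℝ E] {b u p : E} {ε δ : ℝ} (hle : ε ≤ δ)
    (hp : p ∈ segment ℝ (b + ε • (u - b)) (b + δ • (u - b))) :
    ∃ θ, ε ≤ θ ∧ θ ≤ δ ∧ p = b + θ • (u - b) := by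
  rw [segment_eq_image'] at hp
  obtain ⟨s, ⟨h0, h1⟩, rfl⟩ := hp
  refine ⟨ε + s * (δ - ε), ?_, ?_, ?_⟩
  · nlinarith
  · nlinarith
  · module

lemma ray_mem_segment {E : Type*} [AddCommGroup E] [Module ℝ E] {b u : E} {θ : ℝ} (h0 : 0 ≤ θ)
    (h1 : θ ≤ 1) : b + θ • (u - b) ∈ segment ℝ b u := by
  rw [segment_eq_image']
  exact ⟨θ, ⟨h0, h1⟩, rfl⟩

lemma ray_injective {b u : ℝ × ℝ} (hu : u.1 ≠ b.1) {θ η : ℝ}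
    (h : (b + θ • (u - b)).1 = (b + η • (u - b)).1) : θ = η := by
  have hu' : u.1 - b.1 ≠ 0 := sub_ne_zero.2 hu
  simpa [hu'] using h

lemma eq_of_add_eq_zero_zmod {a b : ZMod 2} (h : a + b = 0) : a = b :=
  (CharTwo.add_eq_zero).1 h

variable {t : ℕ → ℝ × ℝ} {m : ℕ}

/-- The path from i to j closed by the chord is a closed curve, so its crossing parity does not
change along a segment that avoids it. The next two lemmas do the same for the complementary path
with the chord and for the whole polygon. -/
lemma pathCross_chord_eq {i j : ℕ} (hij : i ≤ j) {p q : ℝ × ℝ}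
    (hx : ∀ k, i ≤ k → k < j → (t k).1 ≠ (t (k + 1)).1) (hij' : (t i).1 ≠ (t j).1)
    (hpq : p.1 ≠ q.1)
    (hd : ∀ k, i ≤ k → k < j → Disjoint (segment ℝ p q) (segment ℝ (t k) (t (k + 1))))
    (hc : Disjoint (segment ℝ p q) (segment ℝ (t i) (t j))) :
    pathCross t i j p + rayCross (t i) (t j) p = pathCross t i j q + rayCross (t i) (t j) q := by
  apply eq_of_add_eq_zero_zmod
  have h1 := pathCross_add t hij hx hpq hd
  have h2 := rayCross_add hij' hpq hc
  linear_combination h1 + h2 + zmod_two_add_self (aboveSegment p q (t i)) +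
    zmod_two_add_self (aboveSegment p q (t j))

lemma pathCross_outer_chord_eq (hclosed : t m = t 0) {i j : ℕ} (hjm : j ≤ m)
    {p q : ℝ × ℝ}
    (hx : ∀ k, k < m → (t k).1 ≠ (t (k + 1)).1) (hij' : (t i).1 ≠ (t j).1)
    (hpq : p.1 ≠ q.1) (him : i ≤ m)
    (hd : ∀ k, k < i ∨ j ≤ k ∧ k < m → Disjoint (segment ℝ p q) (segment ℝ (t k) (t (k + 1))))
    (hc : Disjoint (segment ℝ p q) (segment ℝ (t i) (t j))) :
    pathCross t 0 i p + pathCross t j m p + rayCross (t i) (t j) p =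
      pathCross t 0 i q + pathCross t j m q + rayCross (t i) (t j) q := by
  apply eq_of_add_eq_zero_zmod
  have h1 := pathCross_add t (Nat.zero_le i) (fun k _ h => hx k (by omega)) hpq
    (fun k _ h => hd k (Or.inl h))
  have h2 := pathCross_add t hjm (fun k _ h => hx k h) hpq (fun k h h' => hd k (Or.inr ⟨h, h'⟩))
  have h3 := rayCross_add hij' hpq hc
  rw [hclosed] at h2
  linear_combination h1 + h2 + h3 + zmod_two_add_self (aboveSegment p q (t i)) +
    zmod_two_add_self (aboveSegment p q (t j)) + zmod_two_add_self (aboveSegment p q (t 0))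

lemma pathCross_closed_eq (hclosed : t m = t 0) {p q : ℝ × ℝ}
    (hx : ∀ k, k < m → (t k).1 ≠ (t (k + 1)).1) (hpq : p.1 ≠ q.1)
    (hd : ∀ k, k < m → Disjoint (segment ℝ p q) (segment ℝ (t k) (t (k + 1)))) :
    pathCross t 0 m p = pathCross t 0 m q := by
  apply eq_of_add_eq_zero_zmod
  have h1 := pathCross_add t (Nat.zero_le m) (fun k _ h => hx k h) hpq (fun k _ h => hd k h)
  rw [hclosed] at h1
  rw [h1, zmod_two_add_self]

lemma edge_fst_ne (h : SimplePolygon t m) (hm : 2 ≤ m)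
    (hx : ∀ a < m, ∀ b < m, (t a).1 = (t b).1 → a = b) {k : ℕ} (hk : k < m) :
    (t k).1 ≠ (t (k + 1)).1 := by
  intro heq
  rcases Nat.lt_or_ge (k + 1) m with h1 | h1
  · have := hx k hk (k + 1) h1 heq
    omega
  · have h2 : k + 1 = m := by omega
    rw [h2, h.closed] at heq
    have := hx k hk 0 (by omega) heq
    omega

/-- In a theta graph formed by a simple polygon and a chord, exactly one or all three of the arcs
are enclosed by the closed curve formed by the two others. -/
lemma theta_parity (h : SimplePolygon t m) (hx : ∀ a < m, ∀ b < m, (t a).1 = (t b).1 → a = b)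
    {i n : ℕ} (hin : i < n) (hnm : n + 2 < m) (hav : AvoidsPolygon t m i (n + 1)) :
    (pathCross t i (n + 1) (t (n + 2)) + rayCross (t i) (t (n + 1)) (t (n + 2))) +
      (pathCross t 0 i (t n) + pathCross t (n + 1) m (t n) + rayCross (t i) (t (n + 1)) (t n)) +
      pathCross t 0 m (midpoint ℝ (t i) (t (n + 1))) = 1 := by
  have hxe : ∀ k, k < m → (t k).1 ≠ (t (k + 1)).1 := fun k hk => edge_fst_ne h (by omega) hx hk
  set b := t (n + 1) with hb
  have hne : ∀ a < m, a ≠ n + 1 → (t a).1 ≠ b.1 := fun a ha hab heq =>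
    hab (hx a ha (n + 1) (by omega) heq)
  have u1 := hne n (by omega) (by omega)
  have u2 := hne (n + 2) (by omega) (by omega)
  have u3 := hne i (by omega) (by omega)
  set q : ℝ × ℝ → ℝ → ℝ × ℝ := fun u ε => b + ε • (u - b) with hq
  have htend : ∀ u, Tendsto (q u) (𝓝[>] 0) (𝓝 b) := by
    intro u
    have h1 : Tendsto (q u) (𝓝 0) (𝓝 (q u 0)) := Continuous.tendsto (by fun_prop) 0
    have h2 : q u 0 = b := by simp [hq]
    rw [h2] at h1
    exact h1.mono_left nhdsWithin_le_nhds
  -- Near b the edges not incident to b contribute the same amount as at b; these constant terms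
  -- occur twice in the final sum and cancel.
  have hfar : ∀ u, ∀ᶠ ε in 𝓝[>] (0 : ℝ), ∀ a ∈ Finset.range m, a ≠ n → a ≠ n + 1 →
      rayCross (t a) (t (a + 1)) (q u ε) = rayCross (t a) (t (a + 1)) b := by
    intro u
    rw [eventually_all_finset]
    intro a ha
    rw [Finset.mem_range] at ha
    by_cases h1 : a = n
    · exact Eventually.of_forall fun _ h => absurd h1 h
    by_cases h2 : a = n + 1
    · exact Eventually.of_forall fun _ _ h => absurd h2 h
    have h3 : (t (a + 1)).1 ≠ b.1 := by
      rcases Nat.lt_or_ge (a + 1) m with h4 | h4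
      · exact hne _ h4 (by omega)
      · have : a + 1 = m := by omega
        rw [this, h.closed]
        exact hne 0 (by omega) (by omega)
    have h4 : b ∉ segment ℝ (t a) (t (a + 1)) := by
      intro hmem
      have := h.vertex_mem_edge (v := n + 1) (by omega) ha hmem
      omega
    filter_upwards [(htend u).eventually (rayCross_eventually (hne a ha h2) h3 (hxe a ha) h4)]
      with ε hε _ _ using hε
  have d12 : ∀ p ∈ segment ℝ b (t n), p ∈ segment ℝ b (t (n + 2)) → p = b := by
    intro p hp hp'
    rw [segment_symm] at hp
    rcases h.edges n (n + 1) (by omega) (by omega) p hp hp' with h1 | h1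
    · exact h1.2
    · omega
  have d13 : ∀ p ∈ segment ℝ b (t n), p ∈ segment ℝ b (t i) → p = b := by
    intro p hp hp'
    rw [segment_symm] at hp hp'
    rcases hav n (by omega) p hp' hp with h1 | h1
    · rw [h1] at hp
      have := h.vertex_mem_edge (v := i) (by omega) (by omega) hp
      omega
    · exact h1
  have d23 : ∀ p ∈ segment ℝ b (t (n + 2)), p ∈ segment ℝ b (t i) → p = b := by
    intro p hp hp'
    rw [segment_symm] at hp'
    rcases hav (n + 1) (by omega) p hp' hp with h1 | h1
    · rw [h1] at hp
      have := h.vertex_mem_edge (v := i) (by omega) (by omega) hp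
      omega
    · exact h1
  have hsmall : ∀ᶠ ε in 𝓝[>] (0 : ℝ), ε < 1 / 2 :=
    nhdsWithin_le_nhds (gt_mem_nhds (by norm_num))
  -- One ε serves all three branches at b. The test point of each arc of the theta graph is moved
  -- along its branch to relative distance ε from b, where only the three local pairs of branches
  -- matter.
  obtain ⟨ε, f1, f2, f3, p12, p23, p31, hε2, hε0⟩ := (((hfar (t n)).and ((hfar (t (n + 2))).and
    ((hfar (t i)).and ((rayCross_pair u1 u2 d12).and ((rayCross_pair u2 u3 d23).and
    ((rayCross_pair u3 u1 fun p h1 h2 => d13 p h2 h1).and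
    (hsmall.and self_mem_nhdsWithin))))))).exists)
  have hε0 : 0 < ε := hε0
  change _ = _ at p12
  simp only [Finset.mem_range] at f1 f2 f3
  -- the three local evaluations
  have c2 : pathCross t i (n + 1) (q (t (n + 2)) ε) =
      pathCross t i n b + rayCross (t n) b (q (t (n + 2)) ε) := by
    rw [pathCross_split t hin.le (Nat.le_succ n)]
    congr 1
    · refine Finset.sum_congr rfl fun a ha => ?_
      rw [Finset.mem_Ico] at ha
      exact f2 a (by omega) (by omega) (by omega)
    · simp [pathCross, hb]
  have c1 : pathCross t (n + 1) m (q (t n) ε) =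
      pathCross t (n + 2) m b + rayCross (t (n + 2)) b (q (t n) ε) := by
    rw [pathCross_split t (Nat.le_succ (n + 1)) (by omega : n + 1 + 1 ≤ m), add_comm]
    congr 1
    · refine Finset.sum_congr rfl fun a ha => ?_
      rw [Finset.mem_Ico] at ha
      exact f1 a (by omega) (by omega) (by omega)
    · rw [rayCross_symm u2]
      simp [pathCross, hb]
  have c1' : pathCross t 0 i (q (t n) ε) = pathCross t 0 i b := by
    refine Finset.sum_congr rfl fun a ha => ?_
    rw [Finset.mem_Ico] at ha
    exact f1 a (by omega) (by omega) (by omega)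
  have c3 : pathCross t 0 m (q (t i) ε) = pathCross t 0 n b + rayCross (t n) b (q (t i) ε) +
      rayCross (t (n + 2)) b (q (t i) ε) + pathCross t (n + 2) m b := by
    rw [pathCross_split t (Nat.zero_le n) (by omega : n ≤ m),
      pathCross_split t (Nat.le_succ n) (by omega : n + 1 ≤ m),
      pathCross_split t (Nat.le_succ (n + 1)) (by omega : n + 1 + 1 ≤ m), ← add_assoc, ← add_assoc]
    congr 1
    · congr 1
      · congr 1
        · refine Finset.sum_congr rfl fun a ha => ?_
          rw [Finset.mem_Ico] at ha
          exact f3 a (by omega) (by omega) (by omega)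
        · simp [pathCross, hb]
      · rw [rayCross_symm u2]
        simp [pathCross, hb]
    · refine Finset.sum_congr rfl fun a ha => ?_
      rw [Finset.mem_Ico] at ha
      exact f3 a (by omega) (by omega) (by omega)
  have hsub : ∀ u : ℝ × ℝ, ∀ δ : ℝ, ε ≤ δ → δ ≤ 1 → u.1 ≠ b.1 → ∀ p ∈ segment ℝ (q u ε) (q u δ),
      p ∈ segment ℝ b u ∧ p ≠ b ∧ (δ < 1 → p ≠ u) := by
    intro u δ h1 h2 hu p hp
    obtain ⟨θ, g1, g2, rfl⟩ := mem_segment_ray h1 hp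
    refine ⟨ray_mem_segment (by linarith) (by linarith), fun heq => ?_, fun hδ heq => ?_⟩
    · have := ray_injective hu (θ := θ) (η := 0) (by rw [heq]; simp)
      linarith
    · have := ray_injective hu (θ := θ) (η := 1) (by rw [heq]; simp)
      linarith
  have q1 : ∀ u, q u 1 = u := by intro u; simp [hq]
  have hneq : ∀ u : ℝ × ℝ, u.1 ≠ b.1 → ∀ δ : ℝ, ε < δ → (q u ε).1 ≠ (q u δ).1 :=
    fun u hu δ hδ heq => hδ.ne (ray_injective hu heq)
  -- moving to the final positions
  have m2 : pathCross t i (n + 1) (q (t (n + 2)) ε) + rayCross (t i) b (q (t (n + 2)) ε) =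
      pathCross t i (n + 1) (t (n + 2)) + rayCross (t i) b (t (n + 2)) := by
    have hs := hsub (t (n + 2)) 1 (by linarith) le_rfl u2
    have hn := hneq (t (n + 2)) u2 1 (by linarith)
    rw [q1] at hs hn
    refine pathCross_chord_eq (by omega) (fun k _ hk => hxe k (by omega)) u3 hn ?_ ?_
    · intro k h1 h2
      rw [Set.disjoint_left]
      intro p hp hp'
      obtain ⟨g1, g2, -⟩ := hs p hp
      rcases h.edges k (n + 1) (by omega) (by omega) p hp' g1 with g | g
      · exact g2 g.2
      · omega
    · rw [Set.disjoint_left]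
      intro p hp hp'
      obtain ⟨g1, g2, -⟩ := hs p hp
      rw [segment_symm] at hp'
      exact g2 (d23 p g1 hp')
  have m1 : pathCross t 0 i (q (t n) ε) + pathCross t (n + 1) m (q (t n) ε) +
        rayCross (t i) b (q (t n) ε) =
      pathCross t 0 i (t n) + pathCross t (n + 1) m (t n) + rayCross (t i) b (t n) := by
    have hs := hsub (t n) 1 (by linarith) le_rfl u1
    have hn := hneq (t n) u1 1 (by linarith)
    rw [q1] at hs hn
    refine pathCross_outer_chord_eq h.closed (by omega) hxe u3 hn (by omega) ?_ ?_
    · intro k hk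
      rw [Set.disjoint_left]
      intro p hp hp'
      obtain ⟨g1, g2, -⟩ := hs p hp
      rw [segment_symm] at g1
      rcases hk with hk | hk
      · rcases h.edges k n (by omega) (by omega) p hp' g1 with g | g <;> omega
      · rcases h.edges n k (by omega) (by omega) p g1 hp' with g | g
        · have : k = n + 1 := g.1
          subst this
          exact g2 g.2
        · omega
    · rw [Set.disjoint_left]
      intro p hp hp'
      obtain ⟨g1, g2, -⟩ := hs p hp
      rw [segment_symm] at hp'
      exact g2 (d13 p g1 hp')
  -- The chord is traversed only up to its midpoint, so its far end on the polygon is never reached.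
  have m3 : pathCross t 0 m (q (t i) ε) = pathCross t 0 m (midpoint ℝ (t i) b) := by
    have hs := hsub (t i) (1 / 2) hε2.le (by norm_num) u3
    have hn := hneq (t i) u3 (1 / 2) hε2
    have hmid : q (t i) (1 / 2) = midpoint ℝ (t i) b := by
      rw [midpoint_comm, midpoint_eq_smul_add]
      simp only [hq]
      norm_num
      module
    rw [hmid] at hs hn
    refine pathCross_closed_eq h.closed hxe hn fun k hk => ?_
    rw [Set.disjoint_left]
    intro p hp hp'
    obtain ⟨g1, g2, g3⟩ := hs p hp
    rw [segment_symm] at g1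
    rcases hav k hk p g1 hp' with g | g
    · exact g3 (by norm_num) g
    · exact g2 g
  rw [← m1, ← m2, ← m3, c1, c1', c2, c3, pathCross_split t (Nat.zero_le i) hin.le b]
  have hs := three_signs (sub_ne_zero.2 u1) (sub_ne_zero.2 u2) (sub_ne_zero.2 u3)
  rw [← p12, ← p23, ← p31] at hs
  simp only [hq] at hs ⊢
  linear_combination hs + zmod_two_add_self (pathCross t 0 i b) +
    zmod_two_add_self (pathCross t i n b) + zmod_two_add_self (pathCross t (n + 2) m b)

end Theta
end EuclideanTSP

/-! ### Interleaved chords lie on different sides -/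

namespace EuclideanTSP
section Interleaved

variable {t : ℕ → ℝ × ℝ} {m : ℕ}

/-- Two disjoint chords of a simple polygon with interleaved end points lie on different sides. -/
lemma interleaved_parity (h : SimplePolygon t m)
    (hx : ∀ a < m, ∀ b < m, (t a).1 = (t b).1 → a = b) {i k j l : ℕ} (hik : i < k) (hkj : k < j)
    (hjl : j < l) (hlm : l < m) (hav : AvoidsPolygon t m i j) (hav' : AvoidsPolygon t m k l)
    (hdisj : Disjoint (segment ℝ (t i) (t j)) (segment ℝ (t k) (t l))) :
    pathCross t 0 m (midpoint ℝ (t i) (t j)) + pathCross t 0 m (midpoint ℝ (t k) (t l)) = 1 := by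
  obtain ⟨n, rfl⟩ : ∃ n, j = n + 1 := ⟨j - 1, by omega⟩
  have hxe : ∀ k, k < m → (t k).1 ≠ (t (k + 1)).1 := fun k hk => edge_fst_ne h (by omega) hx hk
  have hne : ∀ a < m, ∀ b < m, a ≠ b → (t a).1 ≠ (t b).1 := fun a ha b hb hab heq =>
    hab (hx a ha b hb heq)
  have hc := hne i (by omega) (n + 1) (by omega) (by omega)
  have htheta := theta_parity h hx (i := i) (n := n) (by omega) (by omega) hav
  -- The vertices from n + 2 to l can be joined without meeting the curve formed by the inner path
  -- and the chord, so all have the same parity with respect to it.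
  have inner : ∀ a, n + 2 ≤ a → a ≤ l →
      pathCross t i (n + 1) (t (n + 2)) + rayCross (t i) (t (n + 1)) (t (n + 2)) =
        pathCross t i (n + 1) (t a) + rayCross (t i) (t (n + 1)) (t a) := by
    intro a ha
    induction a, ha using Nat.le_induction with
    | base => intro _; rfl
    | succ a ha ih =>
      intro hal
      rw [ih (by omega)]
      refine pathCross_chord_eq (by omega) (fun k _ hk => hxe k (by omega)) hc
        (hxe a (by omega)) ?_ ?_
      · intro e h1 h2
        rw [Set.disjoint_left]
        intro p hp hp'
        rcases h.edges e a (by omega) (by omega) p hp' hp with g | g <;> omega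
      · rw [Set.disjoint_left]
        intro p hp hp'
        rcases hav a (by omega) p hp' hp with g | g
        · rw [g] at hp
          have := h.vertex_mem_edge (v := i) (by omega) (by omega) hp
          omega
        · rw [g] at hp
          have := h.vertex_mem_edge (v := n + 1) (by omega) (by omega) hp
          omega
  -- Likewise for the vertices from k to n and the curve formed by the outer path and the chord.
  have outer : ∀ a, k ≤ a → a ≤ n →
      pathCross t 0 i (t k) + pathCross t (n + 1) m (t k) + rayCross (t i) (t (n + 1)) (t k) =
      pathCross t 0 i (t a) + pathCross t (n + 1) m (t a) + rayCross (t i) (t (n + 1)) (t a) := by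
    intro a ha
    induction a, ha using Nat.le_induction with
    | base => intro _; rfl
    | succ a ha ih =>
      intro hal
      rw [ih (by omega)]
      refine pathCross_outer_chord_eq h.closed (by omega) hxe hc (hxe a (by omega)) (by omega) ?_ ?_
      · intro e he
        rw [Set.disjoint_left]
        intro p hp hp'
        rcases he with he | he
        · rcases h.edges e a (by omega) (by omega) p hp' hp with g | g <;> omega
        · rcases h.edges a e (by omega) (by omega) p hp hp' with g | g <;> omega
      · rw [Set.disjoint_left]
        intro p hp hp'
        rcases hav a (by omega) p hp' hp with g | g
        · rw [g] at hp
          have := h.vertex_mem_edge (v := i) (by omega) (by omega) hp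
          omega
        · rw [g] at hp
          have := h.vertex_mem_edge (v := n + 1) (by omega) (by omega) hp
          omega
  have hkl := hne k (by omega) l (by omega) (by omega)
  -- Half of the chord, from its midpoint to one end, misses the other end; so it avoids the part of
  -- the polygon containing that other end.
  have half : ∀ u v p : ℝ × ℝ, u.1 ≠ v.1 → p ∈ segment ℝ (midpoint ℝ u v) v →
      p ∈ segment ℝ u v ∧ p ≠ u := by
    intro u v p huv hp
    have e1 : midpoint ℝ u v = u + (1 / 2 : ℝ) • (v - u) := by
      rw [midpoint_eq_smul_add]; norm_num; module
    have e2 : v = u + (1 : ℝ) • (v - u) := by simp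
    rw [e1] at hp
    nth_rewrite 2 [e2] at hp
    obtain ⟨θ, g1, g2, rfl⟩ := mem_segment_ray (by norm_num) hp
    refine ⟨ray_mem_segment (by linarith) g2, fun heq => ?_⟩
    have := ray_injective huv.symm (θ := θ) (η := 0) (by rw [heq]; simp)
    linarith
  have mid_ne : ∀ u v : ℝ × ℝ, u.1 ≠ v.1 → (midpoint ℝ u v).1 ≠ v.1 := by
    intro u v huv heq
    rw [midpoint_eq_smul_add] at heq
    simp at heq
    exact huv (by linarith)
  have m1 : pathCross t i (n + 1) (midpoint ℝ (t k) (t l)) +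
        rayCross (t i) (t (n + 1)) (midpoint ℝ (t k) (t l)) =
      pathCross t i (n + 1) (t l) + rayCross (t i) (t (n + 1)) (t l) := by
    refine pathCross_chord_eq (by omega) (fun k _ hk => hxe k (by omega)) hc
      (mid_ne _ _ hkl) ?_ ?_
    · intro e h1 h2
      rw [Set.disjoint_left]
      intro p hp hp'
      obtain ⟨g1, g2⟩ := half _ _ _ hkl hp
      rcases hav' e (by omega) p g1 hp' with g | g
      · exact g2 g
      · rw [g] at hp'
        have := h.vertex_mem_edge (v := l) (by omega) (by omega) hp'
        omega
    · exact (hdisj.symm).mono_left fun p hp => (half _ _ _ hkl hp).1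
  have m2 : pathCross t 0 i (midpoint ℝ (t k) (t l)) +
        pathCross t (n + 1) m (midpoint ℝ (t k) (t l)) +
        rayCross (t i) (t (n + 1)) (midpoint ℝ (t k) (t l)) =
      pathCross t 0 i (t k) + pathCross t (n + 1) m (t k) + rayCross (t i) (t (n + 1)) (t k) := by
    rw [midpoint_comm]
    refine pathCross_outer_chord_eq h.closed (by omega) hxe hc (mid_ne _ _ hkl.symm)
      (by omega) ?_ ?_
    · intro e he
      rw [Set.disjoint_left]
      intro p hp hp'
      obtain ⟨g1, g2⟩ := half _ _ _ hkl.symm hp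
      rw [segment_symm] at g1
      rcases hav' e (by omega) p g1 hp' with g | g
      · rw [g] at hp'
        have := h.vertex_mem_edge (v := k) (by omega) (by omega) hp'
        omega
      · exact g2 g
    · refine (hdisj.symm).mono_left fun p hp => ?_
      rw [segment_symm]
      exact (half _ _ _ hkl.symm hp).1
  -- Both parities in `theta_parity` are now transported to the midpoint of the second chord. Adding
  -- them counts the first chord twice and leaves the parity with respect to the whole polygon.
  have i1 := inner l (by omega) le_rfl
  have o1 := outer n (by omega) le_rfl
  have s1 := pathCross_split t (Nat.zero_le i) (by omega : i ≤ m) (midpoint ℝ (t k) (t l))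
  have s2 := pathCross_split t (by omega : i ≤ n + 1) (by omega : n + 1 ≤ m)
    (midpoint ℝ (t k) (t l))
  linear_combination htheta + s1 + s2 + m1 + m2 - i1 + o1 -
    zmod_two_add_self (rayCross (t i) (t (n + 1)) (midpoint ℝ (t k) (t l)))

end Interleaved

lemma SimplePolygon.map {E E' : Type*} [AddCommGroup E] [Module ℝ E] [AddCommGroup E'] [Module ℝ E']
    {t : ℕ → E} {m : ℕ} (h : SimplePolygon t m) (φ : E →ₗ[ℝ] E') (hφ : Function.Injective φ) :
    SimplePolygon (fun k => φ (t k)) m where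
  closed := by simp [h.closed]
  inj a ha b hb hab := h.inj a ha b hb (hφ hab)
  edges a b hab hb p hp hp' := by
    have himg : ∀ x y : E, segment ℝ (φ x) (φ y) = φ '' segment ℝ x y := fun x y =>
      (image_segment ℝ φ.toAffineMap x y).symm
    rw [himg] at hp hp'
    obtain ⟨x, hx, rfl⟩ := hp
    obtain ⟨y, hy, hxy⟩ := hp'
    rw [hφ hxy] at hy
    rcases h.edges a b hab hb x hx hy with h1 | h1
    · exact Or.inl ⟨h1.1, by rw [h1.2]⟩
    · exact Or.inr ⟨h1.1, h1.2.1, by rw [h1.2.2]⟩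

lemma AvoidsPolygon.map {E E' : Type*} [AddCommGroup E] [Module ℝ E] [AddCommGroup E'] [Module ℝ E']
    {t : ℕ → E} {m i j : ℕ} (h : AvoidsPolygon t m i j) (φ : E →ₗ[ℝ] E')
    (hφ : Function.Injective φ) : AvoidsPolygon (fun k => φ (t k)) m i j := by
  intro a ha p hp hp'
  have himg : ∀ x y : E, segment ℝ (φ x) (φ y) = φ '' segment ℝ x y := fun x y =>
    (image_segment ℝ φ.toAffineMap x y).symm
  rw [himg] at hp hp'
  obtain ⟨x, hx, rfl⟩ := hp
  obtain ⟨y, hy, hxy⟩ := hp'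
  rw [hφ hxy] at hy
  rcases h a ha x hx hy with h1 | h1
  · exact Or.inl (by rw [h1])
  · exact Or.inr (by rw [h1])

/-- The shear `(x, y) ↦ (x + s y, y)`. -/
noncomputable def shear (s : ℝ) : Plane →ₗ[ℝ] ℝ × ℝ where
  toFun p := (p 0 + s * p 1, p 1)
  map_add' p q := by ext <;> simp; ring
  map_smul' c p := by ext <;> simp; ring

lemma plane_ext {p q : Plane} (h0 : p 0 = q 0) (h1 : p 1 = q 1) : p = q := by
  ext i; fin_cases i
  · exact h0
  · exact h1

lemma shear_injective (s : ℝ) : Function.Injective (shear s) := by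
  intro p q h
  have h1 : p 1 = q 1 := congrArg Prod.snd h
  have h0 : p 0 + s * p 1 = q 0 + s * q 1 := congrArg Prod.fst h
  rw [h1] at h0
  exact plane_ext (by linarith) h1

/-- Each pair of different points excludes at most one value of s. Distinct abscissas of the
vertices are the general position needed for ray crossings. -/
lemma exists_shear (A : Finset Plane) :
    ∃ s : ℝ, ∀ p ∈ A, ∀ q ∈ A, (shear s p).1 = (shear s q).1 → p = q := by
  classical
  obtain ⟨s, hs⟩ := Infinite.exists_notMem_finset
    ((A ×ˢ A).image fun x => (x.1 0 - x.2 0) / (x.2 1 - x.1 1))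
  refine ⟨s, fun p hp q hq h => ?_⟩
  have h0 : p 0 + s * p 1 = q 0 + s * q 1 := h
  by_cases h1 : p 1 = q 1
  · rw [h1] at h0
    exact plane_ext (by linarith) h1
  · exfalso
    apply hs
    rw [Finset.mem_image]
    refine ⟨(p, q), by simp [hp, hq], ?_⟩
    have : q 1 - p 1 ≠ 0 := sub_ne_zero.2 fun h => h1 h.symm
    simp only
    rw [div_eq_iff this]
    linarith

/-- The chords of a simple polygon are of two sorts such that interleaved chords of the same sort
intersect. -/
lemma exists_side {t : ℕ → Plane} {m : ℕ} (h : SimplePolygon t m) :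
    ∃ side : ℕ → ℕ → ZMod 2, (∀ i j, side i j = side j i) ∧
      ∀ i k j l, i < k → k < j → j < l → l < m → AvoidsPolygon t m i j → AvoidsPolygon t m k l →
        Disjoint (segment ℝ (t i) (t j)) (segment ℝ (t k) (t l)) → side i j ≠ side k l := by
  classical
  obtain ⟨s, hs⟩ := exists_shear ((Finset.range m).image t)
  have hinj := shear_injective s
  refine ⟨fun i j => pathCross (fun k => shear s (t k)) 0 m
    (midpoint ℝ (shear s (t i)) (shear s (t j))), fun i j => by beta_reduce; rw [midpoint_comm], ?_⟩
  intro i k j l h1 h2 h3 h4 h5 h6 h7 heq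
  have := interleaved_parity (h.map (shear s) hinj) (fun a ha b hb hab => h.inj a ha b hb
    (hs _ (Finset.mem_image_of_mem _ (Finset.mem_range.2 ha)) _
      (Finset.mem_image_of_mem _ (Finset.mem_range.2 hb)) hab)) h1 h2 h3 h4
    (h5.map (shear s) hinj) (h6.map (shear s) hinj) (by
      have himg : ∀ x y : Plane, segment ℝ (shear s x) (shear s y) = shear s '' segment ℝ x y :=
        fun x y => (image_segment ℝ (shear s).toAffineMap x y).symm
      rw [himg, himg]
      exact (Set.disjoint_image_iff hinj).2 h7)
  simp only at heq
  rw [heq, zmod_two_add_self] at this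
  exact absurd this (by decide)

end EuclideanTSP

/-! ### 2-optimal families of chords of a simple polygon -/

namespace EuclideanTSP

/-- The points j and k lie on the ray from i through p, beyond p; whichever is nearer lies between p
and the other. -/
lemma mem_segment_or_of_ray {E : Type*} [AddCommGroup E] [Module ℝ E] {i j k p : E}
    (h1 : p ∈ segment ℝ i j) (h2 : p ∈ segment ℝ i k) (hp : p ≠ i) :
    k ∈ segment ℝ p j ∨ j ∈ segment ℝ p k := by
  have key : ∀ (a b : ℝ) (j k : E), 0 < a → a ≤ b → b ≤ 1 → i + a • (j - i) = p →
      i + b • (k - i) = p → k ∈ segment ℝ p j := by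
    intro a b j k ha hab hb e1 e2
    have hb0 : 0 < b := ha.trans_le hab
    have e3 : b • (k - i) = a • (j - i) := add_left_cancel (e2.trans e1.symm)
    have e4 : k - i = (a / b) • (j - i) := by
      rw [div_eq_inv_mul, mul_smul, ← e3, smul_smul, inv_mul_cancel₀ hb0.ne', one_smul]
    rw [segment_eq_image']
    by_cases ha1 : a = 1
    · have : b = 1 := by linarith
      refine ⟨0, by simp, ?_⟩
      rw [this, one_smul] at e2
      simp [← e2]
    · have ha2 : 0 < 1 - a := by
        have : a < 1 := lt_of_le_of_ne (hab.trans hb) ha1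
        linarith
      refine ⟨(a / b - a) / (1 - a), ⟨?_, ?_⟩, ?_⟩
      · refine div_nonneg (sub_nonneg.2 ?_) ha2.le
        rw [le_div_iff₀ hb0]; nlinarith
      · rw [div_le_one ha2]
        have : a / b ≤ 1 := (div_le_one hb0).2 hab
        linarith
      · have e5 : k = i + (a / b) • (j - i) := by rw [← e4]; abel
        rw [e5, ← e1]
        have e6 : j - (i + a • (j - i)) = (1 - a) • (j - i) := by module
        rw [e6]
        beta_reduce
        rw [smul_smul, div_mul_cancel₀ _ ha2.ne']
        module
  rw [segment_eq_image'] at h1 h2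
  obtain ⟨a, ⟨ha0, ha1⟩, rfl⟩ := h1
  obtain ⟨b, ⟨hb0, hb1⟩, hb⟩ := h2
  simp only at hb hp
  have ha : 0 < a := lt_of_le_of_ne ha0 (by rintro rfl; simp at hp)
  have hb' : 0 < b := lt_of_le_of_ne hb0 (by
    rintro rfl
    rw [zero_smul, add_zero] at hb
    exact hp hb.symm)
  rcases le_total a b with h | h
  · exact Or.inl (key a b j k ha h hb1 rfl hb)
  · exact Or.inr (key b a k j hb' h ha1 hb rfl)

lemma mem_segment_of_dist {p x y : Plane} (h : dist x p + dist p y ≤ dist x y) :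
    p ∈ segment ℝ x y := by
  rw [mem_segment_iff_wbtw, ← dist_add_dist_eq_iff]
  exact le_antisymm h (dist_triangle _ _ _)

lemma dist_of_mem_segment {p x y : Plane} (h : p ∈ segment ℝ x y) :
    dist x p + dist p y = dist x y := by
  rwa [mem_segment_iff_wbtw, ← dist_add_dist_eq_iff] at h

/-- If two segments meet in `p` and cannot be improved by a 2-move, then they are collinear. -/
lemma mem_segment_of_not_improving {a b x y p : Plane}
    (hopt : dist a b + dist x y ≤ dist a x + dist b y) (h1 : p ∈ segment ℝ a b)
    (h2 : p ∈ segment ℝ x y) : p ∈ segment ℝ a x ∧ p ∈ segment ℝ b y := by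
  have e1 := dist_of_mem_segment h1
  have e2 := dist_of_mem_segment h2
  have t1 := dist_triangle a p x
  have t2 := dist_triangle b p y
  have c1 := dist_comm p b
  have c2 := dist_comm x p
  constructor
  · apply mem_segment_of_dist; linarith
  · apply mem_segment_of_dist; linarith

/-- A common point makes the triangle inequalities for the 2-move tight, so both chords lie on one
line in such a way that an end of one is contained in the other, contradicting that a chord meets
the polygon only in its own ends. -/
lemma disjoint_of_interleaved {t : ℕ → Plane} {m : ℕ} (h : SimplePolygon t m) {i k j l : ℕ}
    (hik : i < k) (hkj : k < j) (hjl : j < l) (hlm : l < m) (hav : AvoidsPolygon t m i j)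
    (hav' : AvoidsPolygon t m k l)
    (hopt : dist (t i) (t j) + dist (t k) (t l) ≤ dist (t i) (t k) + dist (t j) (t l)) :
    Disjoint (segment ℝ (t i) (t j)) (segment ℝ (t k) (t l)) := by
  rw [Set.disjoint_left]
  intro p h1 h2
  obtain ⟨h3, h4⟩ := mem_segment_of_not_improving hopt h1 h2
  have on1 : ∀ a < m, t a ∈ segment ℝ (t i) (t j) → a = i ∨ a = j := by
    intro a ha hmem
    rcases hav a ha _ hmem (left_mem_segment _ _ _) with g | g
    · exact Or.inl (h.inj a ha i (by omega) g)
    · exact Or.inr (h.inj a ha j (by omega) g)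
  have on2 : ∀ a < m, t a ∈ segment ℝ (t k) (t l) → a = k ∨ a = l := by
    intro a ha hmem
    rcases hav' a ha _ hmem (left_mem_segment _ _ _) with g | g
    · exact Or.inl (h.inj a ha k (by omega) g)
    · exact Or.inr (h.inj a ha l (by omega) g)
  have hpi : p ≠ t i := by
    rintro rfl
    have := on2 i (by omega) h2
    omega
  rcases mem_segment_or_of_ray h1 h3 hpi with g | g
  · have := on1 k (by omega) ((convex_segment (t i) (t j)).segment_subset h1
      (right_mem_segment _ _ _) g)
    omega
  · have := on2 j (by omega) ((convex_segment (t k) (t l)).segment_subset h2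
      (left_mem_segment _ _ _) g)
    omega

/-- The chord between two cyclically adjacent vertices, i.e. an edge of the polygon. -/
def IsAdjacentPair (m i j : ℕ) : Prop :=
  j = i + 1 ∨ i = j + 1 ∨ (i = 0 ∧ j + 1 = m) ∨ (j = 0 ∧ i + 1 = m)

/-- The total length of a 2-optimal family of directed chords of a simple polygon. -/
lemma sum_chords_le {t : ℕ → Plane} {m : ℕ} (h : SimplePolygon t m) (E : Finset (ℕ × ℕ))
    (hE : ∀ e ∈ E, e.1 < m ∧ e.2 < m ∧ e.1 ≠ e.2)
    (hav : ∀ e ∈ E, AvoidsPolygon t m e.1 e.2 ∨ IsAdjacentPair m e.1 e.2)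
    (hopt : ∀ e ∈ E, ∀ f ∈ E, e ≠ f → dist (t e.1) (t e.2) + dist (t f.1) (t f.2) ≤
      dist (t e.1) (t f.1) + dist (t e.2) (t f.2)) {K : ℝ} (hK : 1 < K)
    (hT : 0 < ∑ r ∈ Finset.range m, dist (t r) (t (r + 1))) :
    ∑ e ∈ E, dist (t e.1) (t e.2) ≤ 4 * ((∑ r ∈ Finset.range m, dist (t r) (t (r + 1))) *
      (K / 2 + (1 + 2 * Real.log (E.card + 1)) / Real.log K)) := by
  classical
  obtain ⟨side, hsymm, hside⟩ := exists_side h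
  set T := ∑ r ∈ Finset.range m, dist (t r) (t (r + 1))
  set B := T * (K / 2 + (1 + 2 * Real.log (E.card + 1)) / Real.log K) with hB
  have hlogK := Real.log_pos hK
  have hclass : ∀ F : Finset (ℕ × ℕ), ∀ s : ZMod 2, F.card ≤ E.card →
      (∀ e ∈ F, e.1 < e.2 ∧ e.2 < m ∧ side e.1 e.2 = s ∧
        (AvoidsPolygon t m e.1 e.2 ∨ IsAdjacentPair m e.1 e.2)) →
      (∀ e ∈ F, ∀ f ∈ F, e ≠ f → dist (t e.1) (t e.2) + dist (t f.1) (t f.2) ≤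
        dist (t e.1) (t f.1) + dist (t e.2) (t f.2)) →
      ∑ e ∈ F, dist (t e.1) (t e.2) ≤ B := by
    intro F s hcard hF hoptF
    refine (sum_laminar_le t m h.closed F (fun f hf => ⟨(hF f hf).1, (hF f hf).2.1⟩) ?_ hoptF hK
      hT).trans ?_
    · rintro e he f hf ⟨h1, h2, h3⟩
      obtain ⟨e1, e2, e3, e4⟩ := hF e he
      obtain ⟨f1, f2, f3, f4⟩ := hF f hf
      -- An edge of the polygon has no vertex strictly between its ends on one of the two sides, so
      -- it never interleaves.
      have e4 : AvoidsPolygon t m e.1 e.2 := e4.resolve_right (by unfold IsAdjacentPair; omega)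
      have f4 : AvoidsPolygon t m f.1 f.2 := f4.resolve_right (by unfold IsAdjacentPair; omega)
      have hne : e ≠ f := by rintro rfl; omega
      exact hside e.1 f.1 e.2 f.2 h1 h2 h3 f2 e4 f4
        (disjoint_of_interleaved h h1 h2 h3 f2 e4 f4 (hoptF e he f hf hne)) (e3.trans f3.symm)
    · rw [hB]
      have : (F.card : ℝ) ≤ E.card := by exact_mod_cast hcard
      gcongr
  -- Two directions times two sides give the factor 4.
  have hfib : ∑ e ∈ E, dist (t e.1) (t e.2) = ∑ y : Bool × ZMod 2,
      ∑ e ∈ E with (decide (e.1 < e.2), side e.1 e.2) = y, dist (t e.1) (t e.2) :=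
    (Finset.sum_fiberwise_of_maps_to (fun _ _ => Finset.mem_univ _) _).symm
  rw [hfib]
  have hle : ∀ y ∈ (Finset.univ : Finset (Bool × ZMod 2)),
      ∑ e ∈ E with (decide (e.1 < e.2), side e.1 e.2) = y, dist (t e.1) (t e.2) ≤ B := by
    rintro ⟨d, s⟩ -
    cases d with
    | true =>
      refine hclass _ s (Finset.card_filter_le _ _) ?_ ?_
      · intro e he
        simp only [Finset.mem_filter, Prod.mk.injEq, decide_eq_true_eq] at he
        exact ⟨he.2.1, (hE e he.1).2.1, he.2.2, hav e he.1⟩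
      · intro e he f hf hne
        exact hopt e (Finset.mem_filter.1 he).1 f (Finset.mem_filter.1 hf).1 hne
    | false =>
      -- Backward chords are reversed; the 2-optimality condition is invariant under reversing both
      -- segments.
      have := hclass ((E.filter fun e => (decide (e.1 < e.2), side e.1 e.2) = (false, s)).map
        (Equiv.prodComm ℕ ℕ).toEmbedding) s (by
          rw [Finset.card_map]; exact Finset.card_filter_le _ _) ?_ ?_
      · rw [Finset.sum_map] at this
        refine le_trans (le_of_eq ?_) this
        refine Finset.sum_congr rfl fun e _ => ?_
        simp [dist_comm]
      · intro e he
        simp only [Finset.mem_map, Finset.mem_filter, Prod.mk.injEq, decide_eq_false_iff_not] at he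
        obtain ⟨f, ⟨hf, h1, h2⟩, rfl⟩ := he
        obtain ⟨g1, g2, g3⟩ := hE f hf
        simp only [Equiv.coe_toEmbedding, Equiv.prodComm_apply, Prod.fst_swap, Prod.snd_swap]
        refine ⟨by omega, g1, by rw [hsymm]; exact h2, ?_⟩
        refine (hav f hf).imp (fun h a ha p hp hp' => ?_) fun h => ?_
        · rw [segment_symm] at hp
          exact (h a ha p hp hp').symm
        · unfold IsAdjacentPair at h ⊢; omega
      · intro e he f hf hne
        simp only [Finset.mem_map, Finset.mem_filter] at he hf
        obtain ⟨e, ⟨he, -⟩, rfl⟩ := he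
        obtain ⟨f, ⟨hf, -⟩, rfl⟩ := hf
        have := hopt e he f hf (by rintro rfl; exact hne rfl)
        simp only [Equiv.coe_toEmbedding, Equiv.prodComm_apply, Prod.fst_swap, Prod.snd_swap]
        rw [dist_comm (t e.2), dist_comm (t f.2) (t f.1)]
        linarith
  refine (Finset.sum_le_sum hle).trans (le_of_eq ?_)
  rw [Finset.sum_const, Finset.card_univ, Fintype.card_prod, Fintype.card_bool, ZMod.card]
  norm_num

end EuclideanTSP

/-! ### Subdividing polygons and 2-optimal families -/

namespace EuclideanTSP

lemma ray_mem_segment_ray {E : Type*} [AddCommGroup E] [Module ℝ E] (b d : E) {ξ π β : ℝ}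
    (h : (ξ ≤ π ∧ π ≤ β) ∨ (β ≤ π ∧ π ≤ ξ)) :
    b + π • d ∈ segment ℝ (b + ξ • d) (b + β • d) := by
  have key : ∀ ξ β : ℝ, ξ ≤ π → π ≤ β → b + π • d ∈ segment ℝ (b + ξ • d) (b + β • d) := by
    intro ξ β h1 h2
    rcases (h1.trans h2).eq_or_lt with h3 | h3
    · have : π = ξ := by linarith
      rw [this]; exact left_mem_segment _ _ _
    · have h4 : 0 < β - ξ := sub_pos.2 h3
      rw [segment_eq_image']
      refine ⟨(π - ξ) / (β - ξ), ⟨div_nonneg (by linarith) h4.le, ?_⟩, ?_⟩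
      · rw [div_le_one h4]; linarith
      · have e : b + β • d - (b + ξ • d) = (β - ξ) • d := by module
        beta_reduce
        rw [e, smul_smul, div_mul_cancel₀ _ h4.ne']
        module
  rcases h with h | h
  · exact key ξ β h.1 h.2
  · rw [segment_symm]; exact key β ξ h.1 h.2

/-- On a line, a point between `u` and `w` lies between `x` and one of `u`, `w`. -/
lemma mem_segment_or_of_collinear {E : Type*} [AddCommGroup E] [Module ℝ E] {a b x u w p : E}
    (hx : x ∈ segment ℝ a b) (hu : u ∈ segment ℝ a b) (hw : w ∈ segment ℝ a b)
    (hp : p ∈ segment ℝ u w) : p ∈ segment ℝ x u ∨ p ∈ segment ℝ x w := by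
  rw [segment_eq_image'] at hx hu hw
  obtain ⟨ξ, -, rfl⟩ := hx
  obtain ⟨α, -, rfl⟩ := hu
  obtain ⟨β, -, rfl⟩ := hw
  rw [segment_eq_image'] at hp
  obtain ⟨θ, ⟨h0, h1⟩, rfl⟩ := hp
  have e : a + α • (b - a) + θ • (a + β • (b - a) - (a + α • (b - a))) =
      a + (α + θ * (β - α)) • (b - a) := by module
  beta_reduce
  rw [e]
  have hπ : (α ≤ α + θ * (β - α) ∧ α + θ * (β - α) ≤ β) ∨
      (β ≤ α + θ * (β - α) ∧ α + θ * (β - α) ≤ α) := by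
    rcases le_total α β with h | h
    · left; constructor <;> nlinarith
    · right; constructor <;> nlinarith
  generalize α + θ * (β - α) = π at hπ
  rcases le_total ξ π with h | h <;> rcases hπ with h2 | h2
  · exact Or.inr (ray_mem_segment_ray _ _ (Or.inl ⟨h, h2.2⟩))
  · exact Or.inl (ray_mem_segment_ray _ _ (Or.inl ⟨h, h2.2⟩))
  · exact Or.inl (ray_mem_segment_ray _ _ (Or.inr ⟨h2.1, h⟩))
  · exact Or.inr (ray_mem_segment_ray _ _ (Or.inr ⟨h2.1, h⟩))

lemma mem_openSegment_of_mem {E : Type*} [AddCommGroup E] [Module ℝ E] {u w p : E}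
    (h : p ∈ segment ℝ u w) (h1 : p ≠ u) (h2 : p ≠ w) : p ∈ openSegment ℝ u w :=
  mem_openSegment_of_ne_left_right h1.symm h2.symm h

lemma ne_of_mem_openSegment {E : Type*} [AddCommGroup E] [Module ℝ E] {u w p : E}
    (h : p ∈ openSegment ℝ u w) (hne : u ≠ w) : p ≠ u ∧ p ≠ w := by
  constructor
  · rintro rfl
    exact hne (left_mem_openSegment_iff.1 h)
  · rintro rfl
    exact hne (right_mem_openSegment_iff.1 h)

/-- A segment `x z` through an interior point of `u w`, with end points outside the interior of
`u w` but on the same line, covers `u w`. -/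
lemma covers_of_mem_openSegment {E : Type*} [AddCommGroup E] [Module ℝ E] {a b x z u w p : E}
    (hx : x ∈ segment ℝ a b) (hu : u ∈ segment ℝ a b) (hw : w ∈ segment ℝ a b) (hne : u ≠ w)
    (hp : p ∈ openSegment ℝ u w) (hxz : p ∈ segment ℝ x z) (hpx : p ≠ x)
    (hx' : x ∉ openSegment ℝ u w) (hz' : z ∉ openSegment ℝ u w) :
    u ∈ segment ℝ x z ∧ w ∈ segment ℝ x z := by
  have key : ∀ u w : E, u ≠ w → p ∈ openSegment ℝ u w →
      x ∉ openSegment ℝ u w → z ∉ openSegment ℝ u w → p ∈ segment ℝ x w →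
      u ∈ segment ℝ x z ∧ w ∈ segment ℝ x z := by
    intro u w hne hp hx' hz' hxw
    have hps := openSegment_subset_segment _ _ _ hp
    obtain ⟨hpu, hpw⟩ := ne_of_mem_openSegment hp hne
    have hu1 : u ∈ segment ℝ p x := by
      rcases mem_segment_or_of_ray (i := w) (j := x) (k := u) (p := p)
        (by rwa [segment_symm]) (by rwa [segment_symm]) hpw with g | g
      · exact g
      · have hxm : x ∈ segment ℝ u w := (convex_segment u w).segment_subset hps
          (left_mem_segment _ _ _) g
        have : x = u := by
          by_contra hxu
          have hxw' : x ≠ w := by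
            rintro rfl
            rw [segment_same] at hxw
            exact hpw hxw
          exact hx' (mem_openSegment_of_mem hxm hxu hxw')
        rw [this]; exact right_mem_segment _ _ _
    have hw1 : w ∈ segment ℝ p z := by
      rcases mem_segment_or_of_ray (i := x) (j := z) (k := w) (p := p) hxz hxw hpx with g | g
      · exact g
      · have hzm : z ∈ segment ℝ u w := (convex_segment u w).segment_subset hps
          (right_mem_segment _ _ _) g
        have : z = w := by
          by_contra hzw
          by_cases hzu : z = u
          · subst hzu
            -- `z = u ∈ [p, w]` and `p ∈ [u, w]` force `p = u`
            rw [segment_eq_image'] at g hps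
            obtain ⟨θ, ⟨t0, t1⟩, e1⟩ := g
            obtain ⟨η, ⟨s0, s1⟩, e2⟩ := hps
            beta_reduce at e1 e2
            have e3 : (1 - (1 - θ) * (1 - η)) • (w - z) = 0 := by
              have : z + (1 - (1 - θ) * (1 - η)) • (w - z) = z := by
                calc _ = (z + η • (w - z)) + θ • (w - (z + η • (w - z))) := by module
                  _ = z := by rw [e2, e1]
              simpa using this
            rcases smul_eq_zero.1 e3 with h | h
            · have : η = 0 := by nlinarith
              rw [this] at e2
              exact hpu (by rw [← e2]; simp)
            · exact hne (sub_eq_zero.1 h).symm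
          · exact hz' (mem_openSegment_of_mem hzm hzu hzw)
        rw [this]; exact right_mem_segment _ _ _
    refine ⟨?_, ?_⟩
    · exact (convex_segment x z).segment_subset hxz (left_mem_segment _ _ _) hu1
    · exact (convex_segment x z).segment_subset hxz (right_mem_segment _ _ _) hw1
  rcases mem_segment_or_of_collinear hx hu hw (openSegment_subset_segment _ _ _ hp) with g | g
  · rw [openSegment_symm] at hp hx' hz'
    exact (key w u hne.symm hp hx' hz' g).symm
  · exact key u w hne hp hx' hz' g

lemma segment_antisymm {a p x : Plane} (h1 : x ∈ segment ℝ a p) (h2 : p ∈ segment ℝ a x) :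
    x = p := by
  have e1 := dist_of_mem_segment h1
  have e2 := dist_of_mem_segment h2
  have e3 := dist_comm x p
  have : dist x p = 0 := by linarith
  exact dist_eq_zero.1 this

/-- Inserting a point of an edge as a new vertex keeps a polygon simple. -/
lemma SimplePolygon.exists_insert {t : ℕ → Plane} {m : ℕ} (h : SimplePolygon t m) {r : ℕ}
    (hr : r < m) {p : Plane} (hp : p ∈ segment ℝ (t r) (t (r + 1))) (hnew : ∀ a < m, p ≠ t a) :
    ∃ t' : ℕ → Plane, SimplePolygon t' (m + 1) ∧
      (∀ x, (∃ k < m + 1, t' k = x) ↔ x = p ∨ ∃ k < m, t k = x) ∧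
      ∑ k ∈ Finset.range (m + 1), dist (t' k) (t' (k + 1)) =
        ∑ k ∈ Finset.range m, dist (t k) (t (k + 1)) ∧
      (∀ x a, a < m → x ∈ segment ℝ (t a) (t (a + 1)) →
        ∃ b < m + 1, x ∈ segment ℝ (t' b) (t' (b + 1))) ∧
      ∀ a < m + 1, ∃ b < m, segment ℝ (t' a) (t' (a + 1)) ⊆ segment ℝ (t b) (t (b + 1)) := by
  -- The vertices after r are shifted by one to make room for p at position r + 1.
  set t' : ℕ → Plane := fun k => if k ≤ r then t k else if k = r + 1 then p else t (k - 1) with ht'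
  have hlow : ∀ k, k ≤ r → t' k = t k := fun k hk => by simp [ht', hk]
  have hmid : t' (r + 1) = p := by simp [ht']
  have hhigh : ∀ k, r + 1 ≤ k → t' (k + 1) = t k := fun k hk => by
    have h1 : ¬ k + 1 ≤ r := by omega
    have h2 : k ≠ r := by omega
    simp [ht', h1, h2]
  have hnew' : ∀ a ≤ m, p ≠ t a := by
    intro a ha
    rcases ha.lt_or_eq with h1 | rfl
    · exact hnew a h1
    · rw [h.closed]; exact hnew 0 (by omega)
  have hnl : t (r + 1) ∉ segment ℝ (t r) p := fun hmem =>
    hnew' (r + 1) (by omega) (segment_antisymm hmem hp).symm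
  have hnr : t r ∉ segment ℝ p (t (r + 1)) := fun hmem =>
    hnew' r hr.le (segment_antisymm (by rwa [segment_symm]) (by rwa [segment_symm])).symm
  -- the edges of the new polygon
  have hedge : ∀ a < m + 1, (a < r ∧ t' a = t a ∧ t' (a + 1) = t (a + 1)) ∨
      (a = r ∧ t' a = t r ∧ t' (a + 1) = p) ∨ (a = r + 1 ∧ t' a = p ∧ t' (a + 1) = t (r + 1)) ∨
      (r + 1 < a ∧ t' a = t (a - 1) ∧ t' (a + 1) = t (a - 1 + 1)) := by
    intro a ha
    rcases lt_trichotomy a r with h1 | h1 | h1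
    · exact Or.inl ⟨h1, hlow a h1.le, hlow _ h1⟩
    · subst h1; exact Or.inr (Or.inl ⟨rfl, hlow a le_rfl, hmid⟩)
    · rcases Nat.lt_or_ge (r + 1) a with h2 | h2
      · refine Or.inr (Or.inr (Or.inr ⟨h2, ?_, ?_⟩))
        · have := hhigh (a - 1) (by omega)
          rwa [Nat.sub_add_cancel (by omega)] at this
        · rw [hhigh a (by omega), Nat.sub_add_cancel (by omega)]
      · have : a = r + 1 := by omega
        subst this
        exact Or.inr (Or.inr (Or.inl ⟨rfl, hmid, hhigh _ le_rfl⟩))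
  have hsub1 : segment ℝ (t r) p ⊆ segment ℝ (t r) (t (r + 1)) :=
    (convex_segment _ _).segment_subset (left_mem_segment _ _ _) hp
  have hsub2 : segment ℝ p (t (r + 1)) ⊆ segment ℝ (t r) (t (r + 1)) :=
    (convex_segment _ _).segment_subset hp (right_mem_segment _ _ _)
  have hvert : ∀ k < m + 1, (k ≤ r ∧ t' k = t k) ∨ (k = r + 1 ∧ t' k = p) ∨
      (r + 1 < k ∧ t' k = t (k - 1)) := by
    intro k hk
    rcases hedge k hk with h1 | h1 | h1 | h1
    · exact Or.inl ⟨h1.1.le, h1.2.1⟩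
    · exact Or.inl ⟨h1.1.le, by rw [h1.2.1, h1.1]⟩
    · exact Or.inr (Or.inl ⟨h1.1, h1.2.1⟩)
    · exact Or.inr (Or.inr ⟨h1.1, h1.2.1⟩)
  refine ⟨t', ⟨?_, ?_, ?_⟩, ?_, ?_, ?_, ?_⟩
  · rw [hlow 0 (by omega), ← h.closed]
    exact hhigh m (by omega)
  · intro a ha b hb hab
    rcases hvert a ha with h1 | h1 | h1 <;> rcases hvert b hb with h2 | h2 | h2 <;>
      rw [h1.2, h2.2] at hab
    · exact h.inj a (by omega) b (by omega) hab
    · exact absurd hab.symm (hnew a (by omega))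
    · have := h.inj a (by omega) _ (by omega) hab; omega
    · exact absurd hab (hnew b (by omega))
    · omega
    · exact absurd hab (hnew _ (by omega))
    · have := h.inj _ (by omega) b (by omega) hab; omega
    · exact absurd hab.symm (hnew _ (by omega))
    · have := h.inj _ (by omega) _ (by omega) hab; omega
  · intro a b hab hb x hxa hxb
    have h0 : t' 0 = t 0 := hlow 0 (by omega)
    rw [h0]
    rcases hedge a (by omega) with h1 | h1 | h1 | h1 <;> rcases hedge b hb with h2 | h2 | h2 | h2 <;>
      obtain ⟨h1, a1, a2⟩ := h1 <;> obtain ⟨h2, b1, b2⟩ := h2 <;> rw [a1, a2] at hxa <;>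
      rw [b1, b2] at hxb <;> rw [b1]
    · rcases h.edges a b hab (by omega) x hxa hxb with g | g
      · exact Or.inl g
      · omega
    · rcases h.edges a r h1 hr x hxa (hsub1 hxb) with g | g
      · exact Or.inl ⟨by omega, g.2⟩
      · exfalso
        rw [g.2.2, ← h.closed, ← g.2.1] at hxb
        exact hnl hxb
    · rcases h.edges a r h1 hr x hxa (hsub2 hxb) with g | g
      · exfalso
        rw [g.2] at hxb
        exact hnr hxb
      · exact Or.inr ⟨by omega, by omega, g.2.2⟩
    · rcases h.edges a (b - 1) (by omega) (by omega) x hxa hxb with g | g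
      · omega
      · exact Or.inr ⟨by omega, by omega, g.2.2⟩
    · omega
    · omega
    · left
      refine ⟨by omega, ?_⟩
      have e1 := dist_of_mem_segment hxa
      have e2 := dist_of_mem_segment hxb
      have e3 := dist_of_mem_segment hp
      have e4 := dist_triangle (t r) x (t (r + 1))
      have e5 := dist_comm x p
      exact dist_eq_zero.1 (by linarith [dist_nonneg (x := x) (y := p)])
    · rcases h.edges r (b - 1) (by omega) (by omega) x (hsub1 hxa) hxb with g | g
      · exfalso
        rw [g.2, g.1] at hxa
        exact hnl hxa
      · exact Or.inr ⟨by omega, by omega, g.2.2⟩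
    · omega
    · omega
    · omega
    · rcases h.edges r (b - 1) (by omega) (by omega) x (hsub2 hxa) hxb with g | g
      · exact Or.inl ⟨by omega, g.2⟩
      · exfalso
        rw [g.2.2, ← g.1] at hxa
        exact hnr hxa
    · omega
    · omega
    · omega
    · rcases h.edges (a - 1) (b - 1) (by omega) (by omega) x hxa hxb with g | g
      · exact Or.inl ⟨by omega, g.2⟩
      · omega
  · intro x
    constructor
    · rintro ⟨k, hk, rfl⟩
      rcases hvert k hk with h1 | h1 | h1
      · exact Or.inr ⟨k, by omega, h1.2.symm⟩
      · exact Or.inl h1.2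
      · exact Or.inr ⟨k - 1, by omega, h1.2.symm⟩
    · rintro (rfl | ⟨k, hk, rfl⟩)
      · exact ⟨r + 1, by omega, hmid⟩
      · rcases Nat.lt_or_ge r k with h1 | h1
        · exact ⟨k + 1, by omega, hhigh k h1⟩
        · exact ⟨k, by omega, hlow k h1⟩
  · obtain ⟨s, rfl⟩ : ∃ s, m = r + 1 + s := ⟨m - (r + 1), by omega⟩
    have : r + 1 + s + 1 = (r + 1 + 1) + s := by omega
    rw [this, Finset.sum_range_add _ (r + 1 + 1) s, Finset.sum_range_add _ (r + 1) s,
      Finset.sum_range_succ _ (r + 1), Finset.sum_range_succ _ r, Finset.sum_range_succ _ r]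
    congr 1
    · rw [add_assoc]
      congr 1
      · refine Finset.sum_congr rfl fun k hk => ?_
        rw [Finset.mem_range] at hk
        rw [hlow k hk.le, hlow _ hk]
      · rw [hmid, hlow r le_rfl, hhigh _ le_rfl]
        exact dist_of_mem_segment hp
    · refine Finset.sum_congr rfl fun k _ => ?_
      have e1 : t' (r + 1 + 1 + k) = t (r + 1 + k) := by
        rw [show r + 1 + 1 + k = (r + 1 + k) + 1 by omega]; exact hhigh _ (by omega)
      have e2 : t' (r + 1 + 1 + k + 1) = t (r + 1 + k + 1) := by
        rw [show r + 1 + 1 + k + 1 = (r + 1 + k + 1) + 1 by omega]; exact hhigh _ (by omega)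
      rw [e1, e2]
  · intro x a ha hx
    rcases lt_trichotomy a r with h1 | h1 | h1
    · exact ⟨a, by omega, by rwa [hlow a h1.le, hlow _ h1]⟩
    · subst h1
      rcases mem_segment_or_of_collinear hp (left_mem_segment ℝ _ _) (right_mem_segment ℝ _ _) hx
        with g | g
      · exact ⟨a, by omega, by rwa [hlow a le_rfl, hmid, segment_symm]⟩
      · exact ⟨a + 1, by omega, by rwa [hmid, hhigh _ le_rfl]⟩
    · refine ⟨a + 1, by omega, ?_⟩
      rwa [hhigh a (by omega), hhigh (a + 1) (by omega)]
  · intro a ha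
    rcases hedge a ha with h1 | h1 | h1 | h1 <;> rw [h1.2.1, h1.2.2]
    · exact ⟨a, by omega, subset_rfl⟩
    · exact ⟨r, hr, hsub1⟩
    · exact ⟨r, hr, hsub2⟩
    · exact ⟨a - 1, by omega, subset_rfl⟩

/-- Insert the points one at a time, skipping those that are already vertices. The curve and its
length stay the same; the last two clauses record this as mutual covering of old and new edges. -/
lemma SimplePolygon.exists_refinement {t : ℕ → Plane} {m : ℕ} (h : SimplePolygon t m)
    (Q : Finset Plane) (hQ : ∀ p ∈ Q, ∃ a < m, p ∈ segment ℝ (t a) (t (a + 1))) :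
    ∃ (t' : ℕ → Plane) (m' : ℕ), SimplePolygon t' m' ∧
      (∀ x, (∃ k < m', t' k = x) ↔ x ∈ Q ∨ ∃ k < m, t k = x) ∧
      ∑ k ∈ Finset.range m', dist (t' k) (t' (k + 1)) =
        ∑ k ∈ Finset.range m, dist (t k) (t (k + 1)) ∧
      (∀ x a, a < m → x ∈ segment ℝ (t a) (t (a + 1)) →
        ∃ b < m', x ∈ segment ℝ (t' b) (t' (b + 1))) ∧
      ∀ a < m', ∃ b < m, segment ℝ (t' a) (t' (a + 1)) ⊆ segment ℝ (t b) (t (b + 1)) := by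
  classical
  induction Q using Finset.induction_on with
  | empty => exact ⟨t, m, h, by simp, rfl, fun x a ha hx => ⟨a, ha, hx⟩,
      fun a ha => ⟨a, ha, subset_rfl⟩⟩
  | insert p Q hpQ ih =>
    obtain ⟨t', m', h1, h2, h3, h4, h5⟩ := ih fun q hq => hQ q (Finset.mem_insert_of_mem hq)
    by_cases hex : ∃ k < m', t' k = p
    · refine ⟨t', m', h1, fun x => ?_, h3, h4, h5⟩
      rw [h2, Finset.mem_insert, or_assoc]
      refine ⟨Or.inr, ?_⟩
      rintro (rfl | h)
      · exact (h2 x).1 hex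
      · exact h
    · push Not at hex
      obtain ⟨a, ha, hpa⟩ := hQ p (Finset.mem_insert_self _ _)
      obtain ⟨r, hr, hpr⟩ := h4 p a ha hpa
      obtain ⟨t'', g1, g2, g3, g4, g5⟩ := h1.exists_insert hr hpr fun k hk => (hex k hk).symm
      refine ⟨t'', m' + 1, g1, fun x => ?_, g3.trans h3, fun x a ha hx => ?_, fun a ha => ?_⟩
      · rw [g2, h2, Finset.mem_insert, or_assoc]
      · obtain ⟨b, hb, hxb⟩ := h4 x a ha hx
        exact g4 x b hb hxb
      · obtain ⟨b, hb, hsub⟩ := g5 a ha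
        obtain ⟨c, hc, hsub'⟩ := h5 b hb
        exact ⟨c, hc, hsub.trans hsub'⟩

/-- Two directed segments that cannot be improved by a 2-move. -/
def NotImproving (e f : Plane × Plane) : Prop :=
  dist e.1 e.2 + dist f.1 f.2 ≤ dist e.1 f.1 + dist e.2 f.2

lemma NotImproving.symm {e f : Plane × Plane} (h : NotImproving e f) : NotImproving f e := by
  unfold NotImproving at h ⊢
  rw [dist_comm f.1 e.1, dist_comm f.2 e.2]; linarith

/-- Cutting off the piece from r to the end lowers the left side by its length and the right side by
at most as much. -/
lemma NotImproving.left {e f : Plane × Plane} (h : NotImproving e f) {r : Plane}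
    (hr : r ∈ segment ℝ e.1 e.2) : NotImproving (e.1, r) f := by
  unfold NotImproving at h ⊢
  have := dist_of_mem_segment hr
  have := dist_triangle e.2 r f.2
  have := dist_comm e.2 r
  simp only; linarith

lemma NotImproving.right {e f : Plane × Plane} (h : NotImproving e f) {r : Plane}
    (hr : r ∈ segment ℝ e.1 e.2) : NotImproving (r, e.2) f := by
  unfold NotImproving at h ⊢
  have := dist_of_mem_segment hr
  have := dist_triangle e.1 r f.1
  simp only; linarith

open Classical in
/-- Splits a directed segment at an interior point. -/
noncomputable def splitAt (r : Plane) (e : Plane × Plane) : List (Plane × Plane) :=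
  if r ∈ openSegment ℝ e.1 e.2 then [(e.1, r), (r, e.2)] else [e]

lemma mem_splitAt {r : Plane} {e f : Plane × Plane} (hf : f ∈ splitAt r e) :
    (f = e ∧ r ∉ openSegment ℝ e.1 e.2) ∨
      (r ∈ openSegment ℝ e.1 e.2 ∧ (f = (e.1, r) ∨ f = (r, e.2))) := by
  unfold splitAt at hf
  split_ifs at hf with h
  · exact Or.inr ⟨h, by simpa using hf⟩
  · exact Or.inl ⟨by simpa using hf, h⟩

/-- A 2-optimal family of directed segments can be subdivided at a finite set of points. -/
lemma exists_subdivision (A : Finset Plane) (L : List (Plane × Plane))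
    (hL : L.Pairwise NotImproving) (hne : ∀ e ∈ L, e.1 ≠ e.2) :
    ∃ L' : List (Plane × Plane), L'.Pairwise NotImproving ∧ (∀ e ∈ L', e.1 ≠ e.2) ∧
      (∀ e ∈ L', ∃ f ∈ L, segment ℝ e.1 e.2 ⊆ segment ℝ f.1 f.2 ∧
        (e.1 ∈ A ∨ e.1 = f.1) ∧ (e.2 ∈ A ∨ e.2 = f.2)) ∧
      (∀ e ∈ L', ∀ r ∈ A, r ∉ openSegment ℝ e.1 e.2) ∧
      (L'.map fun e => dist e.1 e.2).sum = (L.map fun e => dist e.1 e.2).sum := by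
  classical
  induction A using Finset.induction_on with
  | empty => exact ⟨L, hL, hne, fun e he => ⟨e, he, subset_rfl, Or.inr rfl, Or.inr rfl⟩,
      by simp, rfl⟩
  | insert r A hrA ih =>
    obtain ⟨L', h1, h2, h3, h4, h5⟩ := ih
    have hpart : ∀ e f, f ∈ splitAt r e → e.1 ≠ e.2 → f.1 ≠ f.2 ∧
        segment ℝ f.1 f.2 ⊆ segment ℝ e.1 e.2 ∧ openSegment ℝ f.1 f.2 ⊆ openSegment ℝ e.1 e.2 ∧
        (f.1 = r ∨ f.1 = e.1) ∧ (f.2 = r ∨ f.2 = e.2) ∧ r ∉ openSegment ℝ f.1 f.2 ∧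
        ∀ g, NotImproving e g → NotImproving f g := by
      intro e f hf hne
      rcases mem_splitAt hf with ⟨rfl, h⟩ | ⟨h, rfl | rfl⟩
      · exact ⟨hne, subset_rfl, subset_rfl, Or.inr rfl, Or.inr rfl, h, fun _ h => h⟩
      · have hs := openSegment_subset_segment ℝ _ _ h
        have hr := ne_of_mem_openSegment h hne
        refine ⟨hr.1.symm, (convex_segment _ _).segment_subset (left_mem_segment _ _ _) hs,
          ?_, Or.inr rfl, Or.inl rfl, fun hmem => hr.1.symm (right_mem_openSegment_iff.1 hmem),
          fun g hg => hg.left hs⟩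
        intro x hx
        have hx1 := openSegment_subset_segment ℝ _ _ hx
        have hx2 := ne_of_mem_openSegment hx hr.1.symm
        refine mem_openSegment_of_mem ((convex_segment _ _).segment_subset
          (left_mem_segment _ _ _) hs hx1) hx2.1 ?_
        rintro rfl
        exact hr.2 (segment_antisymm hs hx1)
      · have hs := openSegment_subset_segment ℝ _ _ h
        have hr := ne_of_mem_openSegment h hne
        refine ⟨hr.2, (convex_segment _ _).segment_subset hs (right_mem_segment _ _ _),
          ?_, Or.inl rfl, Or.inr rfl, fun hmem => hr.2 (left_mem_openSegment_iff.1 hmem),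
          fun g hg => hg.right hs⟩
        intro x hx
        have hx1 := openSegment_subset_segment ℝ _ _ hx
        have hx2 := ne_of_mem_openSegment hx hr.2
        refine mem_openSegment_of_mem ((convex_segment _ _).segment_subset hs
          (right_mem_segment _ _ _) hx1) ?_ hx2.2
        rintro rfl
        exact hr.1 (segment_antisymm (by rwa [segment_symm]) (by rwa [segment_symm]))
    refine ⟨L'.flatMap (splitAt r), ?_, ?_, ?_, ?_, ?_⟩
    -- Two pieces of one edge satisfy the condition with equality, pieces of different edges inherit
    -- it.
    · rw [List.pairwise_flatMap]
      constructor
      · intro e he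
        unfold splitAt
        split_ifs with h
        · have hs := dist_of_mem_segment (openSegment_subset_segment ℝ _ _ h)
          simp [NotImproving]
        · simp
      · refine List.Pairwise.imp_of_mem ?_ h1
        intro e f he hf hef x hx y hy
        have hx' := (hpart e x hx (h2 e he)).2.2.2.2.2.2
        have hy' := (hpart f y hy (h2 f hf)).2.2.2.2.2.2
        exact (hy' _ (hx' _ hef).symm).symm
    · intro f hf
      obtain ⟨e, he, hfe⟩ := List.mem_flatMap.1 hf
      exact (hpart e f hfe (h2 e he)).1
    · intro f hf
      obtain ⟨e, he, hfe⟩ := List.mem_flatMap.1 hf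
      obtain ⟨-, p1, -, p2, p3, -⟩ := hpart e f hfe (h2 e he)
      obtain ⟨g, hg, g1, g2, g3⟩ := h3 e he
      refine ⟨g, hg, p1.trans g1, ?_, ?_⟩
      · rcases p2 with p2 | p2 <;> rw [p2]
        · exact Or.inl (Finset.mem_insert_self _ _)
        · exact g2.imp_left Finset.mem_insert_of_mem
      · rcases p3 with p3 | p3 <;> rw [p3]
        · exact Or.inl (Finset.mem_insert_self _ _)
        · exact g3.imp_left Finset.mem_insert_of_mem
    · intro f hf q hq
      obtain ⟨e, he, hfe⟩ := List.mem_flatMap.1 hf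
      obtain ⟨-, -, p1, -, -, p2, -⟩ := hpart e f hfe (h2 e he)
      rcases Finset.mem_insert.1 hq with rfl | hq
      · exact p2
      · exact fun hmem => h4 e he q hq (p1 hmem)
    · rw [← h5]
      clear h1 h2 h3 h4 h5 hpart
      induction L' with
      | nil => rfl
      | cons e L' ih =>
        rw [List.flatMap_cons, List.map_append, List.sum_append, ih, List.map_cons, List.sum_cons]
        congr 1
        unfold splitAt
        split_ifs with h
        · simp [dist_of_mem_segment (openSegment_subset_segment ℝ _ _ h)]
        · simp

end EuclideanTSP

/-! ### Comparing a 2-optimal tour with a simple polygon -/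

namespace EuclideanTSP

instance : Std.Symm NotImproving := ⟨fun _ _ h => h.symm⟩

lemma isTour_apply_ne {V : Finset Plane} {σ : Equiv.Perm V} (h : IsTour σ) (v : V) : σ v ≠ v := by
  refine h.2.apply_ne ?_ (Set.mem_univ v)
  have : Nontrivial V := by
    rw [← Fintype.one_lt_card_iff_nontrivial, Fintype.card_coe]
    have := h.1; omega
  exact Set.nontrivial_univ

/-- The length of a 2-optimal tour in terms of the length of a simple polygon through its points. -/
lemma length_le_of_simplePolygon {V : Finset Plane} {σ : Equiv.Perm V} (hσ : IsTwoOptimal σ)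
    {t : ℕ → Plane} {m : ℕ} (hp : SimplePolygon t m) (hV : ∀ v ∈ V, ∃ k < m, t k = v)
    (hm : m ≤ V.card + 1) {K : ℝ} (hK : 1 < K) :
    length σ ≤ 4 * ((∑ r ∈ Finset.range m, dist (t r) (t (r + 1))) *
      (K / 2 + (1 + 2 * Real.log (((V.card : ℝ) + 1) ^ 4 + 1)) / Real.log K)) := by
  classical
  have hm2 : 1 < m := by
    have h1 : V ⊆ (Finset.range m).image t := by
      intro v hv
      obtain ⟨k, hk, rfl⟩ := hV v hv
      exact Finset.mem_image_of_mem _ (Finset.mem_range.2 hk)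
    have h2 := (Finset.card_le_card h1).trans Finset.card_image_le
    rw [Finset.card_range] at h2
    have := hσ.1.1
    omega
  have hT : 0 < ∑ r ∈ Finset.range m, dist (t r) (t (r + 1)) := by
    have h1 : 0 < dist (t 0) (t (0 + 1)) := by
      rw [dist_pos]
      intro h
      have := hp.inj 0 (by omega) 1 hm2 h
      omega
    exact h1.trans_le (Finset.single_le_sum (f := fun r => dist (t r) (t (r + 1)))
      (fun _ _ => dist_nonneg) (Finset.mem_range.2 (by omega)))
  -- a common point of every pair of intersecting edges
  have hx : ∀ (v : V) (a : ℕ), ∃ x : Plane, x ∈ segment ℝ (t a) (t (a + 1)) ∧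
      ((∃ p ∈ segment ℝ (v : Plane) (σ v), p ∈ segment ℝ (t a) (t (a + 1))) →
        x ∈ segment ℝ (v : Plane) (σ v)) := by
    intro v a
    by_cases h : ∃ p ∈ segment ℝ (v : Plane) (σ v), p ∈ segment ℝ (t a) (t (a + 1))
    · obtain ⟨p, h1, h2⟩ := h
      exact ⟨p, h2, fun _ => h1⟩
    · exact ⟨t a, left_mem_segment _ _ _, fun h' => absurd h' h⟩
  choose x hx1 hx2 using hx
  -- One common point per pair of a tour edge and a polygon edge suffices, even if the two overlap
  -- in a segment: the end points of both are vertices of the refinement anyway.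
  set Q : Finset Plane := (Finset.univ ×ˢ Finset.range m).image fun y : V × ℕ => x y.1 y.2 with hQ
  have hQcard : Q.card ≤ V.card * m := by
    refine Finset.card_image_le.trans ?_
    rw [Finset.card_product, Finset.card_univ, Fintype.card_coe, Finset.card_range]
  obtain ⟨t', m', hp', hvert, hsum, hcarrier, hsub⟩ := hp.exists_refinement Q (by
    intro p hp
    obtain ⟨y, hy, rfl⟩ := Finset.mem_image.1 hp
    exact ⟨y.2, Finset.mem_range.1 (Finset.mem_product.1 hy).2, hx1 _ _⟩)
  set A : Finset Plane := (Finset.range m').image t' with hA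
  have hAmem : ∀ p, p ∈ A ↔ ∃ k < m', t' k = p := by
    intro p; simp [hA]
  -- With n points the refinement has at most n·m + m vertices, where m ≤ n + 1.
  have hm' : m' ≤ (V.card + 1) ^ 2 := by
    have h1 : A.card = m' := by
      rw [hA, Finset.card_image_of_injOn, Finset.card_range]
      intro a ha b hb hab
      exact hp'.inj a (by simpa using ha) b (by simpa using hb) hab
    have h2 : A ⊆ Q ∪ (Finset.range m).image t := by
      intro p hp
      rw [hAmem, hvert] at hp
      rw [Finset.mem_union, Finset.mem_image (f := t)]
      refine hp.imp_right ?_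
      rintro ⟨k, hk, h⟩
      exact ⟨k, Finset.mem_range.2 hk, h⟩
    have h3 := (Finset.card_le_card h2).trans (Finset.card_union_le _ _)
    have h4 : ((Finset.range m).image t).card ≤ m := by
      simpa using Finset.card_image_le (s := Finset.range m) (f := t)
    nlinarith
  have hVA : ∀ v ∈ V, v ∈ A := fun v hv => (hAmem v).2 ((hvert v).2 (Or.inr (hV v hv)))
  set L : List (Plane × Plane) :=
    (Finset.univ : Finset V).toList.map fun v : V => ((v : Plane), ((σ v : V) : Plane)) with hL
  obtain ⟨L', l1, l2, l3, l4, l5⟩ := exists_subdivision A L (by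
      rw [hL, List.pairwise_map]
      refine (Finset.nodup_toList _).imp ?_
      intro a b hab
      exact hσ.2 a b hab) (by
      intro e he
      obtain ⟨v, -, rfl⟩ := List.mem_map.1 he
      exact fun h => isTour_apply_ne hσ.1 v (Subtype.ext h.symm))
  have hLsum : (L'.map fun e => dist e.1 e.2).sum = length σ := by
    rw [l5, hL, List.map_map, length, ← Finset.sum_map_toList]
    rfl
  -- A repeated piece would violate the condition against itself, since it has positive length. So
  -- pieces can be encoded by pairs of vertex indices.
  have hnodup : L'.Nodup := by
    refine List.Pairwise.imp_of_mem ?_ l1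
    rintro e f he - hef rfl
    unfold NotImproving at hef
    simp only [dist_self, add_zero] at hef
    have := dist_pos.2 (l2 e he)
    linarith
  have hend : ∀ e ∈ L', e.1 ∈ A ∧ e.2 ∈ A := by
    intro e he
    obtain ⟨f, hf, -, h1, h2⟩ := l3 e he
    obtain ⟨v, -, rfl⟩ := List.mem_map.1 hf
    exact ⟨h1.elim id fun h => h ▸ hVA _ v.2, h2.elim id fun h => h ▸ hVA _ (σ v).2⟩
  have hidx : ∀ p : Plane, ∃ k, p ∈ A → k < m' ∧ t' k = p := by
    intro p
    by_cases h : p ∈ A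
    · obtain ⟨k, hk⟩ := (hAmem p).1 h
      exact ⟨k, fun _ => hk⟩
    · exact ⟨0, fun h' => absurd h' h⟩
  choose idx hidx using hidx
  have hinjOn : Set.InjOn (fun e : Plane × Plane => (idx e.1, idx e.2)) L'.toFinset := by
    intro e he f hf hef
    simp only [List.coe_toFinset, Set.mem_ofPred_eq] at he hf
    simp only [Prod.mk.injEq] at hef
    obtain ⟨e1, e2⟩ := hend e he
    obtain ⟨f1, f2⟩ := hend f hf
    refine Prod.ext ?_ ?_
    · rw [← (hidx _ e1).2, ← (hidx _ f1).2, hef.1]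
    · rw [← (hidx _ e2).2, ← (hidx _ f2).2, hef.2]
  set E : Finset (ℕ × ℕ) := L'.toFinset.image fun e => (idx e.1, idx e.2) with hE
  have hEmem : ∀ g ∈ E, ∃ e ∈ L', g.1 < m' ∧ g.2 < m' ∧ t' g.1 = e.1 ∧ t' g.2 = e.2 ∧
      g = (idx e.1, idx e.2) := by
    intro g hg
    obtain ⟨e, he, rfl⟩ := Finset.mem_image.1 hg
    have he := List.mem_toFinset.1 he
    obtain ⟨e1, e2⟩ := hend e he
    exact ⟨e, he, (hidx _ e1).1, (hidx _ e2).1, (hidx _ e1).2, (hidx _ e2).2, rfl⟩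
  have hEsum : ∑ e ∈ E, dist (t' e.1) (t' e.2) = length σ := by
    rw [hE, Finset.sum_image hinjOn, ← hLsum, ← List.sum_toFinset _ hnodup]
    refine Finset.sum_congr rfl fun e he => ?_
    obtain ⟨e1, e2⟩ := hend e (List.mem_toFinset.1 he)
    rw [(hidx _ e1).2, (hidx _ e2).2]
  have hEcard : E.card ≤ (V.card + 1) ^ 4 := by
    have h1 : E ⊆ Finset.range m' ×ˢ Finset.range m' := by
      intro g hg
      obtain ⟨e, -, h1, h2, -⟩ := hEmem g hg
      simp [h1, h2]
    have h2 := Finset.card_le_card h1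
    rw [Finset.card_product, Finset.card_range] at h2
    calc E.card ≤ m' * m' := h2
      _ ≤ (V.card + 1) ^ 2 * (V.card + 1) ^ 2 := Nat.mul_le_mul hm' hm'
      _ = _ := by ring
  have hmain := sum_chords_le hp' E (fun g hg => by
      obtain ⟨e, he, h1, h2, h3, h4, -⟩ := hEmem g hg
      refine ⟨h1, h2, fun h => l2 e he ?_⟩
      rw [← h3, ← h4, h]) (fun g hg => by
      obtain ⟨e, he, h1, h2, h3, h4, -⟩ := hEmem g hg
      -- A piece that meets the polygon at an interior point p has to be an edge of the refinement.
      by_cases hav : AvoidsPolygon t' m' g.1 g.2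
      · exact Or.inl hav
      right
      unfold AvoidsPolygon at hav
      push Not at hav
      obtain ⟨a, ha, p, hpe, hpa, hp1, hp2⟩ := hav
      rw [h3, h4] at hpe
      rw [h3] at hp1
      rw [h4] at hp2
      have hne := l2 e he
      have hop := mem_openSegment_of_mem hpe hp1 hp2
      have hout := l4 e he
      obtain ⟨f, hf, hef, -⟩ := l3 e he
      obtain ⟨v, -, rfl⟩ := List.mem_map.1 hf
      simp only at hef
      obtain ⟨b, hb, hab⟩ := hsub a ha
      have hpb := hab hpa
      -- The tour edge and the polygon edge b share both p and the chosen point of `Q`, which differ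
      -- because no point of `A` is interior to the piece. Hence they overlap along a line, and the
      -- part of edge b beyond p covers the whole piece.
      have hxv : x v b ∈ segment ℝ (v : Plane) (σ v) := hx2 v b ⟨p, hef hpe, hpb⟩
      have hxA : x v b ∈ A := (hAmem _).2 ((hvert _).2 (Or.inl
        (Finset.mem_image.2 ⟨(v, b), by simp [hb], rfl⟩)))
      have hpA : p ∉ A := fun h => hout p h hop
      have htA : ∀ k ≤ m, t k ∈ A := by
        intro k hk
        rcases hk.lt_or_eq with hk | rfl
        · exact (hAmem _).2 ((hvert _).2 (Or.inr ⟨k, hk, rfl⟩))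
        · rw [hp.closed]
          exact (hAmem _).2 ((hvert _).2 (Or.inr ⟨0, by omega, rfl⟩))
      have htA' : ∀ k ≤ m', t' k ∈ A := by
        intro k hk
        rcases hk.lt_or_eq with hk | rfl
        · exact (hAmem _).2 ⟨k, hk, rfl⟩
        · rw [hp'.closed]
          exact (hAmem _).2 ⟨0, by omega, rfl⟩
      have hue := hef (left_mem_segment _ _ _)
      have hwe := hef (right_mem_segment _ _ _)
      -- both end points lie on the edge `b` of the original polygon
      have huw : e.1 ∈ segment ℝ (t b) (t (b + 1)) ∧ e.2 ∈ segment ℝ (t b) (t (b + 1)) := by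
        have hcov : ∀ z ∈ A, z ∈ segment ℝ (t b) (t (b + 1)) → p ∈ segment ℝ (x v b) z →
            e.1 ∈ segment ℝ (t b) (t (b + 1)) ∧ e.2 ∈ segment ℝ (t b) (t (b + 1)) := by
          intro z hzA hz hpz
          have hs := (convex_segment (t b) (t (b + 1))).segment_subset (hx1 v b) hz
          have := covers_of_mem_openSegment hxv hue hwe hne hop hpz
            (fun h => hpA (h ▸ hxA)) (hout _ hxA) (hout _ hzA)
          exact ⟨hs this.1, hs this.2⟩
        rcases mem_segment_or_of_collinear (hx1 v b) (left_mem_segment ℝ _ _)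
          (right_mem_segment ℝ _ _) hpb with g | g
        · exact hcov _ (htA b hb.le) (left_mem_segment _ _ _) g
        · exact hcov _ (htA (b + 1) hb) (right_mem_segment _ _ _) g
      -- The same covering argument with the refined edge a: both ends of the piece lie on it and
      -- are vertices, so they are its ends.
      have hfin := covers_of_mem_openSegment (hab (left_mem_segment _ _ _)) huw.1 huw.2 hne hop hpa
        (fun h => hpA (h ▸ htA' a ha.le)) (hout _ (htA' a ha.le)) (hout _ (htA' (a + 1) ha))
      rw [← h3, ← h4] at hfin
      have k1 := hp'.vertex_mem_edge h1 ha hfin.1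
      have k2 := hp'.vertex_mem_edge h2 ha hfin.2
      have hne' : g.1 ≠ g.2 := fun h => hne (by rw [← h3, ← h4, h])
      unfold IsAdjacentPair
      omega) (fun g hg g' hg' hne => by
      obtain ⟨e, he, -, -, h3, h4, h5⟩ := hEmem g hg
      obtain ⟨e', he', -, -, h3', h4', h5'⟩ := hEmem g' hg'
      rw [h3, h4, h3', h4']
      have hee : e ≠ e' := by rintro rfl; exact hne (h5.trans h5'.symm)
      exact l1.forall he he' hee) hK (by rw [hsum]; exact hT)
  rw [hEsum, hsum] at hmain
  refine hmain.trans ?_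
  have hlogK := Real.log_pos hK
  have : (E.card : ℝ) ≤ ((V.card : ℝ) + 1) ^ 4 := by exact_mod_cast hEcard
  gcongr

end EuclideanTSP

/-! ### Noncollinear 2-optimal tours are simple polygons -/

namespace EuclideanTSP

/-- Both c and d lie beyond b on one ray from a; the midpoint of b and the nearer of them works. -/
lemma exists_overlap {a b c d : Plane} (h1 : b ∈ segment ℝ a c) (h2 : b ∈ segment ℝ a d)
    (hba : b ≠ a) (hc : c ≠ b) (hd : d ≠ b) :
    ∃ p, p ∈ openSegment ℝ b c ∧ p ∈ openSegment ℝ b d := by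
  have key : ∀ c d : Plane, c ≠ b → c ∈ segment ℝ b d →
      ∃ p, p ∈ openSegment ℝ b c ∧ p ∈ openSegment ℝ b d := by
    intro c d hc hcd
    have hl : midpoint ℝ b c ≠ b := by
      rw [Ne, midpoint_eq_left_iff]; exact hc.symm
    have hr : midpoint ℝ b c ≠ c := by
      rw [Ne, midpoint_eq_right_iff]; exact hc.symm
    have hm : midpoint ℝ b c ∈ segment ℝ b c := midpoint_mem_segment b c
    have hmd : midpoint ℝ b c ∈ segment ℝ b d :=
      (convex_segment b d).segment_subset (left_mem_segment ℝ b d) hcd hm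
    refine ⟨midpoint ℝ b c, mem_openSegment_of_mem hm hl hr,
      mem_openSegment_of_mem hmd hl fun h => ?_⟩
    have h3 : d ∈ segment ℝ b c := by rw [← h]; exact hm
    rw [← segment_antisymm hcd h3] at h
    exact hr h
  rcases mem_segment_or_of_ray h1 h2 hba with g | g
  · obtain ⟨p, hp1, hp2⟩ := key d c hd g
    exact ⟨p, hp2, hp1⟩
  · exact key c d hc g

lemma openSegment_subset_of_mem {a b c : Plane} (h : b ∈ segment ℝ a c) (hba : b ≠ a)
    (hbc : b ≠ c) : openSegment ℝ b c ⊆ openSegment ℝ a c := by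
  intro p hp
  have hp1 := openSegment_subset_segment ℝ _ _ hp
  refine mem_openSegment_of_mem ((convex_segment a c).segment_subset h (right_mem_segment _ _ _)
    hp1) ?_ (ne_of_mem_openSegment hp hbc).2
  rintro rfl
  rw [segment_symm] at h hp1
  exact hba (segment_antisymm h hp1)

lemma mem_line_of_mem_segment {ℓ : AffineSubspace ℝ Plane} {a b c : Plane} (ha : a ∈ ℓ)
    (hb : b ∈ ℓ) (h : b ∈ segment ℝ a c) (hba : b ≠ a) : c ∈ ℓ := by
  rw [segment_eq_image_lineMap] at h
  obtain ⟨r, -, rfl⟩ := h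
  have hr : r ≠ 0 := by rintro rfl; simp at hba
  have : c = AffineMap.lineMap a (AffineMap.lineMap a c r) r⁻¹ := by
    simp only [AffineMap.lineMap_apply, vsub_eq_sub, vadd_eq_add]
    rw [add_sub_cancel_right, smul_smul, inv_mul_cancel₀ hr, one_smul]
    abel
  rw [this]
  exact AffineMap.lineMap_mem _ ha hb

section TwoOptSimple

variable {ι : Type*} {s : Equiv.Perm ι} {f : ι → Plane}

/-- Two different edges share an interior point. -/
def OverlapsOther (s : Equiv.Perm ι) (f : ι → Plane) (i : ι) : Prop :=
  ∃ j, j ≠ i ∧ ∃ p, p ∈ openSegment ℝ (f i) (f (s i)) ∧ p ∈ openSegment ℝ (f j) (f (s j))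

/-- If the start of edge i lies on edge j, the 2-optimality condition makes the triangle inequality
tight: edge i runs straight back along edge j. The next lemma is the same for the end of edge i. -/
lemma mem_segment_succ_of_mem_edge
    (h2 : ∀ i j, i ≠ j → dist (f i) (f (s i)) + dist (f j) (f (s j)) ≤
      dist (f i) (f j) + dist (f (s i)) (f (s j))) {i j : ι} (hij : i ≠ j)
    (h : f i ∈ segment ℝ (f j) (f (s j))) : f i ∈ segment ℝ (f (s j)) (f (s i)) := by
  have e1 := h2 i j hij
  have e2 := dist_of_mem_segment h
  rw [segment_symm]
  apply mem_segment_of_dist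
  rw [dist_comm (f (s i)) (f i), dist_comm (f i) (f j)] at *
  linarith

lemma mem_segment_pred_of_mem_edge
    (h2 : ∀ i j, i ≠ j → dist (f i) (f (s i)) + dist (f j) (f (s j)) ≤
      dist (f i) (f j) + dist (f (s i)) (f (s j))) {i j : ι} (hij : i ≠ j)
    (h : f (s i) ∈ segment ℝ (f j) (f (s j))) : f (s i) ∈ segment ℝ (f j) (f i) := by
  have e1 := h2 i j hij
  have e2 := dist_of_mem_segment h
  rw [segment_symm]
  apply mem_segment_of_dist
  rw [dist_comm (f (s i)) (f j)]
  linarith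

/-- An overlap propagates to the next edge of the tour and keeps it on the same line. Going once
around, the whole tour would be collinear, which is how overlaps are excluded. -/
lemma OverlapsOther.succ [Finite ι] (hf : Function.Injective f) (hs : ∀ i, s i ≠ i)
    (h2 : ∀ i j, i ≠ j → dist (f i) (f (s i)) + dist (f j) (f (s j)) ≤
      dist (f i) (f j) + dist (f (s i)) (f (s j))) {i : ι} (h : OverlapsOther s f i) :
    OverlapsOther s f (s i) ∧
      ∀ ℓ : AffineSubspace ℝ Plane, f i ∈ ℓ → f (s i) ∈ ℓ → f (s (s i)) ∈ ℓ := by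
  classical
  have := Fintype.ofFinite ι
  have hne : ∀ i, f i ≠ f (s i) := fun i h => hs i (hf h).symm
  -- Taking the overlapping edge that starts farthest from `f i` excludes that it starts inside edge
  -- i.
  obtain ⟨j, hj, hmax⟩ := Finset.exists_max_image
    (Finset.univ.filter fun j => j ≠ i ∧ ∃ p, p ∈ openSegment ℝ (f i) (f (s i)) ∧
      p ∈ openSegment ℝ (f j) (f (s j))) (fun j => dist (f i) (f j)) (by
        obtain ⟨j, hj⟩ := h
        exact ⟨j, by simpa using hj⟩)
  simp only [Finset.mem_filter, Finset.mem_univ, true_and] at hj hmax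
  obtain ⟨hji, p, hpi, hpj⟩ := hj
  have pi := openSegment_subset_segment ℝ _ _ hpi
  have pj := openSegment_subset_segment ℝ _ _ hpj
  have npi := ne_of_mem_openSegment hpi (hne i)
  have npj := ne_of_mem_openSegment hpj (hne j)
  obtain ⟨q1, q2⟩ := mem_segment_of_not_improving (h2 i j hji.symm) pi pj
  have hline : ∀ ℓ : AffineSubspace ℝ Plane, f i ∈ ℓ → f (s i) ∈ ℓ → f (s j) ∈ ℓ := by
    intro ℓ ha hb
    have hp : p ∈ ℓ := by
      rw [segment_eq_image_lineMap] at pi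
      obtain ⟨r, -, rfl⟩ := pi
      exact AffineMap.lineMap_mem _ ha hb
    exact mem_line_of_mem_segment hb hp q2 npi.2
  by_cases hsj : s i = j
  · subst hsj
    exact ⟨⟨i, hji.symm, p, hpj, hpi⟩, hline⟩
  have hfsj : f (s i) ≠ f j := fun h => hsj (hf h)
  rcases mem_segment_or_of_ray pi q1 npi.1 with g | g
  · exfalso
    -- If j started inside edge i, the preceding edge k would also overlap edge i and start farther
    -- away.
    have hji' : f j ∈ segment ℝ (f i) (f (s i)) :=
      (convex_segment _ _).segment_subset pi (right_mem_segment _ _ _) g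
    set k := s.symm j with hk
    have hsk : s k = j := s.apply_symm_apply j
    have hki : k ≠ i := by rintro h; rw [h] at hsk; exact hsj hsk
    have h3 : f (s k) ∈ segment ℝ (f i) (f k) :=
      mem_segment_pred_of_mem_edge h2 hki (by rwa [hsk])
    rw [hsk] at h3
    have hkj : f k ≠ f j := by have := hne k; rwa [hsk] at this
    have hjne : f j ≠ f i := fun h => hji (hf h)
    obtain ⟨p', g1, g2⟩ := exists_overlap hji' h3 hjne hfsj hkj
    have := hmax k ⟨hki, p', openSegment_subset_of_mem hji' hjne hfsj.symm g1, by
      rwa [hsk, openSegment_symm]⟩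
    have e := dist_of_mem_segment h3
    have := dist_pos.2 hkj
    rw [dist_comm (f k)] at this
    linarith
  · have hsi : f (s i) ∈ segment ℝ (f j) (f (s j)) :=
      (convex_segment _ _).segment_subset pj (left_mem_segment _ _ _) g
    have hsne : s i ≠ s j := fun h => hji (s.injective h).symm
    have hsne' : f (s i) ≠ f (s j) := fun h => hsne (hf h)
    have h3 := mem_segment_succ_of_mem_edge h2 hsj hsi
    rw [segment_symm] at hsi
    obtain ⟨p', g1, g2⟩ := exists_overlap h3 hsi hsne' (hne (s i)).symm hfsj.symm
    refine ⟨⟨j, fun h => hsj h.symm, p', g1, ?_⟩, fun ℓ ha hb => ?_⟩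
    · rw [openSegment_symm]
      exact openSegment_subset_of_mem hsi hsne' hfsj g2
    · exact mem_line_of_mem_segment (hline ℓ ha hb) hb h3 hsne'

/-- A tour without improving 2-move whose vertices are not collinear is a simple polygon. -/
lemma edges_meet_of_twoOpt [Finite ι] (hf : Function.Injective f) (hs : ∀ i, s i ≠ i)
    (h2 : ∀ i j, i ≠ j → dist (f i) (f (s i)) + dist (f j) (f (s j)) ≤
      dist (f i) (f j) + dist (f (s i)) (f (s j)))
    (hcyc : ∀ i j, ∃ k : ℕ, (s ^ k) i = j) (hcol : ∀ i j, ∃ k, f k ∉ line[ℝ, f i, f j])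
    {i j : ι} (hij : i ≠ j) {p : Plane} (hpi : p ∈ segment ℝ (f i) (f (s i)))
    (hpj : p ∈ segment ℝ (f j) (f (s j))) :
    (s i = j ∧ p = f j) ∨ (s j = i ∧ p = f i) := by
  have hne : ∀ i, f i ≠ f (s i) := fun i h => hs i (hf h).symm
  have hno : ∀ i, ¬ OverlapsOther s f i := by
    intro i hi
    -- Along the whole cycle every edge overlaps another one and stays on the line of the first.
    have hall : ∀ k : ℕ, OverlapsOther s f ((s ^ k) i) ∧ f ((s ^ k) i) ∈ line[ℝ, f i, f (s i)] ∧
        f (s ((s ^ k) i)) ∈ line[ℝ, f i, f (s i)] := by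
      intro k
      induction k with
      | zero => exact ⟨hi, left_mem_affineSpan_pair _ _ _, right_mem_affineSpan_pair _ _ _⟩
      | succ k ih =>
        obtain ⟨a, b, c⟩ := ih
        obtain ⟨d, e⟩ := a.succ hf hs h2
        rw [pow_succ', Equiv.Perm.mul_apply]
        exact ⟨d, c, e _ b c⟩
    obtain ⟨k, hk⟩ := hcol i (s i)
    obtain ⟨n, rfl⟩ := hcyc i k
    exact hk (hall n).2.1
  -- A vertex in the interior of an edge would create an overlap, because its outgoing edge runs
  -- back along that edge.
  have hvert : ∀ i j, f i ∉ openSegment ℝ (f j) (f (s j)) := by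
    intro i j hmem
    have hn := ne_of_mem_openSegment hmem (hne j)
    have hij : i ≠ j := by rintro rfl; exact hn.1 rfl
    have hm := openSegment_subset_segment ℝ _ _ hmem
    have h3 := mem_segment_succ_of_mem_edge h2 hij hm
    rw [segment_symm] at hm
    obtain ⟨p', g1, g2⟩ := exists_overlap h3 hm hn.2 (hne i).symm hn.1.symm
    refine hno i ⟨j, hij.symm, p', g1, ?_⟩
    rw [openSegment_symm]
    exact openSegment_subset_of_mem hm hn.2 hn.1 g2
  have hfij : f i ≠ f j := fun h => hij (hf h)
  have hsij : f (s i) ≠ f (s j) := fun h => hij (s.injective (hf h))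
  by_cases c1 : p = f i
  · subst c1
    by_cases c2 : f i = f (s j)
    · exact Or.inr ⟨(hf c2).symm, rfl⟩
    · exact absurd (mem_openSegment_of_mem hpj hfij c2) (hvert i j)
  by_cases c2 : p = f j
  · subst c2
    by_cases c3 : f j = f (s i)
    · exact Or.inl ⟨(hf c3).symm, rfl⟩
    · exact absurd (mem_openSegment_of_mem hpi c1 c3) (hvert j i)
  by_cases c3 : p = f (s i)
  · subst c3
    exact absurd (mem_openSegment_of_mem hpj c2 hsij) (hvert (s i) j)
  by_cases c4 : p = f (s j)
  · subst c4
    exact absurd (mem_openSegment_of_mem hpi c1 c3) (hvert (s j) i)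
  exact absurd ⟨j, hij.symm, p, mem_openSegment_of_mem hpi c1 c3, mem_openSegment_of_mem hpj c2 c4⟩
    (hno i)

end TwoOptSimple

end EuclideanTSP

/-! ### Path lengths, closed walks and tours -/

namespace EuclideanTSP

section PathLength
variable {X : Type*} [PseudoMetricSpace X]

/-- The length of the polygonal path through the points of a list. -/
noncomputable def pathLength : List X → ℝ
  | [] => 0
  | [_] => 0
  | a :: b :: l => dist a b + pathLength (b :: l)

@[simp] lemma pathLength_singleton (a : X) : pathLength [a] = 0 := rfl

@[simp] lemma pathLength_cons_cons (a b : X) (l : List X) :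
    pathLength (a :: b :: l) = dist a b + pathLength (b :: l) := rfl

lemma pathLength_nonneg (l : List X) : 0 ≤ pathLength l := by
  induction l with
  | nil => exact le_rfl
  | cons a l ih =>
    cases l with
    | nil => exact le_rfl
    | cons b l => exact add_nonneg dist_nonneg ih

lemma pathLength_append (l₁ : List X) (q : X) (l₂ : List X) :
    pathLength (l₁ ++ q :: l₂) = pathLength (l₁ ++ [q]) + pathLength (q :: l₂) := by
  induction l₁ with
  | nil => simp
  | cons a l ih =>
    cases l with
    | nil => simp
    | cons b l => simp only [List.cons_append, pathLength_cons_cons] at ih ⊢; rw [ih]; ring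

lemma pathLength_cons_le (a b : X) (l : List X) :
    pathLength (a :: l) ≤ dist a b + pathLength (b :: l) := by
  cases l with
  | nil => simp
  | cons c l =>
    simp only [pathLength_cons_cons]
    linarith [dist_triangle a b c]

lemma pathLength_sublist {l' l : List X} (h : l'.Sublist l) (a c : X) :
    pathLength (a :: l' ++ [c]) ≤ pathLength (a :: l ++ [c]) := by
  induction h generalizing a with
  | slnil => exact le_rfl
  | cons b h ih => exact (ih a).trans (pathLength_cons_le a b _)
  | cons_cons b h ih =>
    simp only [List.cons_append, pathLength_cons_cons] at ih ⊢
    exact add_le_add le_rfl (ih b)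

lemma pathLength_eq_sum (L : List X) (x : X) :
    pathLength L = ∑ k ∈ Finset.range (L.length - 1), dist (L.getD k x) (L.getD (k + 1) x) := by
  induction L with
  | nil => simp [pathLength]
  | cons a l ih =>
    cases l with
    | nil => simp
    | cons b l =>
      rw [pathLength_cons_cons, ih]
      simp only [List.length_cons, Nat.add_sub_cancel]
      rw [Finset.sum_range_succ', add_comm]
      rfl

lemma pathLength_map_range (f : ℕ → X) (m : ℕ) :
    pathLength ((List.range (m + 1)).map f) = ∑ k ∈ Finset.range m, dist (f k) (f (k + 1)) := by
  induction m with
  | zero => simp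
  | succ m ih =>
    rw [List.range_succ, List.map_append, List.range_succ, List.map_append]
    simp only [List.map_cons, List.map_nil, List.append_assoc, List.singleton_append]
    rw [pathLength_append, Finset.sum_range_succ, ← ih, List.range_succ, List.map_append]
    simp

lemma dist_le_pathLength (a b : X) (l : List X) :
    dist a b ≤ pathLength (a :: l ++ [b]) := by
  have := pathLength_sublist (List.nil_sublist l) a b
  simpa using this

/-- A detour from `q` to `p` and back. -/
lemma pathLength_detour (l₁ : List X) (q p : X) (l₂ : List X) :
    pathLength (l₁ ++ q :: p :: q :: l₂) = pathLength (l₁ ++ q :: l₂) + 2 * dist q p := by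
  rw [pathLength_append, pathLength_append l₁ q l₂]
  simp only [pathLength_cons_cons]
  rw [dist_comm p q]; ring

/-- There is a closed walk of length at most `B` from `a` visiting exactly the points of `V`. -/
def HasClosedWalk (V : Set X) (a : X) (B : ℝ) : Prop :=
  ∃ l : List X, (∀ x, x ∈ V ↔ x ∈ a :: l) ∧ pathLength (a :: l ++ [a]) ≤ B

/-- Insert a detour to p and back at a visit of q. -/
lemma HasClosedWalk.insert {V : Set X} {a : X} {B : ℝ} (h : HasClosedWalk V a B) {q : X}
    (hq : q ∈ V) (p : X) : HasClosedWalk (insert p V) a (B + 2 * dist q p) := by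
  obtain ⟨l, hl, hB⟩ := h
  rcases List.mem_cons.1 ((hl q).1 hq) with rfl | hql
  · refine ⟨p :: q :: l, fun x => ?_, ?_⟩
    · rw [Set.mem_insert_iff, hl]; simp only [List.mem_cons]; tauto
    · have := pathLength_detour [] q p (l ++ [q])
      simp only [List.nil_append, List.cons_append] at this hB ⊢
      linarith
  · obtain ⟨l₁, l₂, rfl⟩ := List.append_of_mem hql
    refine ⟨l₁ ++ q :: p :: q :: l₂, fun x => ?_, ?_⟩
    · rw [Set.mem_insert_iff, hl]; simp only [List.mem_cons, List.mem_append]; tauto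
    · have := pathLength_detour (a :: l₁) q p (l₂ ++ [a])
      simp only [List.cons_append, List.append_assoc] at this hB ⊢
      linarith

lemma HasClosedWalk.mono {V : Set X} {a : X} {B B' : ℝ} (h : HasClosedWalk V a B) (hB : B ≤ B') :
    HasClosedWalk V a B' := by
  obtain ⟨l, hl, h⟩ := h
  exact ⟨l, hl, h.trans hB⟩

lemma HasClosedWalk.union_image {V : Set X} {a : X} {B δ : ℝ} (h : HasClosedWalk V a B)
    {κ : Type*} (s : Finset κ) (f : κ → X) (hf : ∀ k ∈ s, ∃ q ∈ V, dist q (f k) ≤ δ) :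
    HasClosedWalk (V ∪ f '' s) a (B + 2 * δ * s.card) := by
  classical
  induction s using Finset.induction_on with
  | empty => simpa using h
  | insert k s hk ih =>
    obtain ⟨q, hq, hd⟩ := hf k (Finset.mem_insert_self _ _)
    have := (ih fun j hj => hf j (Finset.mem_insert_of_mem hj)).insert (Or.inl hq) (f k)
    rw [Finset.coe_insert, Set.image_insert_eq, Set.union_insert]
    refine this.mono ?_
    rw [Finset.card_insert_of_notMem hk]
    push_cast
    linarith

end PathLength

/-- The tour visiting the points `t 0, …, t (n - 1)` in this order. -/
lemma exists_tour_of_seq {V : Finset Plane} {n : ℕ} (hn : 3 ≤ n) {t : ℕ → Plane} (h0 : t n = t 0)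
    (hinj : ∀ a < n, ∀ b < n, t a = t b → a = b) (hV : ∀ x, x ∈ V ↔ ∃ k < n, t k = x) :
    ∃ σ : Equiv.Perm V, IsTour σ ∧
      (∀ k < n, ∀ v : V, (v : Plane) = t k → ((σ v : V) : Plane) = t (k + 1)) ∧
      length σ = ∑ k ∈ Finset.range n, dist (t k) (t (k + 1)) := by
  classical
  obtain ⟨m, rfl⟩ : ∃ m, n = m + 1 := ⟨n - 1, by omega⟩
  set e : Fin (m + 1) ≃ V := Equiv.ofBijective
    (fun k => ⟨t k, (hV _).2 ⟨k, k.2, rfl⟩⟩) ⟨fun a b hab => Fin.ext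
      (hinj a a.2 b b.2 (congrArg Subtype.val hab)), fun v => by
        obtain ⟨k, hk, hkv⟩ := (hV v).1 v.2
        exact ⟨⟨k, hk⟩, Subtype.ext hkv⟩⟩ with he
  have hev : ∀ k, ((e k : V) : Plane) = t k := fun k => rfl
  set σ : Equiv.Perm V := e.permCongr (finRotate (m + 1)) with hσ
  have hσe : ∀ k, ((σ (e k) : V) : Plane) = t (k + 1) := by
    intro k
    rw [hσ, Equiv.permCongr_apply, Equiv.symm_apply_apply, hev]
    rcases Nat.lt_or_ge k m with h | h
    · have : finRotate (m + 1) k = ⟨k + 1, by omega⟩ := finRotate_of_lt h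
      rw [this]
    · have hk : k = Fin.last m := Fin.ext (by have := k.2; simp; omega)
      rw [hk, finRotate_last]
      simp [h0]
  have hpow : ∀ k (hk : k < m + 1), (σ ^ k) (e 0) = e ⟨k, hk⟩ := by
    intro k
    induction k with
    | zero => intro _; rfl
    | succ k ih =>
      intro hk
      rw [pow_succ', Equiv.Perm.mul_apply, ih (by omega)]
      exact Subtype.ext (hσe _)
  refine ⟨σ, ⟨?_, ?_⟩, ?_, ?_⟩
  · have := Fintype.card_congr e
    rw [Fintype.card_fin, Fintype.card_coe] at this
    omega
  · refine ⟨Set.bijOn_univ.2 σ.bijective, ?_⟩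
    have key : ∀ v : V, σ.SameCycle (e 0) v := by
      intro v
      obtain ⟨k, rfl⟩ := e.surjective v
      exact ⟨k, by rw [zpow_natCast]; exact hpow k k.2⟩
    intro x _ y _
    exact (key x).symm.trans (key y)
  · intro k hk v hv
    have : v = e ⟨k, hk⟩ := Subtype.ext hv
    rw [this]; exact hσe _
  · rw [length, ← Equiv.sum_comp e, Finset.sum_range]
    exact Finset.sum_congr rfl fun k _ => by rw [Subtype.dist_eq, hσe, hev]

/-- The points of a tour in the order of the tour. -/
lemma exists_seq_of_tour {V : Finset Plane} {σ : Equiv.Perm V} (h : IsTour σ) (v : V) :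
    let t : ℕ → Plane := fun k => (((σ ^ k) v : V) : Plane)
    t V.card = t 0 ∧ (∀ a < V.card, ∀ b < V.card, t a = t b → a = b) ∧
      (∀ x, x ∈ V ↔ ∃ k < V.card, t k = x) ∧
      length σ = ∑ k ∈ Finset.range V.card, dist (t k) (t (k + 1)) := by
  classical
  intro t
  have hc : σ.IsCycleOn ((Finset.univ : Finset V) : Set V) := by
    rw [Finset.coe_univ]; exact h.2
  have hcard : (Finset.univ : Finset V).card = V.card := by
    rw [Finset.card_univ, Fintype.card_coe]
  have hinj : ∀ a < V.card, ∀ b < V.card, (σ ^ a) v = (σ ^ b) v → a = b := by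
    intro a ha b hb hab
    have := (hc.pow_apply_eq_pow_apply (Finset.mem_univ v)).1 hab
    rw [hcard] at this
    exact Nat.ModEq.eq_of_lt_of_lt this ha hb
  have hex : ∀ w : V, ∃ k < V.card, (σ ^ k) v = w := by
    intro w
    obtain ⟨k, hk, hkw⟩ := hc.exists_pow_eq (Finset.mem_univ v) (Finset.mem_univ w)
    exact ⟨k, by rwa [hcard] at hk, hkw⟩
  refine ⟨?_, ?_, ?_, ?_⟩
  · have := hc.pow_card_apply (Finset.mem_univ v)
    rw [hcard] at this
    simp [t, this]
  · intro a ha b hb hab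
    exact hinj a ha b hb (Subtype.ext hab)
  · intro x
    constructor
    · intro hx
      obtain ⟨k, hk, hkx⟩ := hex ⟨x, hx⟩
      exact ⟨k, hk, by simp [t, hkx]⟩
    · rintro ⟨k, -, rfl⟩
      exact ((σ ^ k) v).2
  · symm
    rw [length]
    refine Finset.sum_bij (fun k _ => (σ ^ k) v) (fun _ _ => Finset.mem_univ _) ?_ ?_ ?_
    · intro a ha b hb hab
      exact hinj a (Finset.mem_range.1 ha) b (Finset.mem_range.1 hb) hab
    · intro w _
      obtain ⟨k, hk, hkw⟩ := hex w
      exact ⟨k, Finset.mem_range.2 hk, hkw⟩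
    · intro k _
      simp only [t, pow_succ', Equiv.Perm.mul_apply]
      rfl

/-- The tour visiting the points of a list in this order. -/
lemma exists_tour_of_list {V : Finset Plane} (hcard : 3 ≤ V.card) {a : Plane} {l : List Plane}
    (hnd : (a :: l).Nodup) (hV : ∀ x, x ∈ V ↔ x ∈ a :: l) {R : Plane → Plane → Prop}
    (hR : List.IsChain R (a :: l ++ [a])) :
    ∃ σ : Equiv.Perm V, IsTour σ ∧ (∀ v : V, R v (σ v)) ∧
      length σ = pathLength (a :: l ++ [a]) := by
  classical
  have hlen : (a :: l).length = V.card := by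
    rw [← List.toFinset_card_of_nodup hnd]
    congr 1
    ext x; rw [List.mem_toFinset, hV]
  set t : ℕ → Plane := fun k => (a :: l ++ [a]).getD k a with ht
  have hlow : ∀ k (hk : k < (a :: l).length), t k = (a :: l)[k] := by
    intro k hk
    simp only [ht]
    rw [List.getD_append _ _ _ _ hk, List.getD_eq_getElem _ _ hk]
  obtain ⟨σ, h1, h2, h3⟩ := exists_tour_of_seq (V := V) (n := (a :: l).length) (by omega) (t := t)
    (by simp [ht]) (by
      intro i hi j hj hij
      rw [hlow i hi, hlow j hj] at hij
      exact (List.Nodup.getElem_inj_iff hnd).1 hij) (by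
      intro x
      rw [hV, List.mem_iff_getElem]
      constructor
      · rintro ⟨k, hk, rfl⟩
        exact ⟨k, hk, hlow k hk⟩
      · rintro ⟨k, hk, rfl⟩
        exact ⟨k, hk, (hlow k hk).symm⟩)
  refine ⟨σ, h1, fun v => ?_, ?_⟩
  · obtain ⟨k, hk, hkv⟩ := List.mem_iff_getElem.1 ((hV v).1 v.2)
    have hv : (v : Plane) = t k := by rw [hlow k hk, hkv]
    have hk' : k + 1 < (a :: l ++ [a]).length := by
      rw [List.length_append, List.length_singleton]; omega
    rw [h2 k hk v hv, hv]
    simp only [ht]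
    rw [List.getD_eq_getElem _ _ hk', List.getD_eq_getElem _ _ (by omega)]
    exact List.isChain_iff_getElem.1 hR k hk'
  · rw [h3]
    have := pathLength_eq_sum (a :: l ++ [a]) a
    rw [List.length_append, List.length_singleton, Nat.add_sub_cancel] at this
    rw [ht, ← this]

/-- Shortcutting a closed walk gives a tour that is not longer. -/
lemma HasClosedWalk.exists_tour {V : Finset Plane} (hV : 3 ≤ V.card) {a : Plane} {B : ℝ}
    (h : HasClosedWalk (V : Set Plane) a B) : ∃ τ : Equiv.Perm V, IsTour τ ∧ length τ ≤ B := by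
  classical
  obtain ⟨l, hl, hB⟩ := h
  -- Keep one occurrence of every point other than the base point; deleting the others does not
  -- lengthen the walk.
  set l' := (l.filter (· ≠ a)).dedup with hl'
  have hsub : l'.Sublist l := (List.dedup_sublist _).trans List.filter_sublist
  have hnd : (a :: l').Nodup := by
    rw [List.nodup_cons]
    exact ⟨by simp [hl'], List.nodup_dedup _⟩
  have hmem : ∀ x, x ∈ V ↔ x ∈ a :: l' := by
    intro x
    rw [← Finset.mem_coe, hl]
    by_cases hxa : x = a <;> simp [hl', hxa]
  obtain ⟨σ, h1, -, h3⟩ := exists_tour_of_list hV hnd hmem (R := fun _ _ => True)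
    (List.isChain_iff_getElem.2 fun _ _ => trivial)
  exact ⟨σ, h1, h3.trans_le ((pathLength_sublist hsub a a).trans hB)⟩

lemma IsTour.hasClosedWalk {V : Finset Plane} {τ : Equiv.Perm V} (h : IsTour τ) (v : V) :
    HasClosedWalk (V : Set Plane) v (length τ) := by
  obtain ⟨h1, h2, h3, h4⟩ := exists_seq_of_tour h v
  set t : ℕ → Plane := fun k => (((τ ^ k) v : V) : Plane) with ht
  obtain ⟨n, hn⟩ : ∃ n, V.card = n + 1 := ⟨V.card - 1, by have := h.1; omega⟩
  have hv : (v : Plane) = t 0 := rfl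
  have hlist : (v : Plane) :: (List.range n).map (fun k => t (k + 1)) =
      (List.range (n + 1)).map t := by
    rw [List.range_succ_eq_map, List.map_cons, List.map_map, hv]; rfl
  refine ⟨(List.range n).map fun k => t (k + 1), fun x => ?_, ?_⟩
  · rw [hlist, Finset.mem_coe, h3, hn]
    simp
  · rw [hlist, h4, hn, ← pathLength_map_range, List.range_succ (n := n + 1), List.map_append, ← hn]
    simp only [List.map_cons, List.map_nil]
    rw [h1, hv]

lemma exists_optimal {V : Finset Plane} {τ : Equiv.Perm V} (h : IsTour τ) :
    ∃ τ' : Equiv.Perm V, IsOptimalTour τ' := by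
  classical
  obtain ⟨σ, hσ, hmin⟩ := Finset.exists_min_image
    (Finset.univ.filter fun σ : Equiv.Perm V => IsTour σ) length ⟨τ, by simpa using h⟩
  simp only [Finset.mem_filter, Finset.mem_univ, true_and] at hσ hmin
  exact ⟨σ, hσ, hmin⟩

/-- Optimal tours are 2-optimal. -/
lemma IsOptimalTour.isTwoOptimal {V : Finset Plane} {τ : Equiv.Perm V} (h : IsOptimalTour τ) :
    IsTwoOptimal τ := by
  refine ⟨h.1, fun a x hax => ?_⟩
  -- Starting the tour at `τ a`, it ends at a and passes x at position r. Reversing the initial part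
  -- up to position r performs the 2-move: `{a, τ a}` and `{x, τ x}` become `{a, x}` and `{τ a, τ
  -- x}`. Optimality forbids a gain.
  obtain ⟨h1, h2, h3, h4⟩ := exists_seq_of_tour h.1 (τ a)
  set t : ℕ → Plane := fun k => (((τ ^ k) (τ a) : V) : Plane) with ht
  set n := V.card with hn
  have hn3 := h.1.1
  obtain ⟨r, hr, hrx⟩ := (h3 x).1 x.2
  have hrx' : (τ ^ r) (τ a) = x := Subtype.ext hrx
  have htr1 : t (r + 1) = (τ x : V) := by simp only [ht, pow_succ', Equiv.Perm.mul_apply, hrx']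
  have ht0 : t 0 = (τ a : V) := rfl
  have hlast : t (n - 1) = a := by
    have e1 : t n = ((τ ((τ ^ (n - 1)) (τ a)) : V) : Plane) := by
      rw [← Equiv.Perm.mul_apply, ← pow_succ', Nat.sub_add_cancel (by omega)]
    rw [h1, ht0] at e1
    exact congrArg Subtype.val (τ.injective (Subtype.ext e1)).symm
  have hrn : r ≠ n - 1 := by
    rintro rfl
    rw [hlast] at hrx
    exact hax (Subtype.ext hrx)
  obtain ⟨s, hs⟩ : ∃ s, n = r + 1 + s + 1 := ⟨n - r - 2, by omega⟩
  set t' : ℕ → Plane := fun k => if k ≤ r then t (r - k) else if k < n then t k else t r with ht'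
  have l1 : ∀ k ≤ r, t' k = t (r - k) := fun k hk => by simp [ht', hk]
  have l2 : ∀ k, r < k → k < n → t' k = t k := fun k hk hk' => by
    simp [ht', not_le.2 hk, hk']
  have l3 : t' n = t r := by
    have : ¬ n ≤ r := by omega
    simp [ht', this]
  obtain ⟨σ, g1, -, g3⟩ := exists_tour_of_seq (V := V) (n := n) hn3 (t := t')
    (by rw [l3, l1 0 (by omega), Nat.sub_zero]) (by
      intro i hi j hj hij
      rcases le_or_gt i r with hi' | hi' <;> rcases le_or_gt j r with hj' | hj'
      · rw [l1 i hi', l1 j hj'] at hij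
        have := h2 _ (by omega) _ (by omega) hij; omega
      · rw [l1 i hi', l2 j hj' hj] at hij
        have := h2 _ (by omega) _ (by omega) hij; omega
      · rw [l2 i hi' hi, l1 j hj'] at hij
        have := h2 _ (by omega) _ (by omega) hij; omega
      · rw [l2 i hi' hi, l2 j hj' hj] at hij
        exact h2 _ hi _ hj hij) (by
      intro p
      rw [h3]
      constructor
      · rintro ⟨k, hk, rfl⟩
        rcases le_or_gt k r with hk' | hk'
        · exact ⟨r - k, by omega, by rw [l1 _ (by omega)]; congr 1; omega⟩
        · exact ⟨k, hk, l2 k hk' hk⟩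
      · rintro ⟨k, hk, rfl⟩
        rcases le_or_gt k r with hk' | hk'
        · exact ⟨r - k, by omega, (l1 k hk').symm⟩
        · exact ⟨k, hk, (l2 k hk' hk).symm⟩)
  have hle := h.2 σ g1
  rw [g3, h4, hs, Finset.sum_range_succ, Finset.sum_range_succ _ (r + 1 + s),
    Finset.sum_range_add _ (r + 1) s, Finset.sum_range_add _ (r + 1) s, Finset.sum_range_succ _ r,
    Finset.sum_range_succ _ r] at hle
  have e1 : ∑ k ∈ Finset.range r, dist (t' k) (t' (k + 1)) =
      ∑ k ∈ Finset.range r, dist (t k) (t (k + 1)) := by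
    rw [← Finset.sum_range_reflect (fun k => dist (t k) (t (k + 1)))]
    refine Finset.sum_congr rfl fun k hk => ?_
    rw [Finset.mem_range] at hk
    rw [l1 k hk.le, l1 (k + 1) hk, dist_comm, show r - (k + 1) = r - 1 - k by omega,
      show r - k = r - 1 - k + 1 by omega]
  have e2 : ∑ k ∈ Finset.range s, dist (t' (r + 1 + k)) (t' (r + 1 + k + 1)) =
      ∑ k ∈ Finset.range s, dist (t (r + 1 + k)) (t (r + 1 + k + 1)) := by
    refine Finset.sum_congr rfl fun k hk => ?_
    rw [Finset.mem_range] at hk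
    rw [l2 _ (by omega) (by omega), l2 _ (by omega) (by omega)]
  rw [e1, e2, l1 r le_rfl, l2 (r + 1) (by omega) (by omega), l2 (r + 1 + s) (by omega) (by omega),
    ← hs, l3, h1, Nat.sub_self, show r + 1 + s = n - 1 by omega, hlast, htr1, ht0] at hle
  have : t r = x := hrx
  rw [this] at hle
  simp only [Subtype.dist_eq]
  have e3 := dist_comm ((τ x : V) : Plane) (τ a)
  linarith

end EuclideanTSP

/-! ### The upper bound on the ratios -/

namespace EuclideanTSP

lemma IsTwoOptimal.simplePolygon {V : Finset Plane} {τ : Equiv.Perm V} (h : IsTwoOptimal τ)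
    (hcol : ∀ a b : V, ∃ c : V, (c : Plane) ∉ line[ℝ, (a : Plane), (b : Plane)]) (v : V) :
    SimplePolygon (fun k => (((τ ^ k) v : V) : Plane)) V.card := by
  obtain ⟨h1, h2, h3, -⟩ := exists_seq_of_tour h.1 v
  refine ⟨h1, h2, ?_⟩
  intro a b hab hb p hpa hpb
  have hsucc : ∀ k, (τ ^ (k + 1)) v = τ ((τ ^ k) v) := fun k => by
    rw [pow_succ', Equiv.Perm.mul_apply]
  have hcyc : ∀ i j : V, ∃ k : ℕ, (τ ^ k) i = j := by
    intro i j
    obtain ⟨k, -, hk⟩ := (exists_seq_of_tour h.1 i).2.2.1 j |>.1 j.2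
    exact ⟨k, Subtype.ext hk⟩
  have hne : (τ ^ a) v ≠ (τ ^ b) v := fun hh => by
    have := h2 a (hab.trans hb) b hb (congrArg Subtype.val hh)
    omega
  have := edges_meet_of_twoOpt (f := (Subtype.val : V → Plane)) (s := τ) Subtype.val_injective
    (fun i hi => isTour_apply_ne h.1 i hi) (fun i j hij => h.2 i j hij) hcyc hcol hne
    (p := p) (by simpa only [hsucc] using hpa) (by simpa only [hsucc] using hpb)
  rw [← hsucc, ← hsucc] at this
  rcases this with ⟨hs, hp⟩ | ⟨hs, hp⟩
  · left
    have := h2 (a + 1) (by omega) b hb (congrArg Subtype.val hs)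
    exact ⟨this.symm, hp⟩
  · right
    rcases Nat.lt_or_ge (b + 1) V.card with hb' | hb'
    · have := h2 (b + 1) hb' a (hab.trans hb) (congrArg Subtype.val hs)
      omega
    · have hbe : b + 1 = V.card := by omega
      rw [hbe] at hs
      have ha := h2 0 (by omega) a (hab.trans hb) (h1.symm.trans (congrArg Subtype.val hs))
      subst ha
      exact ⟨rfl, hbe, hp⟩

/-- The third vertex of an isosceles right triangle with apex `p`. -/
noncomputable def quarterTurn (p q : Plane) : Plane := !₂[p 0 - (q 1 - p 1), p 1 + (q 0 - p 0)]

lemma dist_quarterTurn (p q : Plane) : dist p (quarterTurn p q) = dist p q := by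
  simp only [EuclideanSpace.dist_eq, Fin.sum_univ_two, quarterTurn, Real.dist_eq, sq_abs]
  congr 1
  simp
  ring

/-- On a line, the vector from p to q and its quarter turn would be parallel; their determinant is
the squared distance of p and q. -/
lemma not_subset_line_quarterTurn {p q : Plane} (h : p ≠ q) (a b : Plane) :
    ∃ c ∈ ({p, q, quarterTurn p q} : Set Plane), c ∉ line[ℝ, a, b] := by
  by_contra! hc
  obtain ⟨r, hr⟩ := mem_affineSpan_pair_iff_exists_lineMap_eq.1 (hc p (by simp))
  obtain ⟨s, hs⟩ := mem_affineSpan_pair_iff_exists_lineMap_eq.1 (hc q (by simp))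
  obtain ⟨u, hu⟩ := mem_affineSpan_pair_iff_exists_lineMap_eq.1 (hc (quarterTurn p q) (by simp))
  have e : ∀ (r : ℝ) (p : Plane), AffineMap.lineMap a b r = p → ∀ i, p i = a i + r * (b i - a i) := by
    rintro r p rfl i
    simp [AffineMap.lineMap_apply]; ring
  have p0 := e r p hr 0
  have p1 := e r p hr 1
  have q0 := e s q hs 0
  have q1 := e s q hs 1
  have u0 := e u _ hu 0
  have u1 := e u _ hu 1
  have z0 : quarterTurn p q 0 = p 0 - (q 1 - p 1) := by simp [quarterTurn]
  have z1 : quarterTurn p q 1 = p 1 + (q 0 - p 0) := by simp [quarterTurn]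
  have d0 : q 0 - p 0 = (s - r) * (b 0 - a 0) := by rw [p0, q0]; ring
  have d1 : q 1 - p 1 = (s - r) * (b 1 - a 1) := by rw [p1, q1]; ring
  have f0 : -(q 1 - p 1) = (u - r) * (b 0 - a 0) := by linear_combination u0 - z0 - p0
  have f1 : q 0 - p 0 = (u - r) * (b 1 - a 1) := by linear_combination u1 - z1 - p1
  have key : (q 0 - p 0) ^ 2 + (q 1 - p 1) ^ 2 = 0 := by
    have : (q 0 - p 0) * (q 0 - p 0) - (-(q 1 - p 1)) * (q 1 - p 1) = 0 := by
      calc _ = ((s - r) * (b 0 - a 0)) * ((u - r) * (b 1 - a 1)) -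
            ((u - r) * (b 0 - a 0)) * ((s - r) * (b 1 - a 1)) := by
            rw [← d0, ← d1, ← f0, ← f1]
        _ = 0 := by ring
    linear_combination this
  refine h (plane_ext ?_ ?_) <;> nlinarith [sq_nonneg (q 0 - p 0), sq_nonneg (q 1 - p 1)]

/-- A tour goes from v to w and back. -/
lemma IsTour.two_mul_dist_le {V : Finset Plane} {τ : Equiv.Perm V} (h : IsTour τ) (v w : V) :
    2 * dist (v : Plane) w ≤ length τ := by
  obtain ⟨l, hl, hB⟩ := h.hasClosedWalk v
  rcases List.mem_cons.1 ((hl w).1 w.2) with hwv | hw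
  · rw [hwv, dist_self, mul_zero]
    exact (pathLength_nonneg _).trans hB
  · obtain ⟨l₁, l₂, rfl⟩ := List.append_of_mem hw
    have e := pathLength_append ((v : Plane) :: l₁) w (l₂ ++ [(v : Plane)])
    have h1 := dist_le_pathLength (v : Plane) w l₁
    have h2 := dist_le_pathLength (w : Plane) v l₂
    rw [dist_comm] at h2
    simp only [List.cons_append, List.append_assoc] at e hB h1 h2
    linarith

lemma IsTour.length_pos {V : Finset Plane} {τ : Equiv.Perm V} (h : IsTour τ) : 0 < length τ := by
  obtain ⟨v, hv, w, hw, hvw⟩ := Finset.one_lt_card.1 (lt_of_lt_of_le (by norm_num) h.1 : 1 < V.card)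
  have := h.two_mul_dist_le ⟨v, hv⟩ ⟨w, hw⟩
  have := dist_pos.2 hvw
  simp only at *
  linarith

/-- The upper bound on the length of 2-optimal tours. -/
lemma IsTwoOptimal.length_le {V : Finset Plane} {σ τ : Equiv.Perm V} (hσ : IsTwoOptimal σ)
    (hτ : IsTour τ) {K : ℝ} (hK : 1 < K) :
    length σ ≤ 8 * (length τ *
      (K / 2 + (1 + 2 * Real.log (((V.card : ℝ) + 1) ^ 4 + 1)) / Real.log K)) := by
  classical
  obtain ⟨v, hv, w, hw, hvw⟩ := Finset.one_lt_card.1 (lt_of_lt_of_le (by norm_num) hτ.1 : 1 < V.card)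
  -- The extra point prevents collinearity. It is as far from v as w is, so the detour to it costs
  -- at most the length of τ and the optimum for W is at most twice that length; this turns the
  -- factor 4 into 8.
  set z := quarterTurn v w with hz
  set W := insert z V with hW
  have hwalk : HasClosedWalk (W : Set Plane) v (2 * length τ) := by
    rw [hW, Finset.coe_insert]
    refine ((hτ.hasClosedWalk ⟨v, hv⟩).insert (q := v) hv z).mono ?_
    have := hτ.two_mul_dist_le ⟨v, hv⟩ ⟨w, hw⟩
    simp only at this
    rw [hz, dist_quarterTurn]
    linarith
  have hcW : V.card ≤ W.card := Finset.card_le_card (Finset.subset_insert _ _)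
  have hcW' : W.card ≤ V.card + 1 := Finset.card_insert_le _ _
  obtain ⟨τ₁, h1, h1l⟩ := hwalk.exists_tour (hτ.1.trans hcW)
  obtain ⟨τ₂, h2⟩ := exists_optimal h1
  have hvW : v ∈ W := Finset.mem_insert_of_mem hv
  have hsimple := h2.isTwoOptimal.simplePolygon (fun a b => by
    obtain ⟨c, hc, hcl⟩ := not_subset_line_quarterTurn hvw a b
    refine ⟨⟨c, ?_⟩, hcl⟩
    rcases hc with rfl | rfl | rfl
    · exact hvW
    · exact Finset.mem_insert_of_mem hw
    · exact Finset.mem_insert_self _ _) ⟨v, hvW⟩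
  obtain ⟨-, -, g3, g4⟩ := exists_seq_of_tour h2.1 ⟨v, hvW⟩
  have := length_le_of_simplePolygon hσ hsimple
    (fun x hx => (g3 x).1 (Finset.mem_insert_of_mem hx)) hcW' hK
  rw [← g4] at this
  refine this.trans ?_
  have hlen : length τ₂ ≤ 2 * length τ := (h2.2 _ h1).trans h1l
  have hlog : 0 ≤ Real.log (((V.card : ℝ) + 1) ^ 4 + 1) := Real.log_nonneg (by
    have : (0 : ℝ) ≤ ((V.card : ℝ) + 1) ^ 4 := by positivity
    linarith)
  have hpos : 0 ≤ K / 2 + (1 + 2 * Real.log (((V.card : ℝ) + 1) ^ 4 + 1)) / Real.log K := by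
    have := Real.log_pos hK
    have : 0 < K := by linarith
    positivity
  nlinarith [mul_le_mul_of_nonneg_right hlen hpos]

lemma le_of_mem_twoOptRatios {n : ℕ} {r : ℝ} (hr : r ∈ twoOptRatios n) {K : ℝ} (hK : 1 < K) :
    r ≤ 8 * (K / 2 + (1 + 2 * Real.log (((n : ℝ) + 1) ^ 4 + 1)) / Real.log K) := by
  obtain ⟨V, rfl, σ, τ, ⟨-, -, -, hσ⟩, hτ, rfl⟩ := hr
  rw [div_le_iff₀ hτ.1.length_pos]
  have := hσ.length_le hτ.1 hK
  linarith

lemma bddAbove_twoOptRatios (n : ℕ) : BddAbove (twoOptRatios n) :=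
  ⟨_, fun _ hr => le_of_mem_twoOptRatios hr (K := 2) (by norm_num)⟩

lemma IsTwoOptimal.isTwoOptOutput {V : Finset Plane} {σ : Equiv.Perm V} (h : IsTwoOptimal σ) :
    IsTwoOptOutput σ :=
  ⟨σ, h.1, Relation.ReflTransGen.refl, h⟩

/-- An optimal tour is itself 2-optimal and hence a possible output, giving ratio 1. -/
lemma twoOptRatios_nonempty {n : ℕ} (hn : 3 ≤ n) : (twoOptRatios n).Nonempty := by
  obtain ⟨V, hV⟩ := Infinite.exists_subset_card_eq Plane n
  obtain ⟨v, hv⟩ : V.Nonempty := Finset.card_pos.1 (by omega)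
  have hwalk : HasClosedWalk (V : Set Plane) v (pathLength (v :: V.toList ++ [v])) :=
    ⟨V.toList, fun x => by
      rw [List.mem_cons, Finset.mem_toList, Finset.mem_coe]
      exact ⟨Or.inr, fun h => h.elim (fun h => h ▸ hv) id⟩, le_rfl⟩
  obtain ⟨τ, hτ, -⟩ := hwalk.exists_tour (by omega)
  obtain ⟨σ, hσ⟩ := exists_optimal hτ
  exact ⟨_, V, hV, σ, σ, hσ.isTwoOptimal.isTwoOptOutput, hσ, rfl⟩

end EuclideanTSP

/-! ### The layered instance and 2-optimality of its snake tour -/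

namespace EuclideanTSP

lemma plane_dist_sq (a b : Plane) : dist a b ^ 2 = (a 0 - b 0) ^ 2 + (a 1 - b 1) ^ 2 := by
  rw [EuclideanSpace.dist_eq, Real.sq_sqrt (by positivity), Fin.sum_univ_two, Real.dist_eq,
    Real.dist_eq, sq_abs, sq_abs]

lemma abs_sub_le_plane_dist (a b : Plane) (i : Fin 2) : |a i - b i| ≤ dist a b := by
  refine abs_le_of_sq_le_sq ?_ dist_nonneg
  rw [plane_dist_sq]
  fin_cases i
  · simp; positivity
  · simp; positivity

lemma sub_le_plane_dist (a b : Plane) (i : Fin 2) : a i - b i ≤ dist a b :=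
  (le_abs_self _).trans (abs_sub_le_plane_dist a b i)

lemma sub_le_plane_dist' (a b : Plane) (i : Fin 2) : b i - a i ≤ dist a b := by
  rw [dist_comm]; exact sub_le_plane_dist b a i

lemma plane_dist_of_fst_eq {a b : Plane} (h : a 0 = b 0) : dist a b = |a 1 - b 1| := by
  rw [← abs_of_nonneg (dist_nonneg (x := a) (y := b)), ← sq_eq_sq_iff_abs_eq_abs, plane_dist_sq, h]
  ring

lemma plane_dist_of_snd_eq {a b : Plane} (h : a 1 = b 1) : dist a b = |a 0 - b 0| := by
  rw [← abs_of_nonneg (dist_nonneg (x := a) (y := b)), ← sq_eq_sq_iff_abs_eq_abs, plane_dist_sq, h]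
  ring

/-- The triangle inequality for `a - x` and the mirror image of `b - y` in the vertical axis. For
two parallel horizontal edges of lengths L and L' with equal direction and vertical distance D, it
reduces 2-optimality to L·L' ≤ D². -/
lemma le_dist_add_dist {a b x y : Plane} {r : ℝ}
    (h : r ^ 2 ≤ ((a 0 - x 0) - (b 0 - y 0)) ^ 2 + ((a 1 - x 1) + (b 1 - y 1)) ^ 2) :
    r ≤ dist a x + dist b y := by
  refine (le_abs_self r).trans (abs_le_of_sq_le_sq ?_ (add_nonneg dist_nonneg dist_nonneg))
  have key : (a 1 - x 1) * (b 1 - y 1) - (a 0 - x 0) * (b 0 - y 0) ≤ dist a x * dist b y := by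
    refine (le_abs_self _).trans (abs_le_of_sq_le_sq ?_ (mul_nonneg dist_nonneg dist_nonneg))
    rw [mul_pow, plane_dist_sq, plane_dist_sq]
    nlinarith [sq_nonneg ((a 0 - x 0) * (b 1 - y 1) + (a 1 - x 1) * (b 0 - y 0))]
  have h1 := plane_dist_sq a x
  have h2 := plane_dist_sq b y
  nlinarith

/-- The height of a layer of the instance on which 2-Opt performs badly. -/
noncomputable def layerHeight (d i : ℕ) : ℝ := 2 / (d : ℝ) ^ (i + 1)

/-- The number of edges of the tour in a layer. -/
def layerSteps (d q i : ℕ) : ℕ := if i < d then d ^ i else q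

/-- The leftmost abscissa of a layer; the rightmost one is `1`. -/
noncomputable def layerLeft (d i : ℕ) : ℝ := if i = 0 ∨ i = d then -1 else 0

/-- The length of the edges in a layer. -/
noncomputable def layerGap (d q i : ℕ) : ℝ := (1 - layerLeft d i) / layerSteps d q i

/-- The points of the instance. -/
noncomputable def layerPoint (d q i j : ℕ) : Plane :=
  !₂[layerLeft d i + j * layerGap d q i, layerHeight d i]

@[simp] lemma layerPoint_zero (d q i j : ℕ) :
    layerPoint d q i j 0 = layerLeft d i + j * layerGap d q i := by simp [layerPoint]

@[simp] lemma layerPoint_one (d q i j : ℕ) : layerPoint d q i j 1 = layerHeight d i := by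
  simp [layerPoint]

/-- An edge inside of the layer `i`: rightwards in the even and leftwards in the odd layers. -/
structure IsLayerEdge (d q i : ℕ) (a b : Plane) : Prop where
  le : i ≤ d
  fst : a 1 = layerHeight d i
  snd : b 1 = layerHeight d i
  left_fst : layerLeft d i ≤ a 0
  left_snd : layerLeft d i ≤ b 0
  right_fst : a 0 ≤ 1
  right_snd : b 0 ≤ 1
  even : Even i → b 0 = a 0 + layerGap d q i
  odd : Odd i → b 0 = a 0 - layerGap d q i
  grid : ∃ j : ℤ, a 0 = layerLeft d i + j * layerGap d q i

/-- An edge from the layer `i` to the layer `i + 1`. -/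
structure IsConnector (d i : ℕ) (a b : Plane) : Prop where
  lt : i < d
  fst : a 1 = layerHeight d i
  snd : b 1 = layerHeight d (i + 1)
  vertical : b 0 = a 0
  even : Even i → a 0 = 1
  odd : Odd i → a 0 = 0

/-- The edge from the last layer back to the first one. -/
structure IsClosingEdge (d : ℕ) (a b : Plane) : Prop where
  fst : a 1 = layerHeight d d
  snd : b 1 = layerHeight d 0
  vertical : b 0 = a 0
  left : a 0 = -1

/-- The oriented edges of the tour through the layers. -/
def IsLayeredEdge (d q : ℕ) (a b : Plane) : Prop :=
  (∃ i, IsLayerEdge d q i a b) ∨ (∃ i, IsConnector d i a b) ∨ IsClosingEdge d a b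

section
variable {d q : ℕ}

lemma layerHeight_pos (hd : 5 ≤ d) (i : ℕ) : 0 < layerHeight d i := by
  have : (0 : ℝ) < d := by exact_mod_cast (by omega : 0 < d)
  unfold layerHeight; positivity

lemma mul_layerHeight_succ (hd : 5 ≤ d) (i : ℕ) :
    (d : ℝ) * layerHeight d (i + 1) = layerHeight d i := by
  have : (0 : ℝ) < d := by exact_mod_cast (by omega : 0 < d)
  unfold layerHeight; field_simp; ring

lemma five_mul_layerHeight_succ (hd : 5 ≤ d) (i : ℕ) :
    5 * layerHeight d (i + 1) ≤ layerHeight d i := by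
  have : (5 : ℝ) ≤ d := by exact_mod_cast hd
  rw [← mul_layerHeight_succ hd i]
  exact mul_le_mul_of_nonneg_right this (layerHeight_pos hd _).le

lemma layerHeight_anti (hd : 5 ≤ d) : Antitone (layerHeight d) :=
  antitone_nat_of_succ_le fun i => by
    linarith [five_mul_layerHeight_succ hd i, layerHeight_pos hd (i + 1)]

lemma five_mul_layerHeight (hd : 5 ≤ d) {i j : ℕ} (h : i < j) :
    5 * layerHeight d j ≤ layerHeight d i := by
  have := layerHeight_anti hd (show i + 1 ≤ j from h)
  linarith [five_mul_layerHeight_succ hd i]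

lemma layerHeight_one (d : ℕ) : layerHeight d 1 = layerHeight d 0 ^ 2 / 2 := by
  unfold layerHeight
  rw [div_pow]; ring

lemma layerHeight_zero_le (hd : 5 ≤ d) : layerHeight d 0 ≤ 2 / 5 := by
  have : (5 : ℝ) ≤ d := by exact_mod_cast hd
  unfold layerHeight
  rw [zero_add, pow_one]
  exact div_le_div_of_nonneg_left (by norm_num) (by norm_num) this

lemma layerSteps_pos (hd : 5 ≤ d) (hq : 2 * d ^ d ≤ q) (i : ℕ) : 0 < layerSteps d q i := by
  have : 0 < d ^ d := by positivity
  unfold layerSteps; split_ifs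
  · positivity
  · omega

lemma layerLeft_le (d i : ℕ) : layerLeft d i ≤ 0 := by
  unfold layerLeft; split_ifs <;> norm_num

lemma layerGap_pos (hd : 5 ≤ d) (hq : 2 * d ^ d ≤ q) (i : ℕ) : 0 < layerGap d q i :=
  div_pos (by linarith [layerLeft_le d i]) (by exact_mod_cast layerSteps_pos hd hq i)

lemma layerGap_zero (hd : 5 ≤ d) : layerGap d q 0 = 2 := by
  have : 0 < d := by omega
  simp [layerGap, layerLeft, layerSteps, this]; norm_num

/-- The steps of a layer are at most half the height of the layer above; for the last layer this is
the reason for requiring at least 2·d^d steps. -/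
lemma layerGap_le (hd : 5 ≤ d) (hq : 2 * d ^ d ≤ q) {i : ℕ} (hi : i < d) :
    2 * layerGap d q (i + 1) ≤ layerHeight d i := by
  have h0 : (0 : ℝ) < d := by exact_mod_cast (by omega : 0 < d)
  unfold layerGap layerSteps layerHeight layerLeft
  rcases Nat.lt_or_ge (i + 1) d with h | h
  · rw [if_neg (by omega), if_pos h, sub_zero, Nat.cast_pow, mul_one_div]
  · have : i + 1 = d := by omega
    rw [if_pos (Or.inr this), if_neg (by omega), this]
    have hq' : 2 * (d : ℝ) ^ d ≤ q := by exact_mod_cast hq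
    have hp : 0 < (d : ℝ) ^ d := by positivity
    rw [← mul_div_assoc, div_le_div_iff₀ (by linarith) hp]
    linarith

lemma layerGap_le_mul (hd : 5 ≤ d) (hq : 2 * d ^ d ≤ q) {i : ℕ} (hi : i ≤ d) :
    layerGap d q i ≤ d * layerHeight d i := by
  have h0 : (0 : ℝ) < d := by exact_mod_cast (by omega : 0 < d)
  cases i with
  | zero =>
    rw [layerGap_zero hd]
    unfold layerHeight
    rw [zero_add, pow_one, mul_div_cancel₀ _ h0.ne']
  | succ i =>
    rw [mul_layerHeight_succ hd]
    linarith [layerGap_le hd hq (show i < d by omega), layerGap_pos hd hq (i + 1)]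

/-- With h for heights, the product is at most (d·h_i)(h_(i+1)/2) = h_i²/2, whereas layer j, two or
more below layer i, has h_j ≤ h_i/25. -/
lemma layerGap_mul_le (hd : 5 ≤ d) (hq : 2 * d ^ d ≤ q) {i j : ℕ} (hij : i + 2 ≤ j) (hj : j ≤ d) :
    layerGap d q i * layerGap d q j ≤ (layerHeight d i - layerHeight d j) ^ 2 := by
  obtain ⟨k, rfl⟩ : ∃ k, j = k + 1 := ⟨j - 1, by omega⟩
  have h1 := layerGap_le_mul hd hq (show i ≤ d by omega)
  have h2 := layerGap_le hd hq (show k < d by omega)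
  have h3 := layerHeight_anti hd (show i + 1 ≤ k by omega)
  have h4 := five_mul_layerHeight hd (show k < k + 1 by omega)
  have h5 := five_mul_layerHeight_succ hd i
  have h6 := mul_layerHeight_succ hd i
  have p1 := layerHeight_pos hd (k + 1)
  have p2 := layerHeight_pos hd i
  have g1 := layerGap_pos hd hq i
  have g2 := layerGap_pos hd hq (k + 1)
  have e1 : layerGap d q i * layerGap d q (k + 1) ≤
      (d * layerHeight d i) * (layerHeight d (i + 1) / 2) :=
    mul_le_mul h1 (by linarith) g2.le (by linarith)
  have e2 : (d * layerHeight d i) * (layerHeight d (i + 1) / 2) = layerHeight d i ^ 2 / 2 := by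
    rw [← h6]; ring
  nlinarith

variable {a b x y : Plane} {i j : ℕ}

lemma IsLayerEdge.dist_eq (hd : 5 ≤ d) (hq : 2 * d ^ d ≤ q) (h : IsLayerEdge d q i a b) :
    dist a b = layerGap d q i := by
  have := layerGap_pos hd hq i
  rw [plane_dist_of_snd_eq (h.fst.trans h.snd.symm)]
  rcases Nat.even_or_odd i with hi | hi
  · rw [h.even hi, show a 0 - (a 0 + layerGap d q i) = -layerGap d q i by ring, abs_neg,
      abs_of_pos this]
  · rw [h.odd hi, show a 0 - (a 0 - layerGap d q i) = layerGap d q i by ring, abs_of_pos this]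

lemma IsConnector.dist_eq (hd : 5 ≤ d) (h : IsConnector d i a b) :
    dist a b = layerHeight d i - layerHeight d (i + 1) := by
  rw [plane_dist_of_fst_eq h.vertical.symm, h.fst, h.snd,
    abs_of_nonneg (sub_nonneg.2 (layerHeight_anti hd (Nat.le_succ i)))]

lemma IsClosingEdge.dist_eq (hd : 5 ≤ d) (h : IsClosingEdge d a b) :
    dist a b = layerHeight d 0 - layerHeight d d := by
  rw [dist_comm, plane_dist_of_fst_eq h.vertical, h.fst, h.snd,
    abs_of_nonneg (sub_nonneg.2 (layerHeight_anti hd (Nat.zero_le d)))]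

/-- Edges in opposite directions: project to the horizontal axis. In one layer: translates by
multiples of the step. In different layers of equal parity: their distance is large, by
`layerGap_mul_le`. -/
lemma IsLayerEdge.twoOpt (hd : 5 ≤ d) (hq : 2 * d ^ d ≤ q) (h : IsLayerEdge d q i a b)
    (h' : IsLayerEdge d q j x y) (hne : a ≠ x) (hij : i ≤ j) :
    dist a b + dist x y ≤ dist a x + dist b y := by
  rw [h.dist_eq hd hq, h'.dist_eq hd hq]
  have p1 := layerGap_pos hd hq i
  have p2 := layerGap_pos hd hq j
  by_cases hpar : Even i ↔ Even j
  · rcases hij.eq_or_lt with rfl | hlt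
    · have hdist : layerGap d q i ≤ |a 0 - x 0| := by
        obtain ⟨k, hk⟩ := h.grid
        obtain ⟨l, hl⟩ := h'.grid
        have hkl : k ≠ l := by
          rintro rfl
          exact hne (plane_ext (hk.trans hl.symm) (h.fst.trans h'.fst.symm))
        have h1 : (1 : ℝ) ≤ |((k - l : ℤ) : ℝ)| := by
          rw [← Int.cast_abs]
          exact_mod_cast Int.one_le_abs (sub_ne_zero.2 hkl)
        rw [hk, hl, show layerLeft d i + k * layerGap d q i - (layerLeft d i + l * layerGap d q i)
          = ((k - l : ℤ) : ℝ) * layerGap d q i by push_cast; ring, abs_mul, abs_of_pos p1]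
        nlinarith
      have e : b 0 - y 0 = a 0 - x 0 := by
        rcases Nat.even_or_odd i with hi | hi
        · rw [h.even hi, h'.even hi]; ring
        · rw [h.odd hi, h'.odd hi]; ring
      have h1 := abs_sub_le_plane_dist a x 0
      have h2 := abs_sub_le_plane_dist b y 0
      rw [e] at h2
      linarith
    · have h2 : i + 2 ≤ j := by
        rcases Nat.lt_or_ge (i + 1) j with h3 | h3
        · omega
        · have : j = i + 1 := by omega
          subst this
          rw [Nat.even_add_one] at hpar
          tauto
      have hm := layerGap_mul_le hd hq h2 h'.le
      refine le_dist_add_dist ?_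
      rw [h.fst, h.snd, h'.fst, h'.snd]
      rcases Nat.even_or_odd i with hi | hi
      · rw [h.even hi, h'.even (hpar.1 hi)]
        nlinarith
      · rw [h.odd hi, h'.odd (by rw [← Nat.not_even_iff_odd] at hi ⊢; tauto)]
        nlinarith
  · rcases Nat.even_or_odd i with hi | hi
    · have hj : Odd j := by rw [← Nat.not_even_iff_odd]; tauto
      have e1 := h.even hi
      have e2 := h'.odd hj
      have h1 := sub_le_plane_dist' a x 0
      have h2 := sub_le_plane_dist b y 0
      linarith
    · have hj : Even j := by rw [← Nat.not_even_iff_odd] at hi; tauto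
      have e1 := h.odd hi
      have e2 := h'.even hj
      have h1 := sub_le_plane_dist a x 0
      have h2 := sub_le_plane_dist' b y 0
      linarith

/-- Except for the two cases below, one new edge is at least as long as the connector by vertical
projection, and the other at least as long as the layer edge by horizontal projection, since the
connector stands at an end of the layer. If the layer is well below the connector and of the same
parity, vertical projections of both new edges suffice. -/
lemma IsConnector.twoOpt_layerEdge (hdo : Odd d) (hd : 5 ≤ d) (hq : 2 * d ^ d ≤ q)
    (h : IsConnector d i a b) (h' : IsLayerEdge d q j x y) :
    dist a b + dist x y ≤ dist a x + dist b y := by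
  rw [h.dist_eq hd, h'.dist_eq hd hq]
  have p1 := layerGap_pos hd hq j
  have q1 := layerHeight_pos hd i
  have q2 := layerHeight_pos hd (i + 1)
  have q3 := layerHeight_pos hd j
  have hb : b 0 = a 0 := h.vertical
  have hl0 : 0 < j → j < d → layerLeft d j = 0 := fun h1 h2 => by
    rw [layerLeft, if_neg (by omega)]
  have h1 := sub_le_plane_dist a x 1
  have h1' := sub_le_plane_dist' a x 1
  have h2 := sub_le_plane_dist b y 1
  have h2' := sub_le_plane_dist' b y 1
  rw [h.fst, h'.fst] at h1 h1'
  rw [h.snd, h'.snd] at h2 h2'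
  by_cases hpar : Even i ↔ Even j
  · rcases Nat.lt_or_ge i j with hij | hij
    · have h3 : i + 1 < j := by
        rcases Nat.lt_or_ge (i + 1) j with h3 | h3
        · exact h3
        · have : j = i + 1 := by omega
          subst this
          rw [Nat.even_add_one] at hpar
          tauto
      obtain ⟨k, rfl⟩ : ∃ k, j = k + 1 := ⟨j - 1, by omega⟩
      have g1 := layerGap_le hd hq (show k < d by have := h'.le; omega)
      have g2 := layerHeight_anti hd (show i + 1 ≤ k by omega)
      have g3 := five_mul_layerHeight_succ hd k
      linarith
    · have g1 := layerHeight_anti hd hij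
      suffices layerGap d q j ≤ dist a x by linarith
      rcases Nat.even_or_odd i with hi | hi
      · have := sub_le_plane_dist a x 0
        have e1 := h.even hi
        have e2 := h'.even (hpar.1 hi)
        have e3 := h'.right_snd
        linarith
      · have hjo : Odd j := by rw [← Nat.not_even_iff_odd] at hi ⊢; tauto
        have := sub_le_plane_dist' a x 0
        have e1 := h.odd hi
        have e2 := h'.odd hjo
        have e3 := h'.left_snd
        rw [hl0 hjo.pos (by have := h.lt; omega)] at e3
        linarith
  · have hij : i ≠ j := fun e => hpar (by rw [e])
    -- Here the connector stands at abscissa 0, below the middle of the single edge of layer 0.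
    -- Projections do not suffice; the estimate is quadratic and uses that layer 1 has half the
    -- squared height of layer 0.
    by_cases hE : j = 0
    · subst hE
      have hi : Odd i := by rw [← Nat.not_even_iff_odd]; simpa using hpar
      rw [layerGap_zero hd]
      have hx1 := h'.left_fst
      have hy1 := h'.right_snd
      have hy := h'.even (by simp)
      rw [layerGap_zero hd] at hy
      have hxl : layerLeft d 0 = -1 := by simp [layerLeft]
      have hx0 : x 0 = -1 := by linarith
      refine le_dist_add_dist ?_
      rw [hb, h.odd hi, hx0, hy, hx0, h.fst, h.snd, h'.fst, h'.snd]
      have g1 := layerHeight_anti hd (show 1 ≤ i from hi.pos)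
      have g2 := five_mul_layerHeight hd (show 0 < i from hi.pos)
      have g3 := five_mul_layerHeight_succ hd i
      have g4 := layerHeight_one d
      nlinarith
    · have hv : layerHeight d i - layerHeight d (i + 1) ≤ dist a x := by
        rcases Nat.lt_or_ge i j with hlt | hge
        · have := layerHeight_anti hd (show i + 1 ≤ j from hlt)
          linarith
        · have := five_mul_layerHeight hd (show j < i by omega)
          linarith
      suffices layerGap d q j ≤ dist b y by linarith
      rcases Nat.even_or_odd i with hi | hi
      · have hjo : Odd j := by rw [← Nat.not_even_iff_odd]; tauto
        have := sub_le_plane_dist b y 0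
        have e1 := h.even hi
        have e2 := h'.odd hjo
        have e3 := h'.right_fst
        linarith
      · have hje : Even j := by rw [← Nat.not_even_iff_odd] at hi; tauto
        have hjd : j ≠ d := by rintro rfl; exact Nat.not_even_iff_odd.2 hdo hje
        have := sub_le_plane_dist' b y 0
        have e1 := h.odd hi
        have e2 := h'.even hje
        have e3 := h'.left_fst
        rw [hl0 (by omega) (by have := h'.le; omega)] at e3
        linarith

/-- The first and last layers end at the closing edge and are handled by projections. The other
layers are at horizontal distance at least 1 from it, so the new edges have total length at least 2;
this is why only the first and last layers extend to -1. -/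
lemma IsClosingEdge.twoOpt_layerEdge (hdo : Odd d) (hd : 5 ≤ d) (hq : 2 * d ^ d ≤ q)
    (h : IsClosingEdge d a b) (h' : IsLayerEdge d q j x y) :
    dist a b + dist x y ≤ dist a x + dist b y := by
  rw [h.dist_eq hd, h'.dist_eq hd hq]
  have hb := h.vertical
  have ha := h.left
  have h1 := sub_le_plane_dist' a x 1
  have h2 := sub_le_plane_dist b y 1
  have h3 := sub_le_plane_dist' a x 0
  have h4 := sub_le_plane_dist' b y 0
  rw [h.fst, h'.fst] at h1
  rw [h.snd, h'.snd] at h2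
  have p := layerHeight_pos hd d
  have p0 := layerHeight_zero_le hd
  rcases Nat.eq_zero_or_pos j with rfl | hj
  · have e := h'.even (by simp)
    have e1 := h'.left_fst
    have hxl : layerLeft d 0 = -1 := by simp [layerLeft]
    linarith
  rcases h'.le.eq_or_lt with rfl | hjd
  · have e := h'.odd hdo
    have e1 := h'.left_snd
    have hxl : layerLeft j j = -1 := by simp [layerLeft]
    linarith
  · have hl0 : layerLeft d j = 0 := by rw [layerLeft, if_neg (by omega)]
    obtain ⟨k, rfl⟩ : ∃ k, j = k + 1 := ⟨j - 1, by omega⟩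
    have g1 := layerGap_le hd hq (show k < d by omega)
    have g2 := layerHeight_anti hd (Nat.zero_le k)
    have e1 := h'.left_fst
    have e2 := h'.left_snd
    linarith

lemma IsConnector.twoOpt (hd : 5 ≤ d) (h : IsConnector d i a b) (h' : IsConnector d j x y)
    (hne : a ≠ x) (hij : i ≤ j) : dist a b + dist x y ≤ dist a x + dist b y := by
  rw [h.dist_eq hd, h'.dist_eq hd]
  have hlt : i < j := by
    refine lt_of_le_of_ne hij ?_
    rintro rfl
    refine hne (plane_ext ?_ (h.fst.trans h'.fst.symm))
    rcases Nat.even_or_odd i with hi | hi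
    · rw [h.even hi, h'.even hi]
    · rw [h.odd hi, h'.odd hi]
  have h1 := sub_le_plane_dist a x 1
  have h2 := sub_le_plane_dist b y 1
  rw [h.fst, h'.fst] at h1
  rw [h.snd, h'.snd] at h2
  have := layerHeight_anti hd (show i + 1 ≤ j from hlt)
  linarith

lemma IsClosingEdge.twoOpt_connector (hd : 5 ≤ d) (h : IsClosingEdge d a b)
    (h' : IsConnector d j x y) : dist a b + dist x y ≤ dist a x + dist b y := by
  rw [h.dist_eq hd, h'.dist_eq hd]
  have h1 := sub_le_plane_dist' a x 1
  have h2 := sub_le_plane_dist b y 1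
  rw [h.fst, h'.fst] at h1
  rw [h.snd, h'.snd] at h2
  linarith

lemma IsLayeredEdge.twoOpt (hdo : Odd d) (hd : 5 ≤ d) (hq : 2 * d ^ d ≤ q)
    (h : IsLayeredEdge d q a b) (h' : IsLayeredEdge d q x y) (hne : a ≠ x) :
    dist a b + dist x y ≤ dist a x + dist b y := by
  have swap : dist x y + dist a b ≤ dist x a + dist y b →
      dist a b + dist x y ≤ dist a x + dist b y := fun hh => by
    rw [dist_comm x a, dist_comm y b] at hh; linarith
  rcases h with ⟨i, h⟩ | ⟨i, h⟩ | h <;> rcases h' with ⟨j, h'⟩ | ⟨j, h'⟩ | h'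
  · rcases le_total i j with hij | hij
    · exact h.twoOpt hd hq h' hne hij
    · exact swap (h'.twoOpt hd hq h hne.symm hij)
  · exact swap (h'.twoOpt_layerEdge hdo hd hq h)
  · exact swap (h'.twoOpt_layerEdge hdo hd hq h)
  · exact h.twoOpt_layerEdge hdo hd hq h'
  · rcases le_total i j with hij | hij
    · exact h.twoOpt hd h' hne hij
    · exact swap (h'.twoOpt hd h hne.symm hij)
  · exact swap (h'.twoOpt_connector hd h)
  · exact h.twoOpt_layerEdge hdo hd hq h'
  · exact h.twoOpt_connector hd h'
  · exact absurd (plane_ext (h.left.trans h'.left.symm) (h.fst.trans h'.fst.symm)) hne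

end

end EuclideanTSP

/-! ### A long 2-optimal tour and a short closed walk -/

namespace EuclideanTSP

lemma dist_head_last_le_pathLength {X : Type*} [PseudoMetricSpace X] {l : List X} {a b : X}
    (ha : a ∈ l.head?) (hb : b ∈ l.getLast?) : dist a b ≤ pathLength l := by
  induction l generalizing a with
  | nil => simp at ha
  | cons c l ih =>
    simp only [List.head?_cons, Option.mem_def, Option.some.injEq] at ha
    subst ha
    cases l with
    | nil => simp at hb; simp [hb]
    | cons e l =>
      rw [List.getLast?_cons_cons] at hb
      rw [pathLength_cons_cons]
      linarith [ih (a := e) (by simp) hb, dist_triangle c e b]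

lemma pathLength_add_le {X : Type*} [PseudoMetricSpace X] (l₁ l₂ : List X) :
    pathLength l₁ + pathLength l₂ ≤ pathLength (l₁ ++ l₂) := by
  induction l₁ with
  | nil => simp [pathLength]
  | cons a l ih =>
    cases l with
    | nil =>
      cases l₂ with
      | nil => simp [pathLength]
      | cons b l => simp
    | cons b l => simp only [List.cons_append, pathLength_cons_cons] at ih ⊢; linarith

/-- The points of a layer in the order of the tour. -/
noncomputable def layerList (d q i : ℕ) : List Plane :=
  (List.range (layerSteps d q i + 1)).map fun j =>
    layerPoint d q i (if Even i then j else layerSteps d q i - j)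

/-- The points of the first `m` layers in the order of the tour. -/
noncomputable def layersList (d q m : ℕ) : List Plane :=
  (List.range m).flatMap (layerList d q)

section
variable {d q : ℕ}

lemma layersList_succ (m : ℕ) : layersList d q (m + 1) = layersList d q m ++ layerList d q m := by
  simp [layersList, List.range_succ]

lemma mem_layerList {i : ℕ} {p : Plane} :
    p ∈ layerList d q i ↔ ∃ j ≤ layerSteps d q i, layerPoint d q i j = p := by
  simp only [layerList, List.mem_map, List.mem_range, Nat.lt_succ_iff]
  split_ifs with h
  · rfl
  · constructor
    · rintro ⟨j, hj, rfl⟩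
      exact ⟨_, Nat.sub_le _ _, rfl⟩
    · rintro ⟨j, hj, rfl⟩
      exact ⟨layerSteps d q i - j, Nat.sub_le _ _, by rw [Nat.sub_sub_self hj]⟩

lemma mem_layersList {m : ℕ} {p : Plane} :
    p ∈ layersList d q m ↔ ∃ i < m, ∃ j ≤ layerSteps d q i, layerPoint d q i j = p := by
  simp only [layersList, List.mem_flatMap, List.mem_range, mem_layerList]

lemma head?_layerList (i : ℕ) : (layerList d q i).head? =
    some (layerPoint d q i (if Even i then 0 else layerSteps d q i)) := by
  simp [layerList, List.range_succ_eq_map]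

lemma getLast?_layerList (i : ℕ) : (layerList d q i).getLast? =
    some (layerPoint d q i (if Even i then layerSteps d q i else 0)) := by
  simp [layerList, List.range_succ]

lemma layerPoint_injective (hd : 5 ≤ d) (hq : 2 * d ^ d ≤ q) (i : ℕ) :
    Function.Injective (layerPoint d q i) := by
  intro j k h
  have := congrArg (fun p : Plane => p 0) h
  simp only [layerPoint_zero, add_right_inj, mul_eq_mul_right_iff,
    (layerGap_pos hd hq i).ne', or_false, Nat.cast_inj] at this
  exact this

lemma nodup_layersList (hd : 5 ≤ d) (hq : 2 * d ^ d ≤ q) (m : ℕ) : (layersList d q m).Nodup := by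
  induction m with
  | zero => simp [layersList]
  | succ m ih =>
    rw [layersList_succ, List.nodup_append']
    refine ⟨ih, ?_, ?_⟩
    · refine List.Nodup.map_on ?_ List.nodup_range
      intro j hj k hk h
      rw [List.mem_range] at hj hk
      have := layerPoint_injective hd hq m h
      split_ifs at this <;> omega
    · intro p hp hp'
      obtain ⟨i, hi, j, -, rfl⟩ := mem_layersList.1 hp
      obtain ⟨k, -, hk⟩ := mem_layerList.1 hp'
      have := congrArg (fun p : Plane => p 1) hk
      simp only [layerPoint_one] at this
      linarith [five_mul_layerHeight hd hi, layerHeight_pos hd m]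

lemma length_layersList (m : ℕ) :
    (layersList d q m).length = ∑ i ∈ Finset.range m, (layerSteps d q i + 1) := by
  induction m with
  | zero => simp [layersList]
  | succ m ih => rw [layersList_succ, List.length_append, ih, Finset.sum_range_succ]; simp [layerList]

lemma layerPoint_last (hd : 5 ≤ d) (hq : 2 * d ^ d ≤ q) (i : ℕ) :
    layerPoint d q i (layerSteps d q i) 0 = 1 := by
  have : (layerSteps d q i : ℝ) ≠ 0 := by exact_mod_cast (layerSteps_pos hd hq i).ne'
  rw [layerPoint_zero, layerGap, mul_div_cancel₀ _ this]
  ring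

lemma le_layerPoint (hd : 5 ≤ d) (hq : 2 * d ^ d ≤ q) (i j : ℕ) :
    layerLeft d i ≤ layerPoint d q i j 0 := by
  rw [layerPoint_zero]
  have := layerGap_pos hd hq i
  linarith [mul_nonneg (Nat.cast_nonneg (α := ℝ) j) this.le]

lemma layerPoint_le (hd : 5 ≤ d) (hq : 2 * d ^ d ≤ q) {i j : ℕ} (hj : j ≤ layerSteps d q i) :
    layerPoint d q i j 0 ≤ 1 := by
  rw [← layerPoint_last hd hq i, layerPoint_zero, layerPoint_zero]
  have h1 := layerGap_pos hd hq i
  have h2 : (j : ℝ) ≤ layerSteps d q i := by exact_mod_cast hj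
  nlinarith

lemma isChain_layerList (hd : 5 ≤ d) (hq : 2 * d ^ d ≤ q) {i : ℕ} (hi : i ≤ d) :
    List.IsChain (IsLayeredEdge d q) (layerList d q i) := by
  rw [layerList, List.isChain_map, List.isChain_range_succ]
  intro j hj
  refine Or.inl ⟨i, hi, by simp, by simp, le_layerPoint hd hq _ _, le_layerPoint hd hq _ _,
    layerPoint_le hd hq ?_, layerPoint_le hd hq ?_, ?_, ?_, ⟨_, layerPoint_zero d q i _⟩⟩
  · split_ifs <;> omega
  · split_ifs <;> omega
  · intro he
    simp only [if_pos he, layerPoint_zero, Nat.succ_eq_add_one]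
    push_cast; ring
  · intro ho
    have he : ¬ Even i := Nat.not_even_iff_odd.2 ho
    have hc : layerSteps d q i - j = (layerSteps d q i - j.succ) + 1 := by omega
    simp only [if_neg he]
    rw [hc, layerPoint_zero, layerPoint_zero]
    push_cast; ring

/-- The junctions are vertical. At odd i the next layer is even, hence not the last layer d, so both
ends have abscissa 0; at even i both have abscissa 1. -/
lemma isChain_layersList (hdo : Odd d) (hd : 5 ≤ d) (hq : 2 * d ^ d ≤ q) {m : ℕ} (hm : m ≤ d + 1) :
    List.IsChain (IsLayeredEdge d q) (layersList d q m) := by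
  induction m with
  | zero => simp [layersList]
  | succ m ih =>
    rw [layersList_succ, List.isChain_append]
    refine ⟨ih (by omega), isChain_layerList hd hq (by omega), ?_⟩
    intro x hx y hy
    cases m with
    | zero => simp [layersList] at hx
    | succ i =>
      rw [layersList_succ, List.getLast?_append, getLast?_layerList, Option.some_or,
        Option.mem_some_iff] at hx
      rw [head?_layerList, Option.mem_some_iff] at hy
      subst hx hy
      have hlast : ∀ i, layerPoint d q i (layerSteps d q i) 0 = 1 := layerPoint_last hd hq
      have hleft : ∀ j, 0 < j → j < d → layerPoint d q j 0 0 = 0 := fun j h0 h1 => by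
        rw [layerPoint_zero, layerLeft, if_neg (by omega)]; simp
      refine Or.inr (Or.inl ⟨i, by omega, layerPoint_one .., layerPoint_one .., ?_, ?_, ?_⟩)
      · rcases Nat.even_or_odd i with hi | hi
        · rw [if_pos hi, if_neg (by rw [Nat.even_add_one]; tauto), hlast, hlast]
        · have hid : i + 1 ≠ d := by
            rintro rfl
            rw [Nat.odd_add_one] at hdo
            exact hdo hi
          rw [if_neg (Nat.not_even_iff_odd.2 hi),
            if_pos (by rw [Nat.even_add_one]; exact Nat.not_even_iff_odd.2 hi),
            hleft _ (by omega) (by omega), hleft _ hi.pos (by omega)]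
      · intro hi
        rw [if_pos hi, hlast]
      · intro hi
        rw [if_neg (Nat.not_even_iff_odd.2 hi), hleft _ hi.pos (by omega)]

lemma le_pathLength_layersList (hd : 5 ≤ d) (hq : 2 * d ^ d ≤ q) (m : ℕ) :
    (m : ℝ) ≤ pathLength (layersList d q m) := by
  induction m with
  | zero => simp [layersList, pathLength]
  | succ m ih =>
    rw [layersList_succ]
    have h1 : 1 ≤ dist (layerPoint d q m 0) (layerPoint d q m (layerSteps d q m)) := by
      refine le_trans ?_ (sub_le_plane_dist' _ _ 0)
      rw [layerPoint_last hd hq, layerPoint_zero]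
      have := layerLeft_le d m
      push_cast; linarith
    have h2 : 1 ≤ pathLength (layerList d q m) := by
      have := dist_head_last_le_pathLength (head?_layerList (d := d) (q := q) m)
        (getLast?_layerList m)
      split_ifs at this
      · linarith
      · rw [dist_comm] at this; linarith
    have := pathLength_add_le (layersList d q m) (layerList d q m)
    push_cast
    linarith

/-- The layered instance has a long 2-optimal tour. -/
lemma exists_long_twoOptimal (hdo : Odd d) (hd : 5 ≤ d) (hq : 2 * d ^ d ≤ q) :
    ∃ V : Finset Plane, V.card = ∑ i ∈ Finset.range (d + 1), (layerSteps d q i + 1) ∧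
      (∀ p, p ∈ V ↔ p ∈ layersList d q (d + 1)) ∧
      ∃ σ : Equiv.Perm V, IsTwoOptimal σ ∧ (d : ℝ) ≤ length σ := by
  classical
  set l := layersList d q (d + 1) with hl
  have hnd : l.Nodup := nodup_layersList hd hq _
  have hcard : l.toFinset.card = ∑ i ∈ Finset.range (d + 1), (layerSteps d q i + 1) := by
    rw [List.toFinset_card_of_nodup hnd, hl, length_layersList]
  have hhead : l.head? = some (layerPoint d q 0 0) := by
    have : ∀ m, (layersList d q (m + 1)).head? = some (layerPoint d q 0 0) := by
      intro m
      induction m with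
      | zero => simp [layersList, head?_layerList]
      | succ m ih => rw [layersList_succ, List.head?_append, ih]; rfl
    exact this d
  have hlast : l.getLast? = some (layerPoint d q d 0) := by
    rw [hl, layersList_succ, List.getLast?_append, getLast?_layerList, Option.some_or,
      if_neg (Nat.not_even_iff_odd.2 hdo)]
  have hchain := isChain_layersList hdo hd hq le_rfl
  rw [← hl] at hchain
  have hlen := le_pathLength_layersList hd hq (d + 1)
  rw [← hl] at hlen
  refine ⟨l.toFinset, hcard, fun p => List.mem_toFinset, ?_⟩
  have hclosed : List.IsChain (IsLayeredEdge d q) (l ++ [layerPoint d q 0 0]) := by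
    rw [List.isChain_append]
    refine ⟨hchain, by simp, ?_⟩
    intro x hx y hy
    rw [hlast, Option.mem_some_iff] at hx
    simp only [List.head?_cons, Option.mem_some_iff] at hy
    subst hx hy
    have h0 : layerLeft d 0 = -1 := by simp [layerLeft]
    have h1 : layerLeft d d = -1 := by simp [layerLeft]
    exact Or.inr (Or.inr ⟨layerPoint_one .., layerPoint_one .., by simp [h0, h1], by simp [h1]⟩)
  have h3 : 3 ≤ l.toFinset.card := by
    rw [hcard]
    calc 3 ≤ ∑ i ∈ Finset.range (d + 1), 1 := by simp; omega
      _ ≤ _ := Finset.sum_le_sum fun i _ => by omega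
  obtain ⟨l', hl'⟩ : ∃ l', l = layerPoint d q 0 0 :: l' := by
    cases hll : l with
    | nil => rw [hll] at hhead; simp at hhead
    | cons a l' =>
      rw [hll] at hhead
      simp only [List.head?_cons, Option.some.injEq] at hhead
      exact ⟨l', by rw [hhead]⟩
  rw [hl'] at hclosed hnd
  obtain ⟨σ, hσ, hR, hσl⟩ := exists_tour_of_list h3 hnd
    (fun x => by rw [List.mem_toFinset, hl']) hclosed
  refine ⟨σ, ⟨hσ, fun a x hax => ?_⟩, ?_⟩
  · exact (hR a).twoOpt hdo hd hq (hR x) fun h => hax (Subtype.ext h)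
  · rw [hσl, ← hl']
    have := pathLength_add_le l [layerPoint d q 0 0]
    rw [pathLength_singleton] at this
    push_cast at hlen
    linarith

/-- Round the abscissa down to the grid of the last layer. -/
lemma exists_layerPoint_near (hd : 5 ≤ d) (hq : 2 * d ^ d ≤ q) {p : Plane} (h0 : -1 ≤ p 0)
    (h1 : p 0 ≤ 1) :
    ∃ j ≤ q, dist (layerPoint d q d j) p ≤ layerGap d q d + |layerHeight d d - p 1| := by
  have hg := layerGap_pos hd hq d
  have hl : layerLeft d d = -1 := by simp [layerLeft]
  have hN : layerSteps d q d = q := by simp [layerSteps]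
  have hqg : -1 + q * layerGap d q d = 1 := by
    have := layerPoint_last hd hq d
    rwa [layerPoint_zero, hl, hN] at this
  set j := ⌊(p 0 + 1) / layerGap d q d⌋₊ with hj
  have hnn : 0 ≤ (p 0 + 1) / layerGap d q d := div_nonneg (by linarith) hg.le
  have hj1 : j * layerGap d q d ≤ p 0 + 1 := by
    have := Nat.floor_le hnn
    rwa [le_div_iff₀ hg] at this
  have hj2 : p 0 + 1 ≤ (j + 1) * layerGap d q d := by
    have := (Nat.lt_floor_add_one ((p 0 + 1) / layerGap d q d)).le
    rwa [div_le_iff₀ hg] at this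
  refine ⟨j, ?_, ?_⟩
  · have : (j : ℝ) ≤ q := by
      by_contra! hlt
      nlinarith
    exact_mod_cast this
  · have hle : ∀ a b : Plane, dist a b ≤ |a 0 - b 0| + |a 1 - b 1| := fun a b => by
      refine (le_abs_self _).trans (abs_le_of_sq_le_sq ?_ (by positivity))
      rw [plane_dist_sq, ← sq_abs (a 0 - b 0), ← sq_abs (a 1 - b 1)]
      nlinarith [abs_nonneg (a 0 - b 0), abs_nonneg (a 1 - b 1)]
    refine (hle _ _).trans (add_le_add ?_ (by rw [layerPoint_one]))
    rw [layerPoint_zero, hl, abs_le]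
    constructor <;> linarith

/-- The layered instance has a short closed walk. -/
lemma hasClosedWalk_layers (hd : 5 ≤ d) (hq : 2 * d ^ d ≤ q) :
    HasClosedWalk {p | p ∈ layersList d q (d + 1)} (layerPoint d q d 0) 16 := by
  classical
  have hg := layerGap_pos hd hq d
  have hl : layerLeft d d = -1 := by simp [layerLeft]
  have hN : layerSteps d q d = q := by simp [layerSteps]
  have hqg : q * layerGap d q d = 2 := by
    have := layerPoint_last hd hq d
    rw [layerPoint_zero, hl, hN] at this
    linarith
  have h0 : (0 : ℝ) < d := by exact_mod_cast (by omega : 0 < d)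
  -- Back and forth along the last layer, which has width 2.
  have hbase : HasClosedWalk {p | p ∈ layerList d q d} (layerPoint d q d 0) 4 := by
    refine ⟨(List.range q).map fun j => layerPoint d q d (j + 1), ?_, ?_⟩
    · intro x
      rw [Set.mem_ofPred_eq, mem_layerList, hN]
      simp only [List.mem_cons, List.mem_map, List.mem_range]
      constructor
      · rintro ⟨j, hj, rfl⟩
        cases j with
        | zero => exact Or.inl rfl
        | succ j => exact Or.inr ⟨j, by omega, rfl⟩
      · rintro (rfl | ⟨j, hj, rfl⟩)
        · exact ⟨0, by omega, rfl⟩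
        · exact ⟨j + 1, by omega, rfl⟩
    · have hlist : layerPoint d q d 0 :: (List.range q).map (fun j => layerPoint d q d (j + 1)) =
          (List.range (q + 1)).map (layerPoint d q d) := by
        rw [List.range_succ_eq_map, List.map_cons, List.map_map]; rfl
      have hd1 : ∀ j k : ℕ, dist (layerPoint d q d j) (layerPoint d q d k) =
          |(j : ℝ) - k| * layerGap d q d := by
        intro j k
        rw [plane_dist_of_snd_eq (by simp), layerPoint_zero, layerPoint_zero,
          show layerLeft d d + j * layerGap d q d - (layerLeft d d + k * layerGap d q d) =
            ((j : ℝ) - k) * layerGap d q d by ring, abs_mul, abs_of_pos hg]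
      rw [hlist, List.range_succ, List.map_append, List.map_singleton, List.append_assoc,
        List.singleton_append, pathLength_append, ← List.map_singleton, ← List.map_append,
        ← List.range_succ, pathLength_map_range]
      simp only [pathLength_cons_cons, pathLength_singleton, hd1]
      have : ∀ k : ℕ, |(k : ℝ) - ((k + 1 : ℕ) : ℝ)| = 1 := fun k => by
        push_cast; rw [show (k : ℝ) - (k + 1) = -1 by ring]; norm_num
      simp only [this, one_mul, Finset.sum_const, Finset.card_range, nsmul_eq_mul]
      rw [Nat.cast_zero, sub_zero, Nat.abs_cast, hqg]
      norm_num
  -- Each further layer is reached by detours from the last layer and costs at most 12/d; with d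
  -- layers this gives 4 + 12 = 16.
  have hind : ∀ m ≤ d, HasClosedWalk {p | p ∈ layersList d q m ∨ p ∈ layerList d q d}
      (layerPoint d q d 0) (4 + m * (12 / d)) := by
    intro m
    induction m with
    | zero =>
      intro _
      simpa [layersList] using hbase
    | succ m ih =>
      intro hm
      have hstep := (ih (by omega)).union_image (δ := layerGap d q d + layerHeight d m)
        (Finset.range (layerSteps d q m + 1)) (layerPoint d q m) (by
          intro j hj
          rw [Finset.mem_range, Nat.lt_succ_iff] at hj
          have hlm : -1 ≤ layerLeft d m := by unfold layerLeft; split_ifs <;> norm_num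
          obtain ⟨k, hk, hkd⟩ := exists_layerPoint_near hd hq
            (hlm.trans (le_layerPoint hd hq m j)) (layerPoint_le hd hq hj)
          refine ⟨_, Or.inr (mem_layerList.2 ⟨k, by rwa [hN], rfl⟩), hkd.trans ?_⟩
          rw [layerPoint_one]
          have h1 := layerHeight_pos hd d
          have h2 := five_mul_layerHeight hd (show m < d by omega)
          rw [abs_of_nonpos (by linarith)]
          linarith)
      have hset : {p | p ∈ layersList d q m ∨ p ∈ layerList d q d} ∪
          layerPoint d q m '' (Finset.range (layerSteps d q m + 1) : Finset ℕ) =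
          {p | p ∈ layersList d q (m + 1) ∨ p ∈ layerList d q d} := by
        ext p
        simp only [layersList_succ, List.mem_append, Set.mem_union, Set.mem_ofPred_eq,
          Set.mem_image, Finset.coe_range, Set.mem_Iio, Nat.lt_succ_iff]
        rw [← mem_layerList]; tauto
      rw [hset] at hstep
      refine hstep.mono ?_
      rw [Finset.card_range]
      obtain ⟨e, rfl⟩ : ∃ e, d = e + 1 := ⟨d - 1, by omega⟩
      have g1 := layerGap_le hd hq (show e < e + 1 by omega)
      have g2 := layerHeight_anti hd (show m ≤ e by omega)
      have hp := layerHeight_pos hd m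
      have hc : ((layerSteps (e + 1) q m + 1 : ℕ) : ℝ) ≤ 2 * ((e + 1 : ℕ) : ℝ) ^ m := by
        have : layerSteps (e + 1) q m + 1 ≤ 2 * (e + 1) ^ m := by
          have : 0 < (e + 1) ^ m := by positivity
          rw [layerSteps, if_pos (by omega)]; omega
        exact_mod_cast this
      have hy : layerHeight (e + 1) m * ((e + 1 : ℕ) : ℝ) ^ m = 2 / ((e + 1 : ℕ) : ℝ) := by
        unfold layerHeight
        rw [pow_succ]
        field_simp
      have hpow : (0 : ℝ) < ((e + 1 : ℕ) : ℝ) ^ m := by positivity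
      -- A detour costs twice at most 3/2 of the height of layer m, there are at most 2·d^m of them,
      -- and the height is 2/d^(m+1).
      have hfin : 2 * (layerGap (e + 1) q (e + 1) + layerHeight (e + 1) m) *
          ((layerSteps (e + 1) q m + 1 : ℕ) : ℝ) ≤ 12 / ((e + 1 : ℕ) : ℝ) := by
        calc _ ≤ (3 * layerHeight (e + 1) m) * (2 * ((e + 1 : ℕ) : ℝ) ^ m) :=
              mul_le_mul (by linarith) hc (by positivity) (by positivity)
          _ = 6 * (layerHeight (e + 1) m * ((e + 1 : ℕ) : ℝ) ^ m) := by ring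
          _ = _ := by rw [hy]; ring
      rw [Nat.cast_add_one m]
      linarith
  have hfin := (hind d le_rfl).mono (B' := 16) (by
    rw [mul_div_cancel₀ _ h0.ne']; norm_num)
  convert hfin using 1
  ext p
  rw [Set.mem_ofPred_eq, Set.mem_ofPred_eq, layersList_succ, List.mem_append]

/-- The first d layers use at most 2·d^d points; all remaining points go into the last layer, which
is then fine enough and makes the total exactly n. -/
lemma exists_large_ratio (hdo : Odd d) (hd : 5 ≤ d) {n : ℕ} (hn : 5 * d ^ d ≤ n) :
    ∃ r ∈ twoOptRatios n, (d : ℝ) / 16 ≤ r := by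
  have hpow : ∑ i ∈ Finset.range d, d ^ i ≤ d ^ d := by
    have := Nat.geomSum_lt (n := d) (s := Finset.range d) (m := d) (by omega)
      (fun i hi => Finset.mem_range.1 hi)
    exact this.le
  have hdd : d ≤ d ^ d := Nat.le_self_pow (by omega) d
  obtain ⟨q, hq⟩ : ∃ q, n = ∑ i ∈ Finset.range d, (d ^ i + 1) + (q + 1) := by
    refine ⟨n - ∑ i ∈ Finset.range d, (d ^ i + 1) - 1, ?_⟩
    rw [Finset.sum_add_distrib, Finset.sum_const, Finset.card_range, smul_eq_mul, mul_one]
    omega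
  have hq2 : 2 * d ^ d ≤ q := by
    rw [Finset.sum_add_distrib, Finset.sum_const, Finset.card_range, smul_eq_mul, mul_one] at hq
    omega
  obtain ⟨V, hVc, hV, σ, hσ, hσl⟩ := exists_long_twoOptimal hdo hd hq2
  have hcard : V.card = n := by
    rw [hVc, hq, Finset.sum_range_succ]
    congr 1
    · exact Finset.sum_congr rfl fun i hi => by
        rw [layerSteps, if_pos (Finset.mem_range.1 hi)]
    · simp [layerSteps]
  have hwalk := hasClosedWalk_layers hd hq2
  rw [show {p | p ∈ layersList d q (d + 1)} = (V : Set Plane) from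
    Set.ext fun p => (hV p).symm] at hwalk
  obtain ⟨τ, hτ, hτl⟩ := hwalk.exists_tour hσ.1.1
  obtain ⟨τ', hτ'⟩ := exists_optimal hτ
  refine ⟨_, ⟨V, hcard, σ, τ', hσ.isTwoOptOutput, hτ', rfl⟩, ?_⟩
  have := (hτ'.2 τ hτ).trans hτl
  have hpos := hτ'.1.length_pos
  rw [div_le_div_iff₀ (by norm_num) hpos]
  nlinarith [Nat.cast_nonneg (α := ℝ) d]

end

end EuclideanTSP

/-! ### Asymptotics -/

namespace EuclideanTSP
open Filter

lemma twoOptApproxRatio_le {n : ℕ} (hn : 4 ≤ n) (hL : 1 < Real.log n) :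
    twoOptApproxRatio n ≤ 280 * (Real.log n / Real.log (Real.log n)) := by
  set L := Real.log n with hLdef
  have hll : 0 < Real.log L := Real.log_pos hL
  -- With K = √L one has log K = (log L)/2, so the logarithmic term is of order L/log L while K
  -- itself is of smaller order. The constant is 8·(1 + 34).
  have hK : 1 < √L := by rw [Real.lt_sqrt (by norm_num)]; simpa using hL
  have hn4 : (4 : ℝ) ≤ n := by exact_mod_cast hn
  have hpoly : Real.log (((n : ℝ) + 1) ^ 4 + 1) ≤ 8 * L := by
    rw [hLdef, show (8 : ℝ) = ((8 : ℕ) : ℝ) by norm_num, ← Real.log_pow]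
    refine Real.log_le_log (by positivity) ?_
    have h1 : (n : ℝ) + 1 ≤ n ^ 2 / 2 := by nlinarith
    have h2 : ((n : ℝ) + 1) ^ 4 ≤ (n ^ 2 / 2) ^ 4 := by gcongr
    have h3 : (4 : ℝ) ^ 8 ≤ n ^ 8 := by gcongr
    have h4 : ((n : ℝ) ^ 2 / 2) ^ 4 = n ^ 8 / 16 := by ring
    linarith
  have hsqrt : √L ≤ 2 * (L / Real.log L) := by
    rw [← mul_div_assoc, le_div_iff₀ hll]
    have h1 : Real.log L = 2 * Real.log √L := by
      rw [Real.log_sqrt (by linarith)]; ring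
    have h2 := Real.log_le_sub_one_of_pos (show 0 < √L by linarith)
    have h3 := Real.mul_self_sqrt (show 0 ≤ L by linarith)
    rw [h1]
    nlinarith
  refine csSup_le (twoOptRatios_nonempty (by omega)) fun r hr => ?_
  refine (le_of_mem_twoOptRatios hr hK).trans ?_
  have hfrac : (1 + 2 * Real.log (((n : ℝ) + 1) ^ 4 + 1)) / Real.log √L ≤
      34 * (L / Real.log L) := by
    rw [Real.log_sqrt (by linarith), ← mul_div_assoc, div_le_div_iff₀ (by linarith) hll]
    nlinarith
  linarith

lemma le_twoOptApproxRatio {n : ℕ} (hn : 0 < n) (hll : 1 ≤ Real.log (Real.log n))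
    (hL : 8 * Real.log (Real.log n) ≤ Real.log n) :
    Real.log n / Real.log (Real.log n) / 64 ≤ twoOptApproxRatio n := by
  set L := Real.log n with hLdef
  set x := L / Real.log L with hx
  have hx8 : 8 ≤ x := by rwa [hx, le_div_iff₀ (by linarith)]
  have hxL : x ≤ L := div_le_self (by linarith) hll
  have hxl : x * Real.log L = L := div_mul_cancel₀ _ (by linarith)
  -- An odd number of size about x/2, where d^d is at most about exp((x/2)·log L) = √n, leaving room
  -- for the factor 5. Since x ≥ 8, also d ≥ x/4, and the ratio d/16 is at least x/64.
  set d := 2 * ⌊x / 4⌋₊ + 1 with hd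
  have hf1 : (⌊x / 4⌋₊ : ℝ) ≤ x / 4 := Nat.floor_le (by linarith)
  have hf2 := Nat.lt_floor_add_one (x / 4)
  have hdc : (d : ℝ) = 2 * ⌊x / 4⌋₊ + 1 := by rw [hd]; push_cast; ring
  have hd5 : 5 ≤ d := by
    have : 2 ≤ ⌊x / 4⌋₊ := Nat.le_floor (by push_cast; linarith)
    omega
  have hd0 : (0 : ℝ) < d := by exact_mod_cast (by omega : 0 < d)
  have hdlog : Real.log d ≤ Real.log L := Real.log_le_log hd0 (by linarith)
  have hlog5 : Real.log 5 ≤ 2 := by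
    rw [Real.log_le_iff_le_exp (by norm_num)]
    have h1 := Real.exp_one_gt_d9
    rw [show (2 : ℝ) = 1 + 1 by norm_num, Real.exp_add]
    nlinarith
  have hsize : 5 * d ^ d ≤ n := by
    have : (5 : ℝ) * (d : ℝ) ^ d ≤ n := by
      rw [← Real.log_le_log_iff (by positivity) (by exact_mod_cast hn),
        Real.log_mul (by norm_num) (by positivity), Real.log_pow]
      have : (d : ℝ) * Real.log d ≤ (x / 2 + 1) * Real.log L :=
        mul_le_mul (by linarith) hdlog
          (Real.log_nonneg (by exact_mod_cast (by omega : 1 ≤ d))) (by linarith)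
      linarith
    exact_mod_cast this
  obtain ⟨r, hr, hdr⟩ := exists_large_ratio ⟨_, hd⟩ hd5 hsize
  have := le_csSup (bddAbove_twoOptRatios n) hr
  unfold twoOptApproxRatio
  linarith

lemma twoOptApproxRatio_isTheta : Asymptotics.IsTheta atTop twoOptApproxRatio
    (fun n : ℕ => Real.log (n : ℝ) / Real.log (Real.log (n : ℝ))) := by
  have hlog : Tendsto (fun n : ℕ => Real.log (n : ℝ)) atTop atTop :=
    Real.tendsto_log_atTop.comp tendsto_natCast_atTop_atTop
  have hlog1 := hlog.eventually_gt_atTop 1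
  have hloglog := (Real.tendsto_log_atTop.comp hlog).eventually_ge_atTop 1
  have hsmall := hlog.eventually
    (Real.isLittleO_log_id_atTop.bound (show (0 : ℝ) < 1 / 8 by norm_num))
  have hbounds : ∀ᶠ n : ℕ in atTop, 0 ≤ Real.log (n : ℝ) / Real.log (Real.log (n : ℝ)) ∧
      Real.log n / Real.log (Real.log n) / 64 ≤ twoOptApproxRatio n ∧
      twoOptApproxRatio n ≤ 280 * (Real.log n / Real.log (Real.log n)) := by
    filter_upwards [hlog1, hloglog, hsmall, eventually_ge_atTop 4] with n h1 h2 h3 h4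
    simp only [Function.comp_apply] at h2
    simp only [id, Real.norm_eq_abs] at h3
    rw [abs_of_nonneg (by linarith), abs_of_nonneg (by linarith)] at h3
    exact ⟨div_nonneg (by linarith) (by linarith),
      le_twoOptApproxRatio (by omega) h2 (by linarith), twoOptApproxRatio_le h4 h1⟩
  constructor
  · refine Asymptotics.IsBigO.of_bound 280 ?_
    filter_upwards [hbounds] with n ⟨h0, h1, h2⟩
    rwa [Real.norm_of_nonneg (by linarith), Real.norm_of_nonneg h0]
  · refine Asymptotics.IsBigO.of_bound 64 ?_
    filter_upwards [hbounds] with n ⟨h0, h1, h2⟩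
    rw [Real.norm_of_nonneg h0, Real.norm_of_nonneg (by linarith)]
    linarith

end EuclideanTSP

theorem theorem1 :
    (∀ n : ℕ, 3 ≤ n → (EuclideanTSP.twoOptRatios n).Nonempty ∧
      BddAbove (EuclideanTSP.twoOptRatios n)) ∧
    Asymptotics.IsTheta Filter.atTop EuclideanTSP.twoOptApproxRatio
      (fun n : ℕ => Real.log (n : ℝ) / Real.log (Real.log (n : ℝ))) :=
  ⟨fun n hn => ⟨EuclideanTSP.twoOptRatios_nonempty hn, EuclideanTSP.bddAbove_twoOptRatios n⟩,
    EuclideanTSP.twoOptApproxRatio_isTheta⟩
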